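/- **Notation.** Let $N\ge 1$ be an integer, $0<r<\infty$, and let $R$ run over the seven types $A_{N-1},B_N,B_N^\vee,C_N,C_N^\vee,BC_N,D_N$ of irreducible reduced affine root systems, where for type $D_N$ we take $N\ge 2$. For $v,\tau\in\mathbb C$ with $\operatorname{Im}\tau>0$ put $z=e^{v\pi i}$, $q=q(\tau)=e^{\tau\pi i}$, $q_0(\tau)=\prod_{n\ge1}(1-q^{2n})$ and $$\vartheta_0(v;\tau)=\sum_{n\in\mathbb Z}(-1)^nq^{n^2}z^{2n},\quad \vartheta_1(v;\tau)=i\sum_{n\in\mathbb Z}(-1)^nq^{(n-1/2)^2}z^{2n-1},\quad \vartheta_3(v;\tau)=\sum_{n\in\mathbb Z}q^{n^2}z^{2n}$$ (where $q^{c}=e^{c\tau\pi i}$). The Macdonald denominators of $\boldsymbol\xi\in\mathbb C^N$ are $$W^{A_{N-1}}(\boldsymbol\xi;\tau)=\prod_{j<k}\vartheta_1(\xi_k-\xi_j;\tau),\qquad W^{D_N}(\boldsymbol\xi;\tau)=\prod_{j<k}\vartheta_1(\xi_k-\xi_j;\tau)\,\vartheta_1(\xi_k+\xi_j;\tau),$$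 and $W^R(\boldsymbol\xi;\tau)=W^{D_N}(\boldsymbol\xi;\tau)\prod_{\ell=1}^N w^R(\xi_\ell;\tau)$ for the other types (here $W^{D_N}$ denotes the displayed product, for every $N\ge1$), where $w^{B_N}=\vartheta_1(\xi;\tau)$, $w^{B_N^\vee}=\vartheta_1(2\xi;2\tau)$, $w^{C_N}=\vartheta_1(2\xi;\tau)$, $w^{C_N^\vee}=\vartheta_1(\xi;\tau/2)$, $w^{BC_N}=\vartheta_1(\xi;\tau)\vartheta_0(2\xi;2\tau)$. Let $J^R(j)=j-\tfrac12$ for $A_{N-1},C_N^\vee$; $J^R(j)=j-1$ for $B_N,B_N^\vee,D_N$; $J^R(j)=j$ for $C_N,BC_N$. Let $\mathcal N^R=N,\ 2N-1,\ 2N,\ 2(N+1),\ 2N,\ 2N+1,\ 2(N-1)$ for $R=A_{N-1},B_N,B_N^\vee,C_N,C_N^\vee,BC_N,D_N$ respectively. Let $\xi(x)=\frac{x}{2\pi r}$, $\tau(t)=\frac{it}{2\pi r^2}$, $\xi(\mathbf x)=(\xi(x_1),\dots,\xi(x_N))$. *Kernels* ($0\le s<t$, $x,y\in\mathbb R$).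 With $p^{\rm BM}(s,x;t,y)=\frac{1}{\sqrt{2\pi(t-s)}}e^{-(x-y)^2/(2(t-s))}$, put $$p^{\rm circ}(s,x;t,y)=\sum_{w\in\mathbb Z}\epsilon_N^{\,w}\,p^{\rm BM}(s,x;t,y+2\pi rw),\qquad \epsilon_N=-1\ (N\text{ even}),\ \ \epsilon_N=1\ (N\text{ odd}),$$ $$p^{\rm ar}(s,x;t,y)=\frac1{\pi r}\sum_{n\in\mathbb Z}e^{-(n-1/2)^2(t-s)/2r^2}\sin\!\big((n-\tfrac12)\tfrac xr\big)\sin\!\big((n-\tfrac12)\tfrac yr\big),$$ $$p^{\rm aa}(s,x;t,y)=\frac1{\pi r}\sum_{n\in\mathbb Z}e^{-n^2(t-s)/2r^2}\sin\tfrac{nx}r\sin\tfrac{ny}r,\qquad p^{\rm rr}(s,x;t,y)=\frac1{\pi r}\sum_{n\in\mathbb Z}e^{-n^2(t-s)/2r^2}\cos\tfrac{nx}r\cos\tfrac{ny}r .$$ ($p^{\rm circ}$ is the kernel of Brownian motion on the circle of radius $r$, with windings signed for even $N$; the others are the transition densities of Brownian motion in $[0,\pi r]$: absorbed at $0$ and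 reflected at $\pi r$ (ar), absorbed at both ends (aa), reflected at both ends (rr).) Let $\mathsf p^\sharp(s,\mathbf x;t,\mathbf y)=\big(p^\sharp(s,x_j;t,y_k)\big)_{1\le j,k\le N}$. *Initial configurations* $\mathbf v^R=(v^R_j)_{j=1}^N$: $v^{A_{N-1}}_j=\frac{2\pi r}{N}(j-1)$; $v^R_j=\frac{2\pi r}{\mathcal N^R}(j-\frac12)$ for $B_N,B_N^\vee$; $v^R_j=\frac{2\pi r}{\mathcal N^R}j$ for $C_N,C_N^\vee,BC_N$; $v^{D_N}_j=\frac{\pi r}{N-1}(j-1)$. *Matrices* $\mathsf r^R(t)$, $1\le j,k\le N$. Write $\mathcal N=\mathcal N^R$, $J=J^R(j)$, $v_k=v^R_k$, $E=e^{-\pi iJ^2\tau(t)}$, $S_k=\sin\!\big[(\mathcal N-2J)\frac{v_k}{2r}\big]$, $S_*=\sin\!\big[(\mathcal N-2J)\frac{\pi}{2}\big]$, and $C_k$, $C_*$ for the same with $\cos$. Then $(\mathsf r^R(t))_{jk}$ equals: - $A_{N-1}$: $\frac{2\pi r}{\mathcal N}E\,e^{-i(\mathcal N-2J)v_k/2r}$;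 - $B_N$: $\frac{4\pi r}{\mathcal N}E\,S_k$ for $k\le N-1$, and $\frac{2\pi r}{\mathcal N}E\,S_*$ for $k=N$; - $B_N^\vee$: $\frac{4\pi r}{\mathcal N}E\,S_k$; - $C_N$, $BC_N$: $\frac{4\pi r}{i\mathcal N}E\,S_k$; - $C_N^\vee$: $\frac{4\pi r}{i\mathcal N}E\,S_k$ for $k\le N-1$, and $\frac{2\pi r}{i\mathcal N}E\,S_*$ for $k=N$; - $D_N$: $\frac{2\pi r}{\mathcal N}E$ for $k=1$, $\frac{4\pi r}{\mathcal N}E\,C_k$ for $2\le k\le N-1$, and $\frac{2\pi r}{\mathcal N}E\,C_*$ for $k=N$. *Factors* $a^R(t)$. With $T=\mathcal N^R\tau(t)$ (so that $q(T)>0$): $$\begin{aligned} a^{A_{N-1}}&=q(T)^{-N(3N-1)/8}q_0(T)^{-(N-1)(N-2)/2}, & a^{B_N}&=2q(T)^{-N(N-1)/4}q_0(T)^{-N(N-1)},\\ a^{B_N^\vee}&=2q(T)^{-N(N-1)/4}q_0(T)^{-(N-1)^2}q_0(2T)^{-(N-1)}, & a^{C_N}&=q(T)^{-N^2/4}q_0(T)^{-N(N-1)},\\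 a^{C_N^\vee}&=q(T)^{-N(2N-1)/8}q_0(T)^{-(N-1)^2}q_0(T/2)^{-(N-1)}, & a^{BC_N}&=q(T)^{-N(N+1)/4}q_0(T)^{-N(N-1)}q_0(2T)^{-N},\\ a^{D_N}&=4q(T)^{-N(N-1)/4}q_0(T)^{-N(N-2)}. \end{aligned}$$ *Coefficients* $b^R(t)$: $$b^{R}(t)=\begin{cases} i^{N(N+1)/2}\,\det[\mathsf r^{R}(t)]/a^{R}(t), & R=A_{N-1},\ N\text{ even},\\ i^{(N-1)(N-2)/2}\,\det[\mathsf r^{R}(t)]/a^{R}(t), & R=A_{N-1},\ N\text{ odd},\\ \det[\mathsf r^{R}(t)]/a^{R}(t), & R=B_N,B_N^\vee,D_N,\\ i^{N}\det[\mathsf r^{R}(t)]/a^{R}(t), & R=C_N,C_N^\vee,BC_N.\end{cases}$$ **Proposition.** Let $s(N)=0$ if $N$ is even and $s(N)=3$ if $N$ is odd. For all $t>0$ and all $\mathbf x\in\mathbb R^N$, $$\vartheta_{s(N)}\Big(\sum_{j=1}^N\xi(x_j);N\tau(t)\Big)\,W^{A_{N-1}}(\xi(\mathbf x);N\tau(t))=b^{A_{N-1}}(t)\,\det[\mathsf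 p^{\rm circ}(0,\mathbf v^{A_{N-1}};t,\mathbf x)],$$ $$W^{R}(\xi(\mathbf x);\mathcal N^{R}\tau(t))=\begin{cases} b^{R}(t)\det[\mathsf p^{\rm ar}(0,\mathbf v^{R};t,\mathbf x)], & R=B_N,C_N^\vee,BC_N,\\ b^{R}(t)\det[\mathsf p^{\rm aa}(0,\mathbf v^{R};t,\mathbf x)], & R=B_N^\vee,C_N,\\ b^{D_N}(t)\det[\mathsf p^{\rm rr}(0,\mathbf v^{D_N};t,\mathbf x)], & R=D_N\ (N\ge 2).\end{cases}$$ -/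

import Mathlib

noncomputable section

namespace MacdonaldKM

/-! ### Jacobi theta functions

With `z = exp (v π i)` and `q = exp (τ π i)`, `0 < Im τ`. -/

/-- `ϑ₀(v; τ) = ∑ₙ (-1)ⁿ q^{n²} z^{2n}`. -/
def theta0 (v τ : ℂ) : ℂ :=
  ∑' n : ℤ, (-1 : ℂ) ^ n * Complex.exp (Real.pi * Complex.I * τ * (n : ℂ) ^ 2)
    * Complex.exp (Real.pi * Complex.I * v * (2 * (n : ℂ)))

/-- `ϑ₁(v; τ) = i ∑ₙ (-1)ⁿ q^{(n-1/2)²} z^{2n-1}`. -/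
def theta1 (v τ : ℂ) : ℂ :=
  Complex.I * ∑' n : ℤ, (-1 : ℂ) ^ n
    * Complex.exp (Real.pi * Complex.I * τ * ((n : ℂ) - 1 / 2) ^ 2)
    * Complex.exp (Real.pi * Complex.I * v * (2 * (n : ℂ) - 1))

/-- `ϑ₃(v; τ) = ∑ₙ q^{n²} z^{2n}`. -/
def theta3 (v τ : ℂ) : ℂ :=
  ∑' n : ℤ, Complex.exp (Real.pi * Complex.I * τ * (n : ℂ) ^ 2)
    * Complex.exp (Real.pi * Complex.I * v * (2 * (n : ℂ)))

/-- `ϑ₃` is Mathlib's two-variable Jacobi theta function. -/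
theorem theta3_eq_jacobiTheta₂ (v τ : ℂ) : theta3 v τ = jacobiTheta₂ v τ := by
  unfold theta3 jacobiTheta₂ jacobiTheta₂_term
  refine tsum_congr fun n => ?_
  rw [← Complex.exp_add]
  congr 1
  ring

/-! ### The seven types and the Macdonald denominators -/

/-- The seven types of irreducible reduced affine root systems
`A_{N-1}, B_N, B_N^∨, C_N, C_N^∨, BC_N, D_N`; the rank parameter `N` is kept separate. -/
inductive RootType
  | A | B | Bv | C | Cv | BC | D

/-- The (normalized) Macdonald denominator `W^R(ξ; τ)`. -/
def macdonaldW (R : RootType) {N : ℕ} (ξ : Fin N → ℂ) (τ : ℂ) : ℂ :=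
  let prodA : ℂ := ∏ j : Fin N, ∏ k ∈ Finset.Ioi j, theta1 (ξ k - ξ j) τ
  let prodD : ℂ := ∏ j : Fin N, ∏ k ∈ Finset.Ioi j,
    (theta1 (ξ k - ξ j) τ * theta1 (ξ k + ξ j) τ)
  match R with
  | .A => prodA
  | .B => (∏ l, theta1 (ξ l) τ) * prodD
  | .Bv => (∏ l, theta1 (2 * ξ l) (2 * τ)) * prodD
  | .C => (∏ l, theta1 (2 * ξ l) τ) * prodD
  | .Cv => (∏ l, theta1 (ξ l) (τ / 2)) * prodD
  | .BC => (∏ l, (theta1 (ξ l) τ * theta0 (2 * ξ l) (2 * τ))) * prodD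
  | .D => prodD

/-- `J^R(j)`, for the index `j = 1, 2, …, N`. -/
def indexJ (R : RootType) (j : ℕ) : ℝ :=
  match R with
  | .A | .Cv => (j : ℝ) - 1 / 2
  | .B | .Bv | .D => (j : ℝ) - 1
  | .C | .BC => (j : ℝ)

/-- The number `𝒩^R`. -/
def calN (R : RootType) (N : ℕ) : ℝ :=
  match R with
  | .A => (N : ℝ)
  | .B => 2 * (N : ℝ) - 1
  | .Bv | .Cv => 2 * (N : ℝ)
  | .C => 2 * ((N : ℝ) + 1)
  | .BC => 2 * (N : ℝ) + 1
  | .D => 2 * ((N : ℝ) - 1)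

/-- `ξ(x) = x / (2 π r)`. -/
def xiVar (r x : ℝ) : ℂ := (x : ℂ) / (2 * Real.pi * r)

/-- `τ(t) = i t / (2 π r²)`. -/
def tauVar (r t : ℝ) : ℂ := Complex.I * t / (2 * Real.pi * (r : ℂ) ^ 2)

/-! ### Transition densities -/

/-- Transition density of one-dimensional standard Brownian motion. -/
def pBM (s x t y : ℝ) : ℝ :=
  1 / Real.sqrt (2 * Real.pi * (t - s)) * Real.exp (-(x - y) ^ 2 / (2 * (t - s)))

/-- Brownian motion on the circle of radius `r`; windings are signed when `N` is even. -/
def pCirc (N : ℕ) (r s x t y : ℝ) : ℝ :=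
  if Even N then ∑' w : ℤ, (-1 : ℝ) ^ w * pBM s x t (y + 2 * Real.pi * r * w)
  else ∑' w : ℤ, pBM s x t (y + 2 * Real.pi * r * w)

/-- Brownian motion in `[0, π r]`, absorbing at `0` and reflecting at `π r`. -/
def pAr (r s x t y : ℝ) : ℝ :=
  1 / (Real.pi * r) * ∑' n : ℤ,
    Real.exp (-((n : ℝ) - 1 / 2) ^ 2 * (t - s) / (2 * r ^ 2))
      * Real.sin (((n : ℝ) - 1 / 2) * (x / r)) * Real.sin (((n : ℝ) - 1 / 2) * (y / r))

/-- Brownian motion in `[0, π r]`, absorbing at both ends. -/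
def pAa (r s x t y : ℝ) : ℝ :=
  1 / (Real.pi * r) * ∑' n : ℤ,
    Real.exp (-(n : ℝ) ^ 2 * (t - s) / (2 * r ^ 2))
      * Real.sin ((n : ℝ) * x / r) * Real.sin ((n : ℝ) * y / r)

/-- Brownian motion in `[0, π r]`, reflecting at both ends. -/
def pRr (r s x t y : ℝ) : ℝ :=
  1 / (Real.pi * r) * ∑' n : ℤ,
    Real.exp (-(n : ℝ) ^ 2 * (t - s) / (2 * r ^ 2))
      * Real.cos ((n : ℝ) * x / r) * Real.cos ((n : ℝ) * y / r)

/-- The Karlin--McGregor--Lindström--Gessel--Viennot determinant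
`det [p(s, x_j; t, y_k)]` of a transition density `p`. -/
def kmlgvDet (p : ℝ → ℝ → ℝ → ℝ → ℝ) {N : ℕ} (s : ℝ) (x : Fin N → ℝ) (t : ℝ)
    (y : Fin N → ℝ) : ℝ :=
  Matrix.det (Matrix.of fun j k : Fin N => p s (x j) t (y k))

/-! ### The initial configurations and the coefficients -/

/-- `v^R_j`, for the index `j = 1, 2, …, N`. -/
def vPoint (R : RootType) (N : ℕ) (r : ℝ) (j : ℕ) : ℝ :=
  match R with
  | .A => 2 * Real.pi * r / N * ((j : ℝ) - 1)
  | .B | .Bv => 2 * Real.pi * r / calN R N * ((j : ℝ) - 1 / 2)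
  | .C | .Cv | .BC => 2 * Real.pi * r / calN R N * (j : ℝ)
  | .D => Real.pi * r / ((N : ℝ) - 1) * ((j : ℝ) - 1)

/-- The configuration `v^R = (v^R_1, …, v^R_N)`. -/
def vConf (R : RootType) (N : ℕ) (r : ℝ) : Fin N → ℝ :=
  fun j => vPoint R N r ((j : ℕ) + 1)

/-- The entry `(r^R(t))_{jk}`, for indices `j, k = 1, 2, …, N`. -/
def rEntry (R : RootType) (N : ℕ) (r t : ℝ) (j k : ℕ) : ℂ :=
  let n : ℝ := calN R N
  let m : ℝ := n - 2 * indexJ R j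
  let v : ℝ := vPoint R N r k
  let e : ℂ := Complex.exp (-Real.pi * Complex.I * (indexJ R j : ℂ) ^ 2 * tauVar r t)
  match R with
  | .A => 2 * Real.pi * r / n
      * Complex.exp (-Real.pi * Complex.I * (indexJ .A j : ℂ) ^ 2 * tauVar r t
          - Complex.I * m * v / (2 * r))
  | .B =>
      if k = N then 2 * Real.pi * r / n * e * Real.sin (m * Real.pi / 2)
      else 4 * Real.pi * r / n * e * Real.sin (m * (v / (2 * r)))
  | .Bv => 4 * Real.pi * r / n * e * Real.sin (m * (v / (2 * r)))
  | .C | .BC => 4 * Real.pi * r / (Complex.I * n) * e * Real.sin (m * (v / (2 * r)))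
  | .Cv =>
      if k = N then 2 * Real.pi * r / (Complex.I * n) * e * Real.sin (m * Real.pi / 2)
      else 4 * Real.pi * r / (Complex.I * n) * e * Real.sin (m * (v / (2 * r)))
  | .D =>
      if k = 1 then 2 * Real.pi * r / n * e
      else if k = N then 2 * Real.pi * r / n * e * Real.cos (m * Real.pi / 2)
      else 4 * Real.pi * r / n * e * Real.cos (m * (v / (2 * r)))

/-- The matrix `r^R(t)`. -/
def rMatrix (R : RootType) (N : ℕ) (r t : ℝ) : Matrix (Fin N) (Fin N) ℂ :=
  Matrix.of fun j k => rEntry R N r t ((j : ℕ) + 1) ((k : ℕ) + 1)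

/-- `q(τ) = exp (τ π i)`. -/
def nome (τ : ℂ) : ℂ := Complex.exp (τ * Real.pi * Complex.I)

/-- `q₀(τ) = ∏_{n ≥ 1} (1 - q(τ)^{2n})`. -/
def nomeProd (τ : ℂ) : ℂ := ∏' n : ℕ, (1 - nome τ ^ (2 * (n + 1)))

/-- The factor `a^R(t)`. The bases `q(𝒩 τ(t)) = exp (-𝒩 t / (2 r²))` are positive reals, so the
powers with fractional exponents are the positive ones. All divisions in the integer exponents
are exact. -/
def aCoeff (R : RootType) (N : ℕ) (r t : ℝ) : ℂ :=
  let T : ℂ := calN R N * tauVar r t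
  let c : ℂ := N
  let d : ℤ := N
  match R with
  | .A => nome T ^ (-(c * (3 * c - 1) / 8)) * nomeProd T ^ (-((d - 1) * (d - 2) / 2))
  | .B => 2 * nome T ^ (-(c * (c - 1) / 4)) * nomeProd T ^ (-(d * (d - 1)))
  | .Bv => 2 * nome T ^ (-(c * (c - 1) / 4)) * nomeProd T ^ (-(d - 1) ^ 2)
      * nomeProd (2 * T) ^ (-(d - 1))
  | .C => nome T ^ (-(c ^ 2 / 4)) * nomeProd T ^ (-(d * (d - 1)))
  | .Cv => nome T ^ (-(c * (2 * c - 1) / 8)) * nomeProd T ^ (-(d - 1) ^ 2)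
      * nomeProd (T / 2) ^ (-(d - 1))
  | .BC => nome T ^ (-(c * (c + 1) / 4)) * nomeProd T ^ (-(d * (d - 1)))
      * nomeProd (2 * T) ^ (-d)
  | .D => 4 * nome T ^ (-(c * (c - 1) / 4)) * nomeProd T ^ (-(d * (d - 2)))

/-- The coefficient `b^R(t)`. -/
def bCoeff (R : RootType) (N : ℕ) (r t : ℝ) : ℂ :=
  let ρ : ℂ := (rMatrix R N r t).det / aCoeff R N r t
  match R with
  | .A => if Even N then Complex.I ^ (N * (N + 1) / 2) * ρ
      else Complex.I ^ ((N - 1) * (N - 2) / 2) * ρ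
  | .B | .Bv | .D => ρ
  | .C | .Cv | .BC => Complex.I ^ N * ρ

end MacdonaldKM

end

/-!
Fix all variables but one. The Macdonald denominator and the determinant of transition densities
are then entire functions of the remaining variable `ξ` with the same multipliers for the periods
`1` and `τ = i L / π`, of degree `M = 𝒩` (`QuasiPeriodic`), and outside type `A` of the same parity.
In type `A` this requires the extra theta function of the sum of the variables. Such functions form
a space of dimension `M`. The point is that the values on a lattice of mesh `1 / M` determine them
(`QuasiPeriodic.eq_zero_of_lattice`): the period `τ` gives a recursion for the Fourier
coefficients, so on the lattice each residue class of frequencies contributes one Fourier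
coefficient times a sum of positive numbers. The initial configuration consists of these lattice
points or, outside type `A`, of one representative of every pair of mirror images (`IsFold`), except
fixed points at which the functions vanish anyhow; with the parity, the values there determine the
function (`QuasiPeriodic.eq_zero_of_nodes`). Consequently an alternating function of `N` variables
with slices in this space is unique up to a factor, and `W(x) det k(y) = W(y) det k(x)` for the nodes
`y` and the determinant `det k` of the kernel (`alternating_mul_det_eq`).

It remains to find the factor, that is, to compare `W(y)` with `det k(y)`. The matrix `R` is a
discrete Fourier transform on the lattice, folded onto the alcove. Trigonometric functions are
eigenvectors of the kernel on the lattice, with Gaussian sums `gaussSum` as eigenvalues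
(`sum_cis_mul_thetaChar`, `sum_nodes_reflKernel`). So the product of `R` with the matrix `k(y)` is a
diagonal matrix times a matrix of exponentials, sines or cosines, and the determinant of the latter
is given by a Weyl denominator formula (`det_cis`, `det_sin_int`, `det_sin_half`, `det_cos`). On the
other side, Jacobi's triple product (`tendsto_triple_product`, `theta1_eq_exp`) writes `W(y)` as the
same product of sines times the exponential of a sum of the values `logCos L x` of the logarithm of
the infinite product `∏ (1 - 2 q^{2n} cos (2πx) + q^{4n})`, and also evaluates the Gaussian sums
(`tsum_exp_quadratic`, `exp_mul_gaussSum`).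

The nodes are division points, so the cyclotomic factorization of `1 - ρ^M` collapses the products
over nodes and over pairs of nodes (`sum_logCos`, `sum_nodes_logCos`, `sum_pairs_logCos`), and in
the same way the product of the Gaussian sums (`sum_logShift`, `sum_fold_logShift`). What is left are
values of `logEuler`, the logarithm of `q₀`, at a few multiples of `L`; comparing them (`balance_B`
and its analogues) yields the factor `a^R`. The comparison is assembled in `denominator_eq_det` for
the types other than `A` and in `macdonaldW_A` for type `A`.
-/

noncomputable section

namespace MacdonaldKM

section

open Filter Topology Finset

/-! ### Jacobi's triple product -/

/-- Gaussian binomial coefficients, defined by the `q`-Pascal recursion. -/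
def gaussBinom (p : ℝ) : ℕ → ℕ → ℝ
  | _, 0 => 1
  | 0, _ + 1 => 0
  | n + 1, k + 1 => p ^ (k + 1) * gaussBinom p n (k + 1) + gaussBinom p n k

/-- The finite product `(p; p)_n`. -/
def qFactorial (p : ℝ) (n : ℕ) : ℝ := ∏ i ∈ range n, (1 - p ^ (i + 1))

lemma gaussBinom_zero_right (p : ℝ) (n : ℕ) : gaussBinom p n 0 = 1 := by
  cases n <;> rfl

lemma gaussBinom_eq_zero (p : ℝ) : ∀ n k : ℕ, n < k → gaussBinom p n k = 0
  | _, 0, h => by omega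
  | 0, k + 1, _ => rfl
  | n + 1, k + 1, h => by
    rw [gaussBinom, gaussBinom_eq_zero p n (k + 1) (by omega), gaussBinom_eq_zero p n k (by omega)]
    simp

/-- Gaussian binomial coefficients as quotients of `qFactorial`. -/
lemma gaussBinom_mul (p : ℝ) (n : ℕ) : ∀ a b : ℕ, a + b = n →
    gaussBinom p n a * (qFactorial p a * qFactorial p b) = qFactorial p n := by
  induction n with
  | zero =>
    intro a b h
    obtain ⟨rfl, rfl⟩ : a = 0 ∧ b = 0 := by omega
    simp [gaussBinom, qFactorial]
  | succ n ih =>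
    intro a b h
    cases a with
    | zero =>
      obtain rfl : b = n + 1 := by omega
      simp [gaussBinom, qFactorial]
    | succ a =>
      rw [gaussBinom]
      have e1 : qFactorial p (a + 1) = qFactorial p a * (1 - p ^ (a + 1)) := prod_range_succ _ _
      have e3 : qFactorial p (n + 1) = qFactorial p n * (1 - p ^ (n + 1)) := prod_range_succ _ _
      cases b with
      | zero =>
        obtain rfl : a = n := by omega
        have h2 := ih a 0 (by omega)
        rw [gaussBinom_eq_zero p a (a + 1) (by omega), e3]
        linear_combination (1 - p ^ (a + 1)) * h2
      | succ b =>
        have h1 := ih (a + 1) b (by omega)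
        have h2 := ih a (b + 1) (by omega)
        have e2 : qFactorial p (b + 1) = qFactorial p b * (1 - p ^ (b + 1)) := prod_range_succ _ _
        obtain rfl : n = a + (b + 1) := by omega
        rw [e3]
        have : p ^ (a + (b + 1) + 1) = p ^ (a + 1) * p ^ (b + 1) := by ring
        rw [this]
        rw [e1] at h1 ⊢
        rw [e2] at h2 ⊢
        linear_combination p ^ (a + 1) * (1 - p ^ (b + 1)) * h1 + (1 - p ^ (a + 1)) * h2

/-- The `q`-binomial theorem. -/
lemma prod_one_add_mul_pow (p : ℝ) (n : ℕ) : ∀ x : ℂ,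
    ∏ i ∈ range n, (1 + x * (p : ℂ) ^ i)
      = ∑ k ∈ range (n + 1), (gaussBinom p n k : ℂ) * (p : ℂ) ^ (k.choose 2) * x ^ k := by
  induction n with
  | zero => intro x; simp [gaussBinom]
  | succ n ih =>
    intro x
    rw [prod_range_succ']
    have : ∏ k ∈ range n, (1 + x * (p : ℂ) ^ (k + 1))
        = ∏ k ∈ range n, (1 + (x * p) * (p : ℂ) ^ k) :=
      prod_congr rfl fun k _ => by ring
    rw [this, ih, sum_range_succ' _ (n + 1)]
    simp only [gaussBinom]
    have h2 : ∀ k : ℕ, ((p ^ (k + 1) * gaussBinom p n (k + 1) + gaussBinom p n k : ℝ) : ℂ)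
          * (p : ℂ) ^ ((k + 1).choose 2) * x ^ (k + 1)
        = (gaussBinom p n (k + 1) : ℂ) * (p : ℂ) ^ ((k + 1).choose 2) * (x * p) ^ (k + 1)
          + ((gaussBinom p n k : ℂ) * (p : ℂ) ^ (k.choose 2) * (x * p) ^ k) * x := by
      intro k
      have : (k + 1).choose 2 = k + k.choose 2 := by
        rw [Nat.choose_succ_succ' k 1, Nat.choose_one_right]
      rw [this]
      push_cast
      ring
    simp only [h2, sum_add_distrib, ← sum_mul]
    have h3 := sum_range_succ' (fun k => (gaussBinom p n k : ℂ) * (p : ℂ) ^ (k.choose 2)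
      * (x * p) ^ k) (n + 1)
    rw [sum_range_succ _ (n + 1), gaussBinom_eq_zero p n (n + 1) (by omega)] at h3
    simp only [gaussBinom_zero_right] at h3
    have : ∑ k ∈ range (n + 1), (gaussBinom p n (k + 1) : ℂ) * (p : ℂ) ^ ((k + 1).choose 2)
        * (x * p) ^ (k + 1) = ∑ k ∈ range (n + 1), (gaussBinom p n k : ℂ) * (p : ℂ) ^ (k.choose 2)
      * (x * p) ^ k - 1 := by
      rw [eq_sub_iff_add_eq]
      simp at h3
      simpa using h3.symm
    rw [this]
    simp
    ring

/-- The finite form of Jacobi's triple product. -/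
lemma finite_triple_product {q : ℝ} (hq : 0 < q) {w : ℂ} (hw : w ≠ 0) (m : ℕ) :
    ∏ n ∈ range m, ((1 + (q : ℂ) ^ (2 * n + 1) * w) * (1 + (q : ℂ) ^ (2 * n + 1) * w⁻¹))
      = ∑ j ∈ Icc (-(m : ℤ)) m,
        (gaussBinom (q ^ 2) (2 * m) (m + j).toNat : ℂ) * ((q : ℂ) ^ (j ^ 2) * w ^ j) := by
  have hq' : (q : ℂ) ≠ 0 := by exact_mod_cast hq.ne'
  have key := prod_one_add_mul_pow (q ^ 2) (2 * m) (w * (q : ℂ) ^ (1 - 2 * (m : ℤ)))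
  have hL : ∏ i ∈ range (2 * m), (1 + w * (q : ℂ) ^ (1 - 2 * (m : ℤ)) * ((q ^ 2 : ℝ) : ℂ) ^ i)
      = w ^ m * (q : ℂ) ^ (-(m : ℤ) ^ 2) *
      ∏ n ∈ range m, ((1 + (q : ℂ) ^ (2 * n + 1) * w) * (1 + (q : ℂ) ^ (2 * n + 1) * w⁻¹)) := by
    have h1 : ∏ n ∈ range m, (w * (q : ℂ) ^ (-(2 * (n : ℤ) + 1)))
        = w ^ m * (q : ℂ) ^ (-(m : ℤ) ^ 2) := by
      rw [prod_mul_distrib, prod_const, card_range]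
      congr 1
      clear key
      induction m with
      | zero => simp
      | succ m ih =>
        rw [prod_range_succ, ih, ← zpow_add₀ hq']
        congr 1
        push_cast
        ring
    rw [two_mul, prod_range_add, ← prod_range_reflect, ← h1, ← prod_mul_distrib,
      ← prod_mul_distrib]
    refine prod_congr rfl fun n hn => ?_
    have hn' := mem_range.1 hn
    have e1 : w * (q : ℂ) ^ (1 - 2 * (m : ℤ)) * ((q ^ 2 : ℝ) : ℂ) ^ (m - 1 - n)
        = w * (q : ℂ) ^ (-(2 * (n : ℤ) + 1)) := by
      push_cast
      rw [← pow_mul, ← zpow_natCast, mul_assoc, ← zpow_add₀ hq']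
      congr 2
      push_cast [Nat.cast_sub (show n ≤ m - 1 by omega), Nat.cast_sub (show 1 ≤ m by omega)]
      ring
    have e2 : w * (q : ℂ) ^ (1 - 2 * (m : ℤ)) * ((q ^ 2 : ℝ) : ℂ) ^ (m + n)
        = (q : ℂ) ^ (2 * n + 1) * w := by
      push_cast
      rw [← pow_mul, ← zpow_natCast, mul_assoc, ← zpow_add₀ hq', mul_comm, ← zpow_natCast]
      congr 2
      push_cast
      ring
    rw [e1, e2]
    have e3 : (q : ℂ) ^ (-(2 * (n : ℤ) + 1)) = ((q : ℂ) ^ (2 * n + 1))⁻¹ := by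
      rw [zpow_neg]; norm_cast
    rw [e3]
    field_simp
    ring
  rw [hL] at key
  have hne : w ^ m * (q : ℂ) ^ (-(m : ℤ) ^ 2) ≠ 0 := mul_ne_zero (pow_ne_zero _ hw) (zpow_ne_zero _ hq')
  apply mul_left_cancel₀ hne
  rw [key, mul_sum]
  refine sum_bij' (fun k _ => (k : ℤ) - m) (fun j _ => (m + j).toNat) ?_ ?_ ?_ ?_ ?_
  · intro k hk; simp at hk ⊢; omega
  · intro j hj; simp at hj ⊢; omega
  · intro k hk; simp
  · intro j hj; simp at hj; simp; omega
  · intro k hk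
    have : (m + ((k : ℤ) - m)).toNat = k := by omega
    rw [this]
    have e1 : ((q ^ 2 : ℝ) : ℂ) ^ (k.choose 2) = (q : ℂ) ^ ((k : ℤ) ^ 2 - k) := by
      push_cast
      rw [← pow_mul, ← zpow_natCast]
      congr 1
      have h2 : k * (k - 1) = 2 * k.choose 2 := by
        rw [Nat.choose_two_right, Nat.mul_div_cancel' (Nat.even_mul_pred_self k).two_dvd]
      rw [← h2]
      cases k
      · simp
      · push_cast [Nat.add_sub_cancel]
        ring
    rw [e1, mul_pow, ← zpow_natCast ((q : ℂ) ^ (1 - 2 * (m : ℤ))), ← zpow_mul]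
    have e2 : w ^ ((k : ℤ) - m) = w ^ k * (w ^ m)⁻¹ := by
      rw [zpow_sub₀ hw]; simp [div_eq_mul_inv]
    rw [e2]
    have e3 : (q : ℂ) ^ ((k : ℤ) ^ 2 - k) * (q : ℂ) ^ ((1 - 2 * (m : ℤ)) * k)
        = (q : ℂ) ^ (-(m : ℤ) ^ 2) * (q : ℂ) ^ (((k : ℤ) - m) ^ 2) := by
      rw [← zpow_add₀ hq', ← zpow_add₀ hq']; congr 1; ring
    have hwm : w ^ m ≠ 0 := pow_ne_zero _ hw
    calc _ = (gaussBinom (q ^ 2) (2 * m) k : ℂ) * w ^ k * ((q : ℂ) ^ ((k : ℤ) ^ 2 - k) * (q : ℂ) ^ ((1 - 2 * (m : ℤ)) * k)) := by ring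
      _ = _ := by rw [e3]; field_simp

lemma qFactorial_pos {p : ℝ} (hp : 0 < p) (hp1 : p < 1) (n : ℕ) : 0 < qFactorial p n :=
  prod_pos fun i _ => by
    have : p ^ (i + 1) < 1 := pow_lt_one₀ hp.le hp1 (by omega)
    linarith

lemma qFactorial_eq_exp {p : ℝ} (hp : 0 < p) (hp1 : p < 1) (n : ℕ) :
    qFactorial p n = Real.exp (∑ i ∈ range n, Real.log (1 - p ^ (i + 1))) := by
  rw [Real.exp_sum]
  refine prod_congr rfl fun i _ => (Real.exp_log ?_).symm
  have : p ^ (i + 1) < 1 := pow_lt_one₀ hp.le hp1 (by omega)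
  linarith

lemma summable_log_one_sub_pow {p : ℝ} (hp : 0 < p) (hp1 : p < 1) :
    Summable fun n : ℕ => Real.log (1 - p ^ (n + 1)) := by
  simp only [sub_eq_add_neg]
  apply Real.summable_log_one_add_of_summable
  exact ((summable_nat_add_iff 1).2 (summable_geometric_of_lt_one hp.le hp1)).neg

lemma tendsto_qFactorial {p : ℝ} (hp : 0 < p) (hp1 : p < 1) :
    Tendsto (qFactorial p) atTop (𝓝 (Real.exp (∑' n : ℕ, Real.log (1 - p ^ (n + 1))))) := by
  have := (summable_log_one_sub_pow hp hp1).hasSum.tendsto_sum_nat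
  exact ((Real.continuous_exp.tendsto _).comp this).congr fun n =>
    (qFactorial_eq_exp hp hp1 n).symm

lemma qFactorial_antitone {p : ℝ} (hp : 0 < p) (hp1 : p < 1) : Antitone (qFactorial p) :=
  antitone_nat_of_succ_le fun n => by
    rw [qFactorial, prod_range_succ]
    have h1 := qFactorial_pos hp hp1 n
    have : 0 < p ^ (n + 1) := pow_pos hp _
    exact mul_le_of_le_one_right h1.le (by linarith)

/-- Jacobi's triple product, as a limit of finite products. -/
lemma tendsto_triple_product {q : ℝ} (hq : 0 < q) (hq1 : q < 1) {w : ℂ} (hw : w ≠ 0)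
    (hs : Summable fun j : ℤ => (q : ℂ) ^ (j ^ 2) * w ^ j) :
    Tendsto (fun m : ℕ => (qFactorial (q ^ 2) m : ℂ) *
        ∏ n ∈ range m, ((1 + (q : ℂ) ^ (2 * n + 1) * w) * (1 + (q : ℂ) ^ (2 * n + 1) * w⁻¹)))
      atTop (𝓝 (∑' j : ℤ, (q : ℂ) ^ (j ^ 2) * w ^ j)) := by
  have hp : 0 < q ^ 2 := by positivity
  have hp1 : q ^ 2 < 1 := pow_lt_one₀ hq.le hq1 (by norm_num)
  set p := q ^ 2 with hpdef
  set c := Real.exp (∑' n : ℕ, Real.log (1 - p ^ (n + 1))) with hc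
  have hc0 : 0 < c := Real.exp_pos _
  have hlim := tendsto_qFactorial hp hp1
  have hge : ∀ n, c ≤ qFactorial p n := (qFactorial_antitone hp hp1).le_of_tendsto hlim
  have hle : ∀ n, qFactorial p n ≤ 1 := fun n => by
    simpa [qFactorial] using qFactorial_antitone hp hp1 (Nat.zero_le n)
  let f : ℕ → ℤ → ℂ := fun m j =>
    if j ∈ Icc (-(m : ℤ)) m then
      ((qFactorial p m * gaussBinom p (2 * m) (m + j).toNat : ℝ) : ℂ)
        * ((q : ℂ) ^ (j ^ 2) * w ^ j) else 0
  -- The Gaussian binomial coefficients in terms of `q`-factorials.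
  have hform : ∀ (m : ℕ) (j : ℤ), j ∈ Icc (-(m : ℤ)) m →
      qFactorial p m * gaussBinom p (2 * m) (m + j).toNat
        = qFactorial p m * qFactorial p (2 * m)
          / (qFactorial p (m + j).toNat * qFactorial p (m - j).toNat) := by
    intro m j hj
    rw [mem_Icc] at hj
    rw [← gaussBinom_mul p (2 * m) (m + j).toNat (m - j).toNat (by omega)]
    have h1 := (qFactorial_pos hp hp1 (m + j).toNat).ne'
    have h2 := (qFactorial_pos hp hp1 (m - j).toNat).ne'
    field_simp
  have hf : ∀ m, (qFactorial p m : ℂ) *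
        ∏ n ∈ range m, ((1 + (q : ℂ) ^ (2 * n + 1) * w) * (1 + (q : ℂ) ^ (2 * n + 1) * w⁻¹))
        = ∑' j, f m j := by
    intro m
    rw [finite_triple_product hq hw, tsum_eq_sum (s := Icc (-(m : ℤ)) m)
      (fun j hj => by simp only [f, if_neg hj]), mul_sum]
    refine sum_congr rfl fun j hj => ?_
    simp only [f, if_pos hj]
    push_cast
    ring
  simp only [hf]
  refine tendsto_tsum_of_dominated_convergence
    (bound := fun j => c⁻¹ ^ 2 * ‖(q : ℂ) ^ (j ^ 2) * w ^ j‖) (hs.norm.mul_left _) ?_ ?_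
  · intro j
    have hj1 : Tendsto (fun m : ℕ => qFactorial p m * qFactorial p (2 * m)
          / (qFactorial p (m + j).toNat * qFactorial p (m - j).toNat)) atTop
        (𝓝 (c * c / (c * c))) := by
      refine (hlim.mul (hlim.comp ?_)).div ((hlim.comp ?_).mul (hlim.comp ?_)) (by positivity)
      · exact tendsto_atTop_mono (fun n => by simp only [id]; omega) tendsto_id
      · exact tendsto_atTop.2 fun b => by
          filter_upwards [eventually_ge_atTop (b + j.natAbs)] with a ha
          omega
      · exact tendsto_atTop.2 fun b => by
          filter_upwards [eventually_ge_atTop (b + j.natAbs)] with a ha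
          omega
    rw [div_self (by positivity)] at hj1
    have hj2 : Tendsto (fun m : ℕ => ((qFactorial p m * qFactorial p (2 * m)
          / (qFactorial p (m + j).toNat * qFactorial p (m - j).toNat) : ℝ) : ℂ)
        * ((q : ℂ) ^ (j ^ 2) * w ^ j)) atTop (𝓝 ((1 : ℝ) * ((q : ℂ) ^ (j ^ 2) * w ^ j))) :=
      ((Complex.continuous_ofReal.tendsto _).comp hj1).mul_const _
    rw [Complex.ofReal_one, one_mul] at hj2
    refine hj2.congr' ?_
    filter_upwards [eventually_ge_atTop j.natAbs] with m hm
    have : j ∈ Icc (-(m : ℤ)) m := by rw [mem_Icc]; omega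
    simp only [f, if_pos this, hform m j this]
  · refine Eventually.of_forall fun m j => ?_
    by_cases hj : j ∈ Icc (-(m : ℤ)) m
    · simp only [f, if_pos hj]
      rw [norm_mul]
      gcongr
      rw [hform m j hj, Complex.norm_real, Real.norm_eq_abs]
      have h0 := fun n => qFactorial_pos hp hp1 n
      rw [abs_of_pos (div_pos (mul_pos (h0 _) (h0 _)) (mul_pos (h0 _) (h0 _)))]
      rw [inv_pow, ← one_div, sq]
      apply div_le_div₀ zero_le_one _ (by positivity)
      · exact mul_le_mul (hge _) (hge _) hc0.le (h0 _).le
      · exact mul_le_one₀ (hle _) (h0 _).le (hle _)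
    · simp only [f, if_neg hj, norm_zero]
      positivity

end

section

open Filter Topology Finset

/-! ### Logarithms of infinite products -/

/-- `log ∏ (1 - q^{2n})` over `n ≥ 1`, for `q = exp (-L)`. -/
def logEuler (L : ℝ) : ℝ := ∑' n : ℕ, Real.log (1 - Real.exp (-(2 * L * (n + 1))))

/-- `log ∏ (1 + q^{2(n + a)})` over `n ≥ 0`, for `q = exp (-L)`. -/
def logShift (L a : ℝ) : ℝ := ∑' n : ℕ, Real.log (1 + Real.exp (-(2 * L * (n + a))))

/-- The factor `1 - 2 ρ cos (2 π x) + ρ² = |1 - ρ e^{2 π i x}|²`. -/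
def cosFactor (ρ x : ℝ) : ℝ := 1 - 2 * ρ * Real.cos (2 * Real.pi * x) + ρ ^ 2

/-- `log ∏ (1 - 2 q^{2n} cos (2 π x) + q^{4n})` over `n ≥ 1`, for `q = exp (-L)`. -/
def logCos (L x : ℝ) : ℝ := ∑' n : ℕ, Real.log (cosFactor (Real.exp (-(2 * L * (n + 1)))) x)

lemma cosFactor_pos {ρ : ℝ} (h0 : 0 < ρ) (h1 : ρ < 1) (x : ℝ) : 0 < cosFactor ρ x := by
  have := Real.cos_le_one (2 * Real.pi * x)
  unfold cosFactor
  nlinarith [sq_nonneg (1 - ρ), mul_nonneg h0.le (sub_nonneg.2 this), sq_pos_of_pos (sub_pos.2 h1)]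

lemma cosFactor_neg (ρ x : ℝ) : cosFactor ρ (-x) = cosFactor ρ x := by
  simp [cosFactor]

lemma cosFactor_add_one (ρ x : ℝ) : cosFactor ρ (x + 1) = cosFactor ρ x := by
  simp only [cosFactor, mul_add, mul_one, Real.cos_add_two_pi]

lemma cosFactor_eq_mul (ρ x : ℝ) : (cosFactor ρ x : ℂ)
    = (1 - ρ * Complex.exp (2 * Real.pi * Complex.I * x))
      * (1 - ρ * (Complex.exp (2 * Real.pi * Complex.I * x))⁻¹) := by
  have e1 : Complex.exp (2 * Real.pi * Complex.I * x)
      = Real.cos (2 * Real.pi * x) + Real.sin (2 * Real.pi * x) * Complex.I := by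
    rw [Complex.ofReal_cos, Complex.ofReal_sin, ← Complex.exp_mul_I]
    congr 1; push_cast; ring
  have e2 : (Complex.exp (2 * Real.pi * Complex.I * x))⁻¹
      = Real.cos (2 * Real.pi * x) - Real.sin (2 * Real.pi * x) * Complex.I := by
    rw [e1, inv_eq_of_mul_eq_one_left]
    have h : (Real.cos (2 * Real.pi * x) : ℂ) ^ 2 + (Real.sin (2 * Real.pi * x) : ℂ) ^ 2 = 1 := by
      exact_mod_cast Real.cos_sq_add_sin_sq _
    linear_combination h - (Real.sin (2 * Real.pi * x) : ℂ) ^ 2 * Complex.I_sq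
  rw [e2, e1]
  have h : (Real.cos (2 * Real.pi * x) : ℂ) ^ 2 + (Real.sin (2 * Real.pi * x) : ℂ) ^ 2 = 1 := by
    exact_mod_cast Real.cos_sq_add_sin_sq _
  rw [cosFactor]
  push_cast at h ⊢
  linear_combination (-(ρ : ℂ) ^ 2) * h + (ρ : ℂ) ^ 2 * (Complex.sin (2 * Real.pi * x)) ^ 2 * Complex.I_sq

/-- The cyclotomic factorization `∏_{i < M} |1 - ρ ζ^i e(x)|² = |1 - ρ^M e(M x)|²`. -/
lemma prod_cosFactor {M : ℕ} (hM : 0 < M) (ρ x : ℝ) :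
    ∏ i ∈ range M, cosFactor ρ (x + i / M) = cosFactor (ρ ^ M) (M * x) := by
  have hM' : (M : ℂ) ≠ 0 := by exact_mod_cast hM.ne'
  set ζ := Complex.exp (2 * Real.pi * Complex.I / M) with hζ
  have hprim : IsPrimitiveRoot ζ M := Complex.isPrimitiveRoot_exp M hM.ne'
  have key : ∀ {η : ℂ}, IsPrimitiveRoot η M → ∀ y : ℂ,
      ∏ i ∈ range M, (1 - η ^ i * y) = 1 - y ^ M := by
    intro η hη y
    have := hη.pow_sub_pow_eq_prod_sub_mul (x := 1) (y := y) hM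
    rw [one_pow] at this
    rw [this]
    refine prod_bij (fun i _ => η ^ i) ?_ ?_ ?_ ?_
    · intro i _
      rw [Polynomial.mem_nthRootsFinset hM, ← pow_mul, mul_comm, pow_mul, hη.pow_eq_one, one_pow]
    · intro i hi j hj h
      exact hη.pow_inj (mem_range.1 hi) (mem_range.1 hj) h
    · intro z hz
      rw [Polynomial.mem_nthRootsFinset hM] at hz
      have : NeZero M := ⟨hM.ne'⟩
      obtain ⟨i, hi, rfl⟩ := hη.eq_pow_of_pow_eq_one hz
      exact ⟨i, mem_range.2 hi, rfl⟩
    · intro i _; rfl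
  have hc : ((∏ i ∈ range M, cosFactor ρ (x + i / M) : ℝ) : ℂ) = cosFactor (ρ ^ M) (M * x) := by
    push_cast
    have h1 : ∀ i : ℕ, Complex.exp (2 * Real.pi * Complex.I * ((x + i / M : ℝ) : ℂ))
        = ζ ^ i * Complex.exp (2 * Real.pi * Complex.I * x) := by
      intro i
      rw [hζ, ← Complex.exp_nat_mul, ← Complex.exp_add]
      congr 1; push_cast; ring
    have h2 : Complex.exp (2 * Real.pi * Complex.I * ((M * x : ℝ) : ℂ))
        = Complex.exp (2 * Real.pi * Complex.I * x) ^ M := by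
      rw [← Complex.exp_nat_mul]
      congr 1; push_cast; ring
    simp only [cosFactor_eq_mul, h1, h2, prod_mul_distrib]
    have e1 := key hprim (ρ * Complex.exp (2 * Real.pi * Complex.I * x))
    have e2 := key hprim.inv (ρ * (Complex.exp (2 * Real.pi * Complex.I * x))⁻¹)
    push_cast
    rw [mul_pow] at e1 e2
    rw [← inv_pow, ← e1, ← e2]
    congr 1 <;> refine prod_congr rfl fun i _ => ?_
    · ring
    · rw [mul_inv, inv_pow]; ring
  exact_mod_cast hc

section Summability

lemma exp_neg_lt_one {c : ℝ} (hc : 0 < c) : Real.exp (-c) < 1 := by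
  rw [Real.exp_lt_one_iff]; linarith

lemma summable_exp_neg {c : ℝ} (hc : 0 < c) (a : ℝ) :
    Summable fun n : ℕ => Real.exp (-(c * (n + a))) := by
  have : ∀ n : ℕ, Real.exp (-(c * (n + a))) = Real.exp (-c) ^ n * Real.exp (-(c * a)) := by
    intro n
    rw [← Real.exp_nat_mul, ← Real.exp_add]
    congr 1; ring
  simp only [this]
  exact (summable_geometric_of_lt_one (Real.exp_pos _).le (exp_neg_lt_one hc)).mul_right _

lemma summable_logEuler {L : ℝ} (hL : 0 < L) :
    Summable fun n : ℕ => Real.log (1 - Real.exp (-(2 * L * (n + 1)))) := by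
  simp only [sub_eq_add_neg (1 : ℝ)]
  exact Real.summable_log_one_add_of_summable (summable_exp_neg (by positivity) 1).neg

lemma summable_logShift {L : ℝ} (hL : 0 < L) (a : ℝ) :
    Summable fun n : ℕ => Real.log (1 + Real.exp (-(2 * L * (n + a)))) :=
  Real.summable_log_one_add_of_summable (summable_exp_neg (by positivity) a)

lemma summable_log_cosFactor {f : ℕ → ℝ} (hf0 : ∀ n, 0 < f n) (hf1 : ∀ n, f n < 1)
    (hf : Summable f) (x : ℝ) : Summable fun n => Real.log (cosFactor (f n) x) := by
  have h : Summable fun n => -2 * f n * Real.cos (2 * Real.pi * x) + f n ^ 2 := by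
    refine Summable.add ((hf.mul_left _).mul_right _) ?_
    refine Summable.of_nonneg_of_le (fun n => sq_nonneg _) (fun n => ?_) hf
    nlinarith [hf0 n, hf1 n]
  convert! Real.summable_log_one_add_of_summable h using 3 with n
  unfold cosFactor; ring

lemma summable_logCos {L : ℝ} (hL : 0 < L) (x : ℝ) :
    Summable fun n : ℕ => Real.log (cosFactor (Real.exp (-(2 * L * (n + 1)))) x) :=
  summable_log_cosFactor (fun _ => Real.exp_pos _) (fun n => exp_neg_lt_one (by positivity))
    (summable_exp_neg (by positivity) 1) x

end Summability

lemma logCos_neg (L x : ℝ) : logCos L (-x) = logCos L x := by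
  simp only [logCos, cosFactor_neg]

lemma logCos_add_one (L x : ℝ) : logCos L (x + 1) = logCos L x := by
  simp only [logCos, cosFactor_add_one]

lemma logCos_add_int (L x : ℝ) (m : ℤ) : logCos L (x + m) = logCos L x := by
  have : Function.Periodic (logCos L) 1 := logCos_add_one L
  simpa using this.int_mul m x

lemma logCos_zero (L : ℝ) : logCos L 0 = 2 * logEuler L := by
  unfold logCos logEuler
  rw [← tsum_mul_left]
  refine tsum_congr fun n => ?_
  have : cosFactor (Real.exp (-(2 * L * (n + 1)))) 0
      = (1 - Real.exp (-(2 * L * (n + 1)))) ^ 2 := by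
    simp [cosFactor]; ring
  rw [this, Real.log_pow]; norm_num

lemma logCos_half (L : ℝ) : logCos L (1 / 2) = 2 * logShift L 1 := by
  unfold logCos logShift
  rw [← tsum_mul_left]
  refine tsum_congr fun n => ?_
  have : cosFactor (Real.exp (-(2 * L * (n + 1)))) (1 / 2)
      = (1 + Real.exp (-(2 * L * (n + 1)))) ^ 2 := by
    have h : 2 * Real.pi * (1 / 2) = Real.pi := by ring
    simp only [cosFactor, h, Real.cos_pi]; ring
  rw [this, Real.log_pow]; norm_num

/-- Multiplication formula for `logCos`. -/
lemma sum_logCos {L : ℝ} (hL : 0 < L) {M : ℕ} (hM : 0 < M) (x : ℝ) :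
    ∑ i ∈ range M, logCos L (x + i / M) = logCos (M * L) (M * x) := by
  unfold logCos
  rw [← Summable.tsum_finsetSum fun i _ => summable_logCos hL _]
  refine tsum_congr fun n => ?_
  rw [← Real.log_prod fun i _ =>
    (cosFactor_pos (Real.exp_pos _) (exp_neg_lt_one (by positivity)) _).ne', prod_cosFactor hM,
    ← Real.exp_nat_mul]
  congr 3; ring

/-- Duplication formula for `logCos`. -/
lemma logCos_two_mul {L : ℝ} (hL : 0 < L) (x : ℝ) :
    logCos L (2 * x) = logCos (L / 2) x + logCos (L / 2) (x + 1 / 2) := by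
  have := sum_logCos (half_pos hL) (M := 2) (by norm_num) x
  simp [sum_range_succ] at this
  rw [mul_div_cancel₀ _ (two_ne_zero)] at this
  rw [← this]; norm_num

lemma logShift_one {L : ℝ} (hL : 0 < L) : logShift L 1 = logEuler (2 * L) - logEuler L := by
  unfold logShift logEuler
  rw [← Summable.tsum_sub (summable_logEuler (by positivity)) (summable_logEuler hL)]
  refine tsum_congr fun n => ?_
  have h1 : Real.exp (-(2 * L * (n + 1))) < 1 := exp_neg_lt_one (by positivity)
  have h0 := Real.exp_pos (-(2 * L * (n + 1)))
  have : 1 - Real.exp (-(2 * (2 * L) * (n + 1)))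
      = (1 + Real.exp (-(2 * L * (n + 1)))) * (1 - Real.exp (-(2 * L * (n + 1)))) := by
    have : Real.exp (-(2 * (2 * L) * (n + 1))) = Real.exp (-(2 * L * (n + 1))) ^ 2 := by
      rw [← Real.exp_nat_mul]; congr 1; push_cast; ring
    rw [this]; ring
  rw [this, Real.log_mul (by linarith) (by linarith)]
  ring

lemma logShift_zero {L : ℝ} (hL : 0 < L) : logShift L 0 = Real.log 2 + logShift L 1 := by
  have := (summable_logShift hL 0).tsum_eq_zero_add
  unfold logShift
  rw [this]
  congr 1
  · norm_num
  · simp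

/-- Multiplication formula for `logShift`. -/
lemma sum_logShift {L : ℝ} (hL : 0 < L) {M : ℕ} (hM : 0 < M) (a : ℝ) :
    ∑ i ∈ range M, logShift (M * L) ((i + a) / M) = logShift L a := by
  have : NeZero M := ⟨hM.ne'⟩
  have hs := summable_logShift hL a
  have hM' : (M : ℝ) ≠ 0 := by exact_mod_cast hM.ne'
  unfold logShift
  rw [← (Nat.divModEquiv M).symm.tsum_eq]
  have hs' : Summable fun c : ℕ × Fin M =>
      Real.log (1 + Real.exp (-(2 * L * ((((Nat.divModEquiv M).symm c : ℕ) : ℝ) + a)))) :=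
    (Nat.divModEquiv M).symm.summable_iff.2 hs
  rw [(hs'.tsum_prod' fun m => (hasSum_fintype _).summable), ← Summable.tsum_finsetSum]
  · refine tsum_congr fun m => ?_
    rw [tsum_fintype, ← Fin.sum_univ_eq_sum_range (fun i => Real.log (1 + Real.exp
      (-(2 * (M * L) * ((m : ℝ) + (i + a) / M)))))]
    refine sum_congr rfl fun i _ => ?_
    simp only [Nat.divModEquiv_symm_apply, Nat.cast_add, Nat.cast_mul]
    congr 3
    field_simp
    ring
  · intro i _
    exact summable_logShift (by positivity) _

lemma logShift_half {L : ℝ} (hL : 0 < L) :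
    logShift L (1 / 2) = 2 * logEuler L - logEuler (L / 2) - logEuler (2 * L) := by
  have := sum_logShift (half_pos hL) (M := 2) (by norm_num) 1
  simp only [sum_range_succ, range_zero, sum_empty] at this
  push_cast at this
  rw [mul_div_cancel₀ _ (two_ne_zero), logShift_one (half_pos hL),
    mul_div_cancel₀ _ (two_ne_zero)] at this
  have h1 := logShift_one hL
  norm_num at this h1 ⊢
  linarith

end

section

open Filter Topology Finset

/-! ### Theta functions with characteristic -/

/-- `cis x = e^{2 π i x}`. -/
def cis (x : ℂ) : ℂ := Complex.exp (2 * Real.pi * Complex.I * x)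

lemma cis_add (x y : ℂ) : cis (x + y) = cis x * cis y := by
  rw [cis, cis, cis, ← Complex.exp_add]; congr 1; ring

lemma cis_ne_zero (x : ℂ) : cis x ≠ 0 := Complex.exp_ne_zero _

@[simp] lemma cis_zero : cis 0 = 1 := by simp [cis]

lemma cis_neg (x : ℂ) : cis (-x) = (cis x)⁻¹ := by
  rw [cis, cis, ← Complex.exp_neg]; congr 1; ring

lemma cis_int (m : ℤ) : cis m = 1 := by
  rw [cis, Complex.exp_eq_one_iff]; exact ⟨m, by ring⟩

lemma cis_half : cis (1 / 2) = -1 := by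
  rw [cis, ← Complex.exp_pi_mul_I]; congr 1; ring

lemma cis_mul_int (x : ℂ) (m : ℤ) : cis (m * x) = cis x ^ m := by
  rw [cis, cis, ← Complex.exp_int_mul]; congr 1; ring

lemma cis_mul_nat (x : ℂ) (m : ℕ) : cis (m * x) = cis x ^ m := by
  exact_mod_cast cis_mul_int x m

lemma cis_eq_cos_add_sin (x : ℝ) :
    cis x = Real.cos (2 * Real.pi * x) + Real.sin (2 * Real.pi * x) * Complex.I := by
  rw [cis, Complex.ofReal_cos, Complex.ofReal_sin, ← Complex.exp_mul_I]
  congr 1; push_cast; ring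

lemma norm_cis (x : ℝ) : ‖cis x‖ = 1 := by
  rw [cis, show 2 * (Real.pi : ℂ) * Complex.I * x = ((2 * Real.pi * x : ℝ) : ℂ) * Complex.I by
    push_cast; ring, Complex.norm_exp_ofReal_mul_I]

lemma differentiable_cis_mul (c : ℂ) : Differentiable ℂ fun z => cis (c * z) := by
  unfold cis; fun_prop

/-- A term of the series defining `thetaChar`. -/
def thetaCharTerm (L h : ℝ) (x : ℂ) (n : ℤ) : ℂ :=
  Complex.exp (-L * ((n : ℂ) - h) ^ 2) * cis (((n : ℂ) - h) * x)

/-- The theta function `∑ₙ e^{-L (n - h)²} e^{2 π i (n - h) x}` with characteristic `h`;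
the parameter of the lattice is `τ = i L / π`. -/
def thetaChar (L h : ℝ) (x : ℂ) : ℂ := ∑' n : ℤ, thetaCharTerm L h x n

lemma thetaCharTerm_eq (L h : ℝ) (x : ℂ) (n : ℤ) :
    thetaCharTerm L h x n = Complex.exp (-L * h ^ 2) * cis (-h * x)
      * jacobiTheta₂_term n (x - Complex.I * L * h / Real.pi) (Complex.I * L / Real.pi) := by
  have hpi : (Real.pi : ℂ) ≠ 0 := by exact_mod_cast Real.pi_ne_zero
  rw [thetaCharTerm, cis, cis, jacobiTheta₂_term, ← Complex.exp_add, ← Complex.exp_add,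
    ← Complex.exp_add]
  congr 1
  field_simp
  linear_combination (2 * (n : ℂ) * h * L - n ^ 2 * L) * Complex.I_sq

lemma im_tau_pos {L : ℝ} (hL : 0 < L) : 0 < (Complex.I * L / Real.pi).im := by
  rw [show Complex.I * (L : ℂ) / Real.pi = ((L / Real.pi : ℝ) : ℂ) * Complex.I by
    push_cast; ring, Complex.im_ofReal_mul, Complex.I_im, mul_one]
  positivity

lemma summable_thetaCharTerm {L : ℝ} (hL : 0 < L) (h : ℝ) (x : ℂ) :
    Summable (thetaCharTerm L h x) := by
  have := ((summable_jacobiTheta₂_term_iff (x - Complex.I * L * h / Real.pi)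
    (Complex.I * L / Real.pi)).2 (im_tau_pos hL)).mul_left
      (Complex.exp (-L * h ^ 2) * cis (-h * x))
  exact this.congr fun n => (thetaCharTerm_eq L h x n).symm

lemma thetaChar_eq_jacobiTheta₂ (L h : ℝ) (x : ℂ) :
    thetaChar L h x = Complex.exp (-L * h ^ 2) * cis (-h * x)
      * jacobiTheta₂ (x - Complex.I * L * h / Real.pi) (Complex.I * L / Real.pi) := by
  rw [thetaChar, jacobiTheta₂, ← tsum_mul_left]
  exact tsum_congr fun n => thetaCharTerm_eq L h x n

lemma differentiable_thetaChar {L : ℝ} (hL : 0 < L) (h : ℝ) : Differentiable ℂ (thetaChar L h) := by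
  have : thetaChar L h = fun x => Complex.exp (-L * h ^ 2) * cis (-h * x)
      * jacobiTheta₂ (x - Complex.I * L * h / Real.pi) (Complex.I * L / Real.pi) :=
    funext fun x => thetaChar_eq_jacobiTheta₂ L h x
  rw [this]
  refine ((differentiable_cis_mul _).const_mul _).mul fun x => ?_
  exact (differentiableAt_jacobiTheta₂_fst _ (im_tau_pos hL)).comp x
    (differentiableAt_id.sub_const _)

lemma thetaChar_add_one (L h : ℝ) (x : ℂ) :
    thetaChar L h (x + 1) = cis (-h) * thetaChar L h x := by
  rw [thetaChar, thetaChar, ← tsum_mul_left]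
  refine tsum_congr fun n => ?_
  rw [thetaCharTerm, thetaCharTerm, mul_add, mul_one, cis_add, sub_eq_add_neg (n : ℂ) (h : ℂ),
    cis_add (n : ℂ), cis_int]
  ring

/-- Quasi-periodicity of `thetaChar` along `τ = i L / π`. -/
lemma thetaChar_add_tau (L h : ℝ) (k : ℤ) (x : ℂ) :
    thetaChar L h (x + k * (Complex.I * L / Real.pi))
      = Complex.exp (L * k ^ 2) * cis (-k * x) * thetaChar L h x := by
  have hpi : (Real.pi : ℂ) ≠ 0 := by exact_mod_cast Real.pi_ne_zero
  rw [thetaChar, thetaChar, ← (Equiv.addRight k).tsum_eq (thetaCharTerm L h x), ← tsum_mul_left]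
  refine tsum_congr fun n => ?_
  simp only [Equiv.coe_addRight, thetaCharTerm, cis, ← Complex.exp_add]
  congr 1
  push_cast
  field_simp
  linear_combination (2 * L * k * ((n : ℂ) - h)) * Complex.I_sq

lemma thetaChar_neg (L : ℝ) {h : ℝ} (m : ℤ) (hm : (m : ℝ) = 2 * h) (x : ℂ) :
    thetaChar L h (-x) = thetaChar L h x := by
  have hm' : (m : ℂ) = 2 * h := by exact_mod_cast hm
  rw [thetaChar, thetaChar, ← (Equiv.subLeft m).tsum_eq (thetaCharTerm L h x)]
  refine tsum_congr fun n => ?_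
  simp only [Equiv.subLeft_apply, thetaCharTerm]
  push_cast
  rw [hm']
  congr 2 <;> ring

lemma theta3_eq_thetaChar (L : ℝ) (x : ℂ) :
    theta3 x (Complex.I * L / Real.pi) = thetaChar L 0 x := by
  have hpi : (Real.pi : ℂ) ≠ 0 := by exact_mod_cast Real.pi_ne_zero
  refine tsum_congr fun n => ?_
  rw [thetaCharTerm, cis, Complex.ofReal_zero, sub_zero]
  congr 2
  · field_simp; linear_combination (L * (n : ℂ) ^ 2) * Complex.I_sq
  · ring

lemma neg_one_zpow_eq_cis (n : ℤ) : (-1 : ℂ) ^ n = cis (n * (1 / 2)) := by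
  rw [cis_mul_int, cis_half]

lemma theta0_eq_thetaChar (L : ℝ) (x : ℂ) :
    theta0 x (Complex.I * L / Real.pi) = thetaChar L 0 (x + 1 / 2) := by
  have hpi : (Real.pi : ℂ) ≠ 0 := by exact_mod_cast Real.pi_ne_zero
  refine tsum_congr fun n => ?_
  rw [thetaCharTerm, neg_one_zpow_eq_cis, cis, cis, Complex.ofReal_zero, sub_zero,
    ← Complex.exp_add, ← Complex.exp_add, ← Complex.exp_add]
  congr 1
  field_simp
  linear_combination (L * (n : ℂ) ^ 2) * Complex.I_sq

lemma theta1_eq_thetaChar (L : ℝ) (x : ℂ) :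
    theta1 x (Complex.I * L / Real.pi) = -thetaChar L (1 / 2) (x + 1 / 2) := by
  have hpi : (Real.pi : ℂ) ≠ 0 := by exact_mod_cast Real.pi_ne_zero
  rw [theta1, thetaChar, ← tsum_mul_left, ← tsum_neg]
  refine tsum_congr fun n => ?_
  have h4 : cis (1 / 4) = Complex.I := by
    rw [cis, show 2 * (Real.pi : ℂ) * Complex.I * (1 / 4) = Real.pi / 2 * Complex.I by ring,
      Complex.exp_pi_div_two_mul_I]
  rw [thetaCharTerm, neg_one_zpow_eq_cis]
  have e1 : cis (((n : ℂ) - ((1 / 2 : ℝ) : ℂ)) * (x + 1 / 2))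
      = cis (n * (1 / 2)) * cis (((n : ℂ) - 1 / 2) * x) * (cis (1 / 4))⁻¹ := by
    rw [← cis_neg, ← cis_add, ← cis_add]; congr 1; push_cast; ring
  have e2 : Complex.exp (Real.pi * Complex.I * x * (2 * (n : ℂ) - 1))
      = cis (((n : ℂ) - 1 / 2) * x) := by rw [cis]; congr 1; ring
  have e3 : Complex.exp (Real.pi * Complex.I * (Complex.I * L / Real.pi) * ((n : ℂ) - 1 / 2) ^ 2)
      = Complex.exp (-L * ((n : ℂ) - ((1 / 2 : ℝ) : ℂ)) ^ 2) := by
    congr 1; push_cast; field_simp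
    linear_combination (L * (2 * (n : ℂ) - 1) ^ 2) * Complex.I_sq
  rw [e1, e2, e3, h4, Complex.inv_I]
  ring

/-! ### Product formulas -/

/-- Jacobi's triple product when the factors combine to positive reals. -/
lemma tsum_eq_exp_of_factors {L : ℝ} (hL : 0 < L) {w : ℂ} (hw : w ≠ 0)
    (hs : Summable fun j : ℤ => (Real.exp (-L) : ℂ) ^ (j ^ 2) * w ^ j) {r : ℕ → ℝ}
    (hr : ∀ n, 0 < r n) (hsum : Summable fun n => Real.log (r n)) {c : ℕ → ℂ} {d : ℂ}
    (hc : Tendsto c atTop (𝓝 d))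
    (hfac : ∀ᶠ m : ℕ in atTop, ∏ n ∈ range m, ((1 + (Real.exp (-L) : ℂ) ^ (2 * n + 1) * w)
      * (1 + (Real.exp (-L) : ℂ) ^ (2 * n + 1) * w⁻¹)) = c m * ∏ n ∈ range m, (r n : ℂ)) :
    ∑' j : ℤ, (Real.exp (-L) : ℂ) ^ (j ^ 2) * w ^ j
      = d * (Real.exp (logEuler L + ∑' n, Real.log (r n)) : ℝ) := by
  have hq0 := Real.exp_pos (-L)
  have hq1 := exp_neg_lt_one hL
  refine tendsto_nhds_unique (tendsto_triple_product hq0 hq1 hw hs) ?_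
  have h1 := tendsto_qFactorial (p := Real.exp (-L) ^ 2) (by positivity)
    (pow_lt_one₀ hq0.le hq1 (by norm_num))
  have e1 : ∑' n : ℕ, Real.log (1 - (Real.exp (-L) ^ 2) ^ (n + 1)) = logEuler L := by
    refine tsum_congr fun n => ?_
    rw [← pow_mul, ← Real.exp_nat_mul]
    congr 3; push_cast; ring
  rw [e1] at h1
  have h2 : Tendsto (fun m => ∏ n ∈ range m, r n) atTop (𝓝 (Real.exp (∑' n, Real.log (r n)))) := by
    refine ((Real.continuous_exp.tendsto _).comp hsum.hasSum.tendsto_sum_nat).congr fun m => ?_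
    simp only [Function.comp, Real.exp_sum]
    exact prod_congr rfl fun n _ => Real.exp_log (hr n)
  have h3 := ((Complex.continuous_ofReal.tendsto _).comp (h1.mul h2))
  rw [Real.exp_add]
  refine (hc.mul h3).congr' (hfac.mono fun m hm => ?_)
  beta_reduce
  rw [hm]
  simp only [Function.comp]
  push_cast
  ring

lemma ofReal_exp_zpow_sq (L : ℝ) (j : ℤ) :
    (Real.exp (-L) : ℂ) ^ (j ^ 2) = Complex.exp (-L * (j : ℂ) ^ 2) := by
  rw [Complex.ofReal_exp, ← Complex.exp_int_mul]
  congr 1; push_cast; ring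

lemma thetaCharTerm_zero_eq (L : ℝ) (x : ℂ) (j : ℤ) :
    thetaCharTerm L 0 x j = (Real.exp (-L) : ℂ) ^ (j ^ 2) * cis x ^ j := by
  rw [thetaCharTerm, ofReal_exp_zpow_sq, Complex.ofReal_zero, sub_zero, cis_mul_int]

lemma exp_neg_pow_mul (L : ℝ) (k : ℕ) (x : ℂ) : (Real.exp (-L) : ℂ) ^ k * x
    = (Real.exp (-(L * k)) : ℂ) * x := by
  rw [← Complex.ofReal_pow, ← Real.exp_nat_mul]
  congr 3; ring

/-- The product over the odd powers of `q = e^{-L}`: these are the powers of `q` without the even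
ones, and `logCos (L / 2)` runs over all of them. -/
lemma sum_logCos_odd {L : ℝ} (hL : 0 < L) (x : ℝ) :
    (Summable fun n : ℕ => Real.log (cosFactor (Real.exp (-(L * (2 * n + 1)))) x)) ∧
    ∑' n : ℕ, Real.log (cosFactor (Real.exp (-(L * (2 * n + 1)))) x)
      = logCos (L / 2) x - logCos L x := by
  have hs := summable_logCos (half_pos hL) x
  have hodd : Summable fun n : ℕ => Real.log (cosFactor (Real.exp (-(L * (2 * n + 1)))) x) := by
    refine (hs.comp_injective (mul_right_injective₀ (two_ne_zero : (2 : ℕ) ≠ 0))).congr fun n => ?_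
    simp only [Function.comp]; congr 4; push_cast; ring
  refine ⟨hodd, ?_⟩
  have hev := summable_logCos hL x
  have e0 : ∀ n : ℕ, Real.log (cosFactor (Real.exp (-(2 * (L / 2) * ((2 * n : ℕ) + 1)))) x)
      = Real.log (cosFactor (Real.exp (-(L * (2 * n + 1)))) x) := fun n => by
    congr 4; push_cast; ring
  have e1 : ∀ n : ℕ, Real.log (cosFactor (Real.exp (-(2 * (L / 2) * ((2 * n + 1 : ℕ) + 1)))) x)
      = Real.log (cosFactor (Real.exp (-(2 * L * (n + 1)))) x) := fun n => by
    congr 4; push_cast; ring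
  have := tsum_even_add_odd (f := fun n : ℕ =>
    Real.log (cosFactor (Real.exp (-(2 * (L / 2) * (n + 1)))) x))
    (hodd.congr fun n => (e0 n).symm) (hev.congr fun n => (e1 n).symm)
  simp only [e0, e1] at this
  rw [logCos, logCos, ← this]
  ring

/-- The product formula for `ϑ₃` at a real argument. -/
lemma thetaChar_zero_eq_exp {L : ℝ} (hL : 0 < L) (x : ℝ) :
    thetaChar L 0 x = (Real.exp (logEuler L + logCos (L / 2) (x + 1 / 2) - logCos L (x + 1 / 2)) : ℝ) := by
  have hs := (summable_thetaCharTerm hL 0 x).congr (thetaCharTerm_zero_eq L x)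
  simp only [thetaChar, thetaCharTerm_zero_eq]
  obtain ⟨h1, h2⟩ := sum_logCos_odd hL (x + 1 / 2)
  rw [tsum_eq_exp_of_factors hL (cis_ne_zero x) hs
    (r := fun n => cosFactor (Real.exp (-(L * (2 * n + 1)))) (x + 1 / 2))
    (fun n => cosFactor_pos (Real.exp_pos _) (exp_neg_lt_one (by positivity)) _) h1
    (c := fun _ => 1) tendsto_const_nhds, h2, one_mul]
  · congr 2; ring
  · refine Eventually.of_forall fun m => ?_
    rw [one_mul]
    refine prod_congr rfl fun n _ => ?_
    have : cis ((x + 1 / 2 : ℝ) : ℂ) = - cis x := by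
      push_cast; rw [cis_add, cis_half]; ring
    rw [cosFactor_eq_mul, ← cis, this, exp_neg_pow_mul, exp_neg_pow_mul, inv_neg]
    push_cast
    ring

/-- The product formula for `ϑ₂`, hence for `ϑ₁`, at a real argument. -/
lemma thetaChar_half_eq_exp {L : ℝ} (hL : 0 < L) (x : ℝ) :
    thetaChar L (1 / 2) x = 2 * Real.cos (Real.pi * x)
      * (Real.exp (-(L / 4) + logEuler L + logCos L (x + 1 / 2)) : ℝ) := by
  have hs := summable_thetaCharTerm hL (1 / 2) x
  set q := (Real.exp (-L) : ℂ) with hq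
  have hq0 : q ≠ 0 := by rw [hq]; exact_mod_cast (Real.exp_pos _).ne'
  set w := q⁻¹ * cis x with hw
  have hw0 : w ≠ 0 := mul_ne_zero (inv_ne_zero hq0) (cis_ne_zero _)
  have hterm : ∀ j : ℤ, thetaCharTerm L (1 / 2) x j
      = (Real.exp (-(L / 4)) * cis (-(x / 2))) * (q ^ (j ^ 2) * w ^ j) := by
    intro j
    rw [thetaCharTerm, hw, mul_zpow, ← cis_mul_int, inv_zpow, ← zpow_neg, hq,
      Complex.ofReal_exp, Complex.ofReal_exp, ← Complex.exp_int_mul, ← Complex.exp_int_mul,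
      cis, cis, cis]
    simp only [← Complex.exp_add]
    congr 1; push_cast; ring
  have hc0 : (Real.exp (-(L / 4)) * cis (-(x / 2)) : ℂ) ≠ 0 :=
    mul_ne_zero (by exact_mod_cast (Real.exp_pos _).ne') (cis_ne_zero _)
  have hs' : Summable fun j : ℤ => q ^ (j ^ 2) * w ^ j := by
    have := hs.mul_left (Real.exp (-(L / 4)) * cis (-(x / 2)) : ℂ)⁻¹
    refine this.congr fun j => ?_
    rw [hterm, inv_mul_cancel_left₀ hc0]
  simp only [thetaChar, hterm]
  -- Telescoping turns the factors `1 + q^{2n} e(x)` into `1 + q^{2n+2} e(x)`, at the cost of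
  -- the quotient of the first factor by the last one.
  rw [tsum_mul_left, tsum_eq_exp_of_factors hL hw0 hs'
    (r := fun n => cosFactor (Real.exp (-(2 * L * (n + 1)))) (x + 1 / 2))
    (fun n => cosFactor_pos (Real.exp_pos _) (exp_neg_lt_one (by positivity)) _)
    (summable_logCos hL _)
    (c := fun m => (1 + cis x) / (1 + q ^ (2 * m) * cis x)) (d := 1 + cis x)]
  · rw [← logCos]
    have e1 : cis (-(x / 2)) * (1 + cis x) = 2 * Real.cos (Real.pi * x) := by
      have h1 : cis x = cis ((x / 2 : ℝ) : ℂ) * cis ((x / 2 : ℝ) : ℂ) := by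
        rw [← cis_add]; congr 1; push_cast; ring
      have h2 : cis (-(x / 2)) = cis ((-(x / 2) : ℝ) : ℂ) := by push_cast; rfl
      have h3 : cis ((-(x / 2) : ℝ) : ℂ) * cis ((x / 2 : ℝ) : ℂ) = 1 := by
        rw [← cis_add]; push_cast; simp
      rw [h1, h2, mul_add, mul_one, ← mul_assoc, h3, one_mul, cis_eq_cos_add_sin,
        cis_eq_cos_add_sin]
      have h4 : 2 * Real.pi * -(x / 2) = -(Real.pi * x) := by ring
      have h5 : 2 * Real.pi * (x / 2) = Real.pi * x := by ring
      rw [h4, h5, Real.cos_neg, Real.sin_neg]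
      push_cast; ring
    rw [add_assoc, Real.exp_add (-(L / 4))]
    push_cast at e1 ⊢
    linear_combination (Complex.exp (-(L / 4)) * Complex.exp (logEuler L + logCos L (x + 1 / 2))) * e1
  · have h1 : Tendsto (fun m : ℕ => q ^ (2 * m)) atTop (𝓝 0) := by
      have : ‖q ^ 2‖ < 1 := by
        rw [hq, ← Complex.ofReal_pow, Complex.norm_real, Real.norm_of_nonneg (by positivity)]
        exact pow_lt_one₀ (Real.exp_pos _).le (exp_neg_lt_one hL) (by norm_num)
      simp only [pow_mul]
      exact tendsto_pow_atTop_nhds_zero_of_norm_lt_one this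
    have h2 := (tendsto_const_nhds (x := 1 + cis x)).div
      ((tendsto_const_nhds (x := (1 : ℂ))).add (h1.mul_const (cis x))) (by simp)
    rw [zero_mul, add_zero, div_one] at h2
    exact h2
  · filter_upwards [eventually_ge_atTop 1] with m hm
    have hne : ∀ n : ℕ, 1 ≤ n → 1 + q ^ (2 * n) * cis x ≠ 0 := by
      intro n hn h0
      have : ‖q ^ (2 * n) * cis x‖ < 1 := by
        rw [norm_mul, norm_cis, mul_one, hq, ← Complex.ofReal_pow, Complex.norm_real,
          Real.norm_of_nonneg (by positivity)]
        exact pow_lt_one₀ (Real.exp_pos _).le (exp_neg_lt_one hL) (by omega)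
      rw [eq_neg_of_add_eq_zero_right h0, norm_neg, norm_one] at this
      exact lt_irrefl _ this
    have hcF : ∀ n : ℕ, (cosFactor (Real.exp (-(2 * L * (n + 1)))) (x + 1 / 2) : ℂ)
        = (1 + q ^ (2 * (n + 1)) * cis x) * (1 + q ^ (2 * (n + 1)) * (cis x)⁻¹) := by
      intro n
      have : cis ((x + 1 / 2 : ℝ) : ℂ) = - cis x := by
        push_cast; rw [cis_add, cis_half]; ring
      rw [cosFactor_eq_mul, ← cis, this, hq, exp_neg_pow_mul, exp_neg_pow_mul, inv_neg]
      have e : -(L * ((2 * (n + 1) : ℕ) : ℝ)) = -(2 * L * (n + 1)) := by push_cast; ring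
      rw [e]; ring
    simp only [hcF]
    have hsplit : ∀ n : ℕ, (1 + q ^ (2 * n + 1) * w) * (1 + q ^ (2 * n + 1) * w⁻¹)
        = (1 + q ^ (2 * n) * cis x) * (1 + q ^ (2 * (n + 1)) * (cis x)⁻¹) := by
      intro n
      have hcx := cis_ne_zero x
      rw [hw]
      congr 2
      · rw [pow_succ]; field_simp
      · rw [show 2 * (n + 1) = 2 * n + 1 + 1 by ring, pow_succ q (2 * n + 1)]; field_simp
    simp only [← hq, hsplit]
    clear hsplit hcF
    rw [div_mul_eq_mul_div, eq_div_iff (hne m hm)]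
    clear hm
    induction m with
    | zero => simp
    | succ m ih =>
      rw [prod_range_succ, prod_range_succ]
      linear_combination ((1 + q ^ (2 * (m + 1)) * cis x)
        * (1 + q ^ (2 * (m + 1)) * (cis x)⁻¹)) * ih

/-- The product formula for `ϑ₁` at a real argument. -/
lemma theta1_eq_exp {L : ℝ} (hL : 0 < L) (x : ℝ) :
    theta1 x (Complex.I * L / Real.pi) = 2 * Real.sin (Real.pi * x)
      * (Real.exp (-(L / 4) + logEuler L + logCos L x) : ℝ) := by
  rw [theta1_eq_thetaChar]
  have := thetaChar_half_eq_exp hL (x + 1 / 2)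
  have h1 : x + 1 / 2 + 1 / 2 = x + 1 := by ring
  have h2 : Real.pi * (x + 1 / 2) = Real.pi * x + Real.pi / 2 := by ring
  rw [h1, h2, logCos_add_one, Real.cos_add_pi_div_two] at this
  push_cast at this ⊢
  rw [this]
  ring

/-- The product formula for `ϑ₀` at a real argument. -/
lemma theta0_eq_exp {L : ℝ} (hL : 0 < L) (x : ℝ) :
    theta0 x (Complex.I * L / Real.pi)
      = (Real.exp (logEuler L + logCos (L / 2) x - logCos L x) : ℝ) := by
  rw [theta0_eq_thetaChar]
  have := thetaChar_zero_eq_exp hL (x + 1 / 2)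
  have h1 : x + 1 / 2 + 1 / 2 = x + 1 := by ring
  rw [h1, logCos_add_one, logCos_add_one] at this
  push_cast at this ⊢
  rw [this]

lemma summable_exp_quadratic {L : ℝ} (hL : 0 < L) (u : ℝ) :
    Summable fun j : ℤ => Real.exp (-L * (j : ℝ) ^ 2 + u * j) := by
  have := summable_thetaCharTerm hL 0 (-Complex.I * u / (2 * Real.pi))
  rw [← Complex.summable_ofReal]
  refine this.congr fun j => ?_
  have hpi : (Real.pi : ℂ) ≠ 0 := by exact_mod_cast Real.pi_ne_zero
  rw [thetaCharTerm, cis, ← Complex.exp_add]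
  push_cast
  congr 1
  field_simp
  linear_combination (-(j : ℂ) * u) * Complex.I_sq

/-- The triple product at a positive real argument. -/
lemma tsum_exp_quadratic {L : ℝ} (hL : 0 < L) (u : ℝ) :
    ∑' j : ℤ, Real.exp (-L * (j : ℝ) ^ 2 + u * j)
      = Real.exp (logEuler L + (logShift L (1 / 2 + u / (2 * L))
          + logShift L (1 / 2 - u / (2 * L)))) := by
  have hs := Complex.summable_ofReal.2 (summable_exp_quadratic hL u)
  have hterm : ∀ j : ℤ, ((Real.exp (-L * (j : ℝ) ^ 2 + u * j) : ℝ) : ℂ)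
      = (Real.exp (-L) : ℂ) ^ (j ^ 2) * (Real.exp u : ℂ) ^ j := by
    intro j
    rw [ofReal_exp_zpow_sq, Complex.ofReal_exp, Complex.ofReal_exp, ← Complex.exp_int_mul,
      ← Complex.exp_add]
    congr 1; push_cast; ring
  have h1 := summable_logShift hL (1 / 2 + u / (2 * L))
  have h2 := summable_logShift hL (1 / 2 - u / (2 * L))
  have hpos : ∀ a : ℝ, 0 < 1 + Real.exp a := fun a => by positivity
  have hlog : ∀ n : ℕ, Real.log ((1 + Real.exp (-(2 * L * (n + (1 / 2 + u / (2 * L))))))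
      * (1 + Real.exp (-(2 * L * (n + (1 / 2 - u / (2 * L)))))))
      = Real.log (1 + Real.exp (-(2 * L * (n + (1 / 2 + u / (2 * L))))))
        + Real.log (1 + Real.exp (-(2 * L * (n + (1 / 2 - u / (2 * L)))))) := fun n =>
    Real.log_mul (hpos _).ne' (hpos _).ne'
  have key := tsum_eq_exp_of_factors hL (w := (Real.exp u : ℂ))
    (by exact_mod_cast (Real.exp_pos u).ne') (hs.congr hterm)
    (r := fun n : ℕ => (1 + Real.exp (-(2 * L * (n + (1 / 2 + u / (2 * L))))))
      * (1 + Real.exp (-(2 * L * (n + (1 / 2 - u / (2 * L)))))))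
    (fun n => mul_pos (hpos _) (hpos _)) ((h1.add h2).congr fun n => (hlog n).symm)
    (c := fun _ => 1) tendsto_const_nhds (Eventually.of_forall fun m => by
      rw [one_mul]
      refine prod_congr rfl fun n _ => ?_
      rw [exp_neg_pow_mul, exp_neg_pow_mul, ← Complex.ofReal_inv, ← Real.exp_neg,
        ← Complex.ofReal_mul, ← Complex.ofReal_mul, ← Real.exp_add, ← Real.exp_add,
        mul_comm (1 + _)]
      have e1 : -(L * ((2 * n + 1 : ℕ) : ℝ)) + -u = -(2 * L * (n + (1 / 2 + u / (2 * L)))) := by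
        push_cast; field_simp; ring
      have e2 : -(L * ((2 * n + 1 : ℕ) : ℝ)) + u = -(2 * L * (n + (1 / 2 - u / (2 * L)))) := by
        push_cast; field_simp; ring
      rw [e1, e2]
      push_cast
      ring)
  simp only [hlog] at key
  rw [Summable.tsum_add h1 h2, one_mul, ← logShift, ← logShift] at key
  simp only [← hterm] at key
  rw [← Complex.ofReal_tsum] at key
  exact_mod_cast key

lemma nome_tau (L : ℝ) : nome (Complex.I * L / Real.pi) = (Real.exp (-L) : ℝ) := by
  have hpi : (Real.pi : ℂ) ≠ 0 := by exact_mod_cast Real.pi_ne_zero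
  rw [nome, Complex.ofReal_exp]
  congr 1
  push_cast
  field_simp
  linear_combination (L : ℂ) * Complex.I_sq

lemma nomeProd_tau {L : ℝ} (hL : 0 < L) :
    nomeProd (Complex.I * L / Real.pi) = (Real.exp (logEuler L) : ℝ) := by
  have hpos : ∀ n : ℕ, 0 < 1 - Real.exp (-(2 * L * (n + 1))) := fun n => by
    have := exp_neg_lt_one (c := 2 * L * (n + 1)) (by positivity)
    linarith
  have h := Real.hasProd_of_hasSum_log hpos (summable_logEuler hL).hasSum
  have h2 := h.map (Complex.ofRealHom : ℝ →+* ℂ) Complex.continuous_ofReal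
  rw [nomeProd, nome_tau, logEuler]
  refine HasProd.tprod_eq ?_
  convert! h2 using 2 with n
  simp only [Function.comp, Complex.ofRealHom_eq_coe]
  rw [← Complex.ofReal_pow, ← Real.exp_nat_mul]
  push_cast
  congr 2
  ring

end

section

open Filter Topology Finset

/-! ### Entire functions with theta-like quasi-periodicity -/

/-- Entire functions with multiplier `χ₁` for the period `1` and multiplier
`χ e^{L M} e^{-2 π i M z}` for the period `τ = i L / π`. -/
structure QuasiPeriodic (L : ℝ) (M : ℕ) (χ₁ χ : ℂ) (f : ℂ → ℂ) : Prop where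
  differentiable : Differentiable ℂ f
  add_one : ∀ z, f (z + 1) = χ₁ * f z
  add_tau : ∀ z, f (z + Complex.I * L / Real.pi)
    = χ * Complex.exp (L * M) * cis (-M * z) * f z

/-- Orthogonality of the characters of `ℤ / M`, on a shifted lattice. -/
lemma sum_cis_lattice {M : ℕ} (hM : 0 < M) (s : ℝ) (k : ℤ) :
    ∑ i ∈ range M, cis (k * ((i + s) / M))
      = if (M : ℤ) ∣ k then M * cis (k * (s / M)) else 0 := by
  have hM' : (M : ℂ) ≠ 0 := by exact_mod_cast hM.ne'
  have h1 : ∀ i : ℕ, cis (k * ((i + s) / M)) = cis (k / M) ^ i * cis (k * (s / M)) := by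
    intro i
    rw [← cis_mul_nat, ← cis_add]
    congr 1; field_simp
  simp only [h1, ← sum_mul]
  split_ifs with h
  · obtain ⟨l, rfl⟩ := h
    have : (((M : ℤ) * l : ℤ) : ℂ) / M = (l : ℂ) := by push_cast; field_simp
    rw [this, cis_int]
    simp
  · have hne : cis (k / M) ≠ 1 := by
      intro h1
      rw [cis, Complex.exp_eq_one_iff] at h1
      obtain ⟨n, hn⟩ := h1
      apply h
      have h2pi : (2 * Real.pi * Complex.I : ℂ) ≠ 0 := Complex.two_pi_I_ne_zero
      have : (k : ℂ) / M = n := by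
        apply mul_left_cancel₀ h2pi
        rw [hn]; ring
      refine ⟨n, ?_⟩
      field_simp at this
      exact_mod_cast this
    rw [geom_sum_eq hne, ← cis_mul_nat]
    have : (M : ℂ) * (k / M) = k := by field_simp
    rw [this, cis_int]
    simp

/-- Contour shift for the integral of a `1`-periodic entire function. -/
lemma integral_shift_eq {g : ℂ → ℂ} (hg : Differentiable ℂ g) (hper : ∀ z, g (z + 1) = g z)
    (Y : ℝ) : ∫ x in (0 : ℝ)..1, g (x + Y * Complex.I) = ∫ x in (0 : ℝ)..1, g x := by
  have := Complex.integral_boundary_rect_eq_zero_of_differentiableOn g 0 (1 + Y * Complex.I)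
    hg.differentiableOn
  simp only [Complex.zero_re, Complex.zero_im, Complex.add_re, Complex.one_re, Complex.mul_re,
    Complex.ofReal_re, Complex.I_re, mul_zero, Complex.ofReal_im, Complex.I_im, mul_one, sub_zero,
    add_zero, Complex.add_im, Complex.one_im, Complex.mul_im, zero_add, Complex.ofReal_zero,
    zero_mul, Complex.ofReal_one] at this
  have h : ∀ y : ℝ, g (1 + y * Complex.I) = g (y * Complex.I) := fun y => by
    rw [add_comm, hper]
  simp only [h] at this
  linear_combination -this

/-- The Fourier coefficient of `f` at the frequency `n + δ`. -/
def twistedCoeff (f : ℂ → ℂ) (δ : ℝ) (n : ℤ) : ℂ :=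
  ∫ x in (0 : ℝ)..1, f x * cis (-(n + δ) * x)

lemma twistedCoeff_shift {f : ℂ → ℂ} {δ : ℝ} (hf : Differentiable ℂ f)
    (h1 : ∀ z, f (z + 1) = cis δ * f z) (n : ℤ) (Y : ℝ) : twistedCoeff f δ n
    = ∫ x in (0 : ℝ)..1, f (x + Y * Complex.I) * cis (-(n + δ) * (x + Y * Complex.I)) := by
  refine (integral_shift_eq (g := fun z => f z * cis (-(n + δ) * z))
    (hf.mul (differentiable_cis_mul _)) (fun z => ?_) Y).symm
  have : -((n : ℂ) + δ) * (z + 1) = -(n + δ) * z + (-n : ℤ) + -δ := by push_cast; ring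
  rw [h1, this, cis_add, cis_add, cis_int, cis_neg]
  have := cis_ne_zero δ
  field_simp

/-- Shifting the contour far up or down shows that Fourier coefficients of entire functions
decay exponentially. -/
lemma summable_twistedCoeff {f : ℂ → ℂ} {δ : ℝ} (hf : Differentiable ℂ f)
    (h1 : ∀ z, f (z + 1) = cis δ * f z) : Summable (twistedCoeff f δ) := by
  have hbound : ∀ Y : ℝ, ∃ C, ∀ n : ℤ,
      ‖twistedCoeff f δ n‖ ≤ C * Real.exp (2 * Real.pi * Y * n) := by
    intro Y
    have hcont : Continuous fun x : ℝ => ‖f (x + Y * Complex.I)‖ := by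
      have := hf.continuous
      fun_prop
    obtain ⟨C, hC⟩ := (isCompact_Icc (a := (0 : ℝ)) (b := 1)).exists_bound_of_continuousOn
      hcont.continuousOn
    refine ⟨C * Real.exp (2 * Real.pi * Y * δ), fun n => ?_⟩
    rw [twistedCoeff_shift hf h1 n Y]
    have h := intervalIntegral.norm_integral_le_of_norm_le_const (a := (0 : ℝ)) (b := 1)
      (f := fun x : ℝ => f (x + Y * Complex.I) * cis (-(n + δ) * (x + Y * Complex.I)))
      (C := C * Real.exp (2 * Real.pi * Y * δ) * Real.exp (2 * Real.pi * Y * n)) ?_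
    · simpa using h
    · intro x hx
      rw [Set.uIoc_of_le zero_le_one] at hx
      have h2 := hC x ⟨hx.1.le, hx.2⟩
      rw [norm_norm] at h2
      rw [norm_mul, mul_assoc, ← Real.exp_add]
      refine mul_le_mul h2 (le_of_eq ?_) (norm_nonneg _) ((norm_nonneg _).trans h2)
      rw [cis, Complex.norm_exp]
      congr 1
      simp [Complex.mul_re, Complex.mul_im]
      ring
  obtain ⟨C, hC⟩ := hbound (-1)
  obtain ⟨D, hD⟩ := hbound 1
  have hgeo : ∀ K : ℝ, Summable fun n : ℕ => K * Real.exp (-(2 * Real.pi * (n + 0))) :=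
    fun K => (summable_exp_neg (by positivity) 0).mul_left K
  refine Summable.of_nat_of_neg ?_ ?_
  · refine Summable.of_norm_bounded (hgeo C) fun n => (hC n).trans (le_of_eq ?_)
    push_cast; ring_nf
  · refine Summable.of_norm_bounded (hgeo D) fun n => (hD (-n)).trans (le_of_eq ?_)
    push_cast; ring_nf

/-- The Fourier expansion of `f` on the real line. -/
lemma hasSum_twistedCoeff {f : ℂ → ℂ} {δ : ℝ} (hf : Differentiable ℂ f)
    (h1 : ∀ z, f (z + 1) = cis δ * f z) (x : ℝ) :
    HasSum (fun n : ℤ => twistedCoeff f δ n * cis ((n + δ) * x)) (f x) := by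
  have : Fact ((0 : ℝ) < 1) := ⟨one_pos⟩
  let g : ℝ → ℂ := fun x => f x * cis (-δ * x)
  have hper : Function.Periodic g 1 := by
    intro x
    have : -(δ : ℂ) * ((x + 1 : ℝ) : ℂ) = -δ * x + -δ := by push_cast; ring
    simp only [g, this]
    rw [cis_add, cis_neg]
    push_cast
    rw [h1]
    have := cis_ne_zero δ
    field_simp
  have hg : Continuous g := by
    have h2 := hf.continuous
    have h3 := (differentiable_cis_mul (-δ)).continuous
    exact (h2.comp Complex.continuous_ofReal).mul (h3.comp Complex.continuous_ofReal)
  let G : C(AddCircle (1 : ℝ), ℂ) := ⟨hper.lift, continuous_coinduced_dom.mpr hg⟩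
  have hGx : ∀ y : ℝ, G (y : AddCircle (1 : ℝ)) = g y := fun y => rfl
  have hfour : ∀ (n : ℤ) (y : ℝ), fourier n (y : AddCircle (1 : ℝ)) = cis (n * y) := by
    intro n y
    rw [fourier_coe_apply, cis]
    congr 1; push_cast; ring
  have hcoef : ∀ n : ℤ, fourierCoeff G n = twistedCoeff f δ n := by
    intro n
    rw [fourierCoeff_eq_intervalIntegral _ n 0, twistedCoeff]
    simp only [div_one, one_smul, zero_add, hGx, hfour, smul_eq_mul, g]
    refine intervalIntegral.integral_congr fun y _ => ?_
    have : -((n : ℂ) + δ) * y = -(n : ℂ) * y + -δ * y := by ring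
    rw [this, cis_add]
    push_cast
    ring
  have hs : Summable (fourierCoeff G) := by
    rw [funext hcoef]; exact summable_twistedCoeff hf h1
  have h := (has_pointwise_sum_fourier_series_of_summable hs (x : AddCircle (1 : ℝ))).mul_right
    (cis (δ * x))
  rw [hGx] at h
  have e : g x * cis (δ * x) = f x := by
    simp only [g]
    rw [mul_assoc, ← cis_add]
    simp
  rw [e] at h
  refine h.congr_fun fun n => ?_
  rw [hcoef, hfour, smul_eq_mul, mul_assoc, ← cis_add]
  congr 2; ring

/-- The quasi-periodicity along `τ` is a recursion for the Fourier coefficients. -/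
lemma twistedCoeff_add {L : ℝ} {M : ℕ} {δ s : ℝ} {f : ℂ → ℂ}
    (hf : QuasiPeriodic L M (cis δ) (cis s) f) (n : ℤ) :
    twistedCoeff f δ (n + M) = cis (-s) * Real.exp (-(L * (M + 2 * (n + δ)))) * twistedCoeff f δ n := by
  have hpi : (Real.pi : ℂ) ≠ 0 := by exact_mod_cast Real.pi_ne_zero
  have h := twistedCoeff_shift hf.differentiable hf.add_one n (L / Real.pi)
  have h2 : ∀ x : ℝ, f (x + ((L / Real.pi : ℝ) : ℂ) * Complex.I)
        * cis (-(n + δ) * (x + ((L / Real.pi : ℝ) : ℂ) * Complex.I))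
      = (cis s * Real.exp (L * (M + 2 * (n + δ)))) * (f x * cis (-((n + M : ℤ) + δ) * x)) := by
    intro x
    have e1 : ((L / Real.pi : ℝ) : ℂ) * Complex.I = Complex.I * L / Real.pi := by push_cast; ring
    have e2 : cis (-(n + δ) * (x + Complex.I * L / Real.pi))
        = cis (-(n + δ) * x) * Complex.exp (2 * L * (n + δ)) := by
      rw [mul_add, cis_add, cis, cis]
      congr 2
      field_simp
      linear_combination (-L * ((n : ℂ) + δ)) * Complex.I_sq
    have e3 : cis (-((n + M : ℤ) + δ) * x) = cis (-M * x) * cis (-(n + δ) * x) := by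
      rw [← cis_add]; congr 1; push_cast; ring
    have e4 : (Real.exp (L * (M + 2 * (n + δ))) : ℂ)
        = Complex.exp (L * M) * Complex.exp (2 * L * (n + δ)) := by
      rw [Complex.ofReal_exp, ← Complex.exp_add]; congr 1; push_cast; ring
    rw [e1, hf.add_tau, e2, e3, e4]
    ring
  simp only [h2] at h
  rw [intervalIntegral.integral_const_mul, ← twistedCoeff] at h
  rw [h, cis_neg, Real.exp_neg]
  have hs := cis_ne_zero s
  have he := (Real.exp_pos (L * (M + 2 * (n + δ)))).ne'
  have he' : (Real.exp (L * (M + 2 * (n + δ))) : ℂ) ≠ 0 := by exact_mod_cast he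
  push_cast at he' ⊢
  field_simp

lemma twistedCoeff_add_mul {L : ℝ} {M : ℕ} {δ s : ℝ} {f : ℂ → ℂ}
    (hf : QuasiPeriodic L M (cis δ) (cis s) f) (n l : ℤ) :
    twistedCoeff f δ (n + M * l)
      = cis (-(l * s)) * Real.exp (-(L * (M * l ^ 2 + 2 * (n + δ) * l))) * twistedCoeff f δ n := by
  induction l using Int.induction_on with
  | zero => simp
  | succ l ih =>
    have h := twistedCoeff_add hf (n + M * l)
    rw [show n + (M : ℤ) * (l + 1) = n + M * l + M by ring, h, ih]
    have e1 : cis (-(((l + 1 : ℤ) : ℂ) * s)) = cis (-s) * cis (-(((l : ℤ) : ℂ) * s)) := by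
      rw [← cis_add]; congr 1; push_cast; ring
    have e2 : Real.exp (-(L * (M * ((l + 1 : ℤ) : ℝ) ^ 2 + 2 * (n + δ) * ((l + 1 : ℤ) : ℝ))))
        = Real.exp (-(L * (M + 2 * (((n + M * l : ℤ) : ℝ) + δ))))
          * Real.exp (-(L * (M * ((l : ℤ) : ℝ) ^ 2 + 2 * (n + δ) * ((l : ℤ) : ℝ)))) := by
      rw [← Real.exp_add]; congr 1; push_cast; ring
    rw [e1, e2]
    push_cast
    ring
  | pred l ih =>
    have h := twistedCoeff_add hf (n + M * (-l - 1))
    rw [show n + (M : ℤ) * (-l - 1) + M = n + M * (-l) by ring, ih] at h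
    have e1 : cis (-(((-l : ℤ) : ℂ) * s)) = cis (-s) * cis (-(((-l - 1 : ℤ) : ℂ) * s)) := by
      rw [← cis_add]; congr 1; push_cast; ring
    have e2 : Real.exp (-(L * (M * ((-l : ℤ) : ℝ) ^ 2 + 2 * (n + δ) * ((-l : ℤ) : ℝ))))
        = Real.exp (-(L * (M + 2 * (((n + M * (-l - 1) : ℤ) : ℝ) + δ))))
          * Real.exp (-(L * (M * ((-l - 1 : ℤ) : ℝ) ^ 2 + 2 * (n + δ) * ((-l - 1 : ℤ) : ℝ)))) := by
      rw [← Real.exp_add]; congr 1; push_cast; ring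
    rw [e1, e2] at h
    have hne : cis (-s) * (Real.exp (-(L * (M + 2 * (((n + M * (-l - 1) : ℤ) : ℝ) + δ)))) : ℂ)
        ≠ 0 := mul_ne_zero (cis_ne_zero _) (by exact_mod_cast (Real.exp_pos _).ne')
    apply mul_left_cancel₀ hne
    rw [← h]
    push_cast
    ring

/-- A quasi-periodic function of degree `M` that vanishes at the `M` points of a suitably shifted
lattice of mesh `1 / M` vanishes on the real line. Restricted to the lattice, the Fourier series
collapses to a finite Fourier sum whose coefficients are positive multiples of the
Fourier coefficients of the function. -/
theorem QuasiPeriodic.eq_zero_of_lattice {L : ℝ} {M : ℕ} (hM : 0 < M) {δ s : ℝ} {f : ℂ → ℂ}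
    (hf : QuasiPeriodic L M (cis δ) (cis s) f)
    (hz : ∀ i < M, f (((i + s) / M : ℝ) : ℂ) = 0) (x : ℝ) : f x = 0 := by
  have hM' : (M : ℂ) ≠ 0 := by exact_mod_cast hM.ne'
  have hMZ : (M : ℤ) ≠ 0 := by exact_mod_cast hM.ne'
  have hcoef : ∀ n, twistedCoeff f δ n = 0 := by
    intro n
    by_contra hn
    -- The finite Fourier sum of the vanishing values on the lattice, at the frequency `n + δ`.
    have h1 : HasSum (fun m : ℤ => ∑ i ∈ range M, twistedCoeff f δ m * cis ((m + δ) * ((i + s) / M))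
        * cis (-(n + δ) * ((i + s) / M))) 0 := by
      have : (0 : ℂ) = ∑ i ∈ range M, f (((i + s) / M : ℝ) : ℂ) * cis (-(n + δ) * ((i + s) / M)) := by
        symm
        refine sum_eq_zero fun i hi => ?_
        rw [hz i (mem_range.1 hi), zero_mul]
      rw [this]
      refine hasSum_sum fun i _ => ?_
      have := (hasSum_twistedCoeff hf.differentiable hf.add_one ((i + s) / M)).mul_right
        (cis (-(n + δ) * ((i + s) / M)))
      push_cast at this ⊢
      exact this
    have h2 : ∀ m : ℤ, ∑ i ∈ range M, twistedCoeff f δ m * cis ((m + δ) * ((i + s) / M))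
        * cis (-(n + δ) * ((i + s) / M))
        = if (M : ℤ) ∣ m - n then twistedCoeff f δ m * (M * cis ((m - n : ℤ) * (s / M))) else 0 := by
      intro m
      have : ∀ i : ℕ, twistedCoeff f δ m * cis ((m + δ) * ((i + s) / M))
          * cis (-(n + δ) * ((i + s) / M))
          = twistedCoeff f δ m * cis ((m - n : ℤ) * ((i + s) / M)) := by
        intro i
        rw [mul_assoc, ← cis_add]
        congr 2; push_cast; ring
      simp only [this]
      rw [← mul_sum, sum_cis_lattice hM]
      split_ifs <;> simp
    simp only [h2] at h1
    have hinj : Function.Injective fun l : ℤ => n + M * l := by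
      intro a b hab
      exact mul_left_cancel₀ hMZ (add_left_cancel hab)
    rw [← hinj.hasSum_iff] at h1
    · have h3 : ∀ l : ℤ, ((fun m : ℤ => if (M : ℤ) ∣ m - n then
          twistedCoeff f δ m * (M * cis ((m - n : ℤ) * (s / M))) else 0) ∘ fun l : ℤ => n + M * l) l
          = (M * twistedCoeff f δ n) * (Real.exp (-(L * (M * l ^ 2 + 2 * (n + δ) * l))) : ℝ) := by
        intro l
        simp only [Function.comp, add_sub_cancel_left, dvd_mul_right, if_true]
        rw [twistedCoeff_add_mul hf]
        have : cis (((M * l : ℤ) : ℂ) * (s / M)) = (cis (-(l * s)))⁻¹ := by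
          rw [← cis_neg]; congr 1; push_cast; field_simp
        rw [this]
        have := cis_ne_zero (-(l * s))
        field_simp
      simp only [funext h3] at h1
      have hne : (M : ℂ) * twistedCoeff f δ n ≠ 0 := mul_ne_zero hM' hn
      have h4 := h1.mul_left (M * twistedCoeff f δ n)⁻¹
      simp only [inv_mul_cancel_left₀ hne, mul_zero] at h4
      have h5 : HasSum (fun l : ℤ => Real.exp (-(L * (M * l ^ 2 + 2 * (n + δ) * l)))) 0 := by
        rw [← Complex.ofReal_zero] at h4
        exact Complex.hasSum_ofReal.1 h4
      have h6 := (hasSum_zero_iff_of_nonneg fun l => (Real.exp_pos _).le).1 h5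
      exact (Real.exp_pos _).ne' (congrFun h6 0)
    · intro m hm
      rw [if_neg]
      rintro ⟨l, hl⟩
      exact hm ⟨l, by simp only; omega⟩
  have := hasSum_twistedCoeff hf.differentiable hf.add_one x
  simp only [hcoef, zero_mul] at this
  exact this.unique hasSum_zero

end

section

open Filter Topology Finset

lemma QuasiPeriodic.const (L : ℝ) (c : ℂ) : QuasiPeriodic L 0 1 1 fun _ => c :=
  ⟨differentiable_const c, fun _ => by simp, fun _ => by simp⟩

lemma QuasiPeriodic.mul {L : ℝ} {M M' : ℕ} {a a' b b' : ℂ} {f g : ℂ → ℂ}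
    (hf : QuasiPeriodic L M a b f) (hg : QuasiPeriodic L M' a' b' g) :
    QuasiPeriodic L (M + M') (a * a') (b * b') fun z => f z * g z := by
  refine ⟨hf.differentiable.mul hg.differentiable, fun z => ?_, fun z => ?_⟩
  · rw [hf.add_one, hg.add_one]; ring
  · rw [hf.add_tau, hg.add_tau]
    have e1 : cis (-((M + M' : ℕ) : ℂ) * z) = cis (-M * z) * cis (-M' * z) := by
      rw [← cis_add]; congr 1; push_cast; ring
    have e2 : Complex.exp (L * ((M + M' : ℕ) : ℂ))
        = Complex.exp (L * M) * Complex.exp (L * M') := by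
      rw [← Complex.exp_add]; congr 1; push_cast; ring
    rw [e1, e2]; ring

lemma QuasiPeriodic.prod {ι : Type} {L : ℝ} {M : ι → ℕ} {a b : ι → ℂ} {f : ι → ℂ → ℂ}
    (s : Finset ι) (h : ∀ i ∈ s, QuasiPeriodic L (M i) (a i) (b i) (f i)) :
    QuasiPeriodic L (∑ i ∈ s, M i) (∏ i ∈ s, a i) (∏ i ∈ s, b i) fun z => ∏ i ∈ s, f i z := by
  classical
  induction s using Finset.induction_on with
  | empty => simpa using QuasiPeriodic.const L 1
  | insert i s hi ih =>
    simp only [prod_insert hi, sum_insert hi]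
    exact (h i (mem_insert_self i s)).mul (ih fun j hj => h j (mem_insert_of_mem hj))

/-- The space of quasi-periodic functions with given degree and multipliers. -/
def quasiPeriodicSubmodule (L : ℝ) (M : ℕ) (a b : ℂ) : Submodule ℂ (ℂ → ℂ) where
  carrier := {f | QuasiPeriodic L M a b f}
  add_mem' hf hg := ⟨hf.differentiable.add hg.differentiable,
    fun z => by simp only [Pi.add_apply, hf.add_one, hg.add_one]; ring,
    fun z => by simp only [Pi.add_apply, hf.add_tau, hg.add_tau]; ring⟩
  zero_mem' := ⟨differentiable_const 0, fun _ => by simp, fun _ => by simp⟩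
  smul_mem' c f hf := ⟨hf.differentiable.const_smul c,
    fun z => by simp only [Pi.smul_apply, smul_eq_mul, hf.add_one]; ring,
    fun z => by simp only [Pi.smul_apply, smul_eq_mul, hf.add_tau]; ring⟩

/-- The space of functions with `f (-z) = ε f z`. -/
def paritySubmodule (ε : ℂ) : Submodule ℂ (ℂ → ℂ) where
  carrier := {f | ∀ z, f (-z) = ε * f z}
  add_mem' hf hg z := by simp only [Pi.add_apply, hf z, hg z]; ring
  zero_mem' _ := by simp
  smul_mem' c f hf z := by simp only [Pi.smul_apply, smul_eq_mul, hf z]; ring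

/-- Theta functions are quasi-periodic after an affine substitution that maps the lattice into
the lattice. -/
lemma quasiPeriodic_thetaChar {L lam : ℝ} (hlam : 0 < lam) (h : ℝ) (a k : ℕ) (hak : a * L = k * lam)
    (b : ℂ) : QuasiPeriodic L (k * a) (cis (-h) ^ a) (cis (-k * b))
      fun z => thetaChar lam h (a * z + b) := by
  have hpi : (Real.pi : ℂ) ≠ 0 := by exact_mod_cast Real.pi_ne_zero
  have hak' : (a : ℂ) * L = k * lam := by exact_mod_cast hak
  refine ⟨(differentiable_thetaChar hlam h).comp (by fun_prop), fun z => ?_, fun z => ?_⟩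
  · have : ∀ (n : ℕ) (x : ℂ), thetaChar lam h (x + n) = cis (-h) ^ n * thetaChar lam h x := by
      intro n x
      induction n with
      | zero => simp
      | succ n ih =>
        rw [Nat.cast_succ, ← add_assoc, thetaChar_add_one, ih]; ring
    rw [← this]; congr 1; ring
  · have e1 : (a : ℂ) * (z + Complex.I * L / Real.pi) + b
        = (a * z + b) + (k : ℤ) * (Complex.I * lam / Real.pi) := by
      push_cast; field_simp; linear_combination Complex.I * hak'
    rw [e1, thetaChar_add_tau]
    have e2 : cis (-((k : ℤ) : ℂ) * (a * z + b)) = cis (-k * b) * cis (-((k * a : ℕ) : ℂ) * z) := by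
      rw [← cis_add]; congr 1; push_cast; ring
    have e3 : (lam : ℂ) * ((k : ℤ) : ℂ) ^ 2 = L * ((k * a : ℕ) : ℂ) := by
      push_cast; linear_combination (-(k : ℂ)) * hak'
    rw [e2, e3]; ring

/-! ### Interpolation of alternating functions of several variables -/

open Function in
/-- A function of several variables vanishes if it vanishes on the grid spanned by the `y k` and
if, in each variable separately, it vanishes as soon as it vanishes at the `y k`. -/
lemma eq_zero_of_slices {N : ℕ} (y : Fin N → ℝ) (A : (Fin N → ℝ) → ℂ)
    (hslice : ∀ x i, (∀ k, A (update x i (y k)) = 0) → ∀ u, A (update x i u) = 0)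
    (hgrid : ∀ σ : Fin N → Fin N, A (y ∘ σ) = 0) (x : Fin N → ℝ) : A x = 0 := by
  have key : ∀ s : Finset (Fin N), ∀ x : Fin N → ℝ, (∀ i ∉ s, x i ∈ Set.range y) → A x = 0 := by
    intro s
    induction s using Finset.induction_on with
    | empty =>
      intro x hx
      choose σ hσ using fun i => hx i (notMem_empty i)
      rw [← hgrid σ]
      congr 1
      funext i
      exact (hσ i).symm
    | insert i s hi ih =>
      intro x hx
      rw [← update_eq_self i x]
      refine hslice x i (fun k => ih _ fun j hj => ?_) _
      by_cases hji : j = i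
      · subst hji; simp
      · rw [update_of_ne hji]
        exact hx j (by simp [hji, hj])
  exact key univ x fun i hi => absurd (mem_univ i) hi

open Function in
/-- An alternating function all of whose slices lie in a space `V` with unisolvent nodes `y`
is a multiple of the determinant of any family of functions of `V`. -/
theorem alternating_mul_det_eq {N : ℕ} (V : Submodule ℂ (ℂ → ℂ)) (y : Fin N → ℝ)
    (hV : ∀ f ∈ V, (∀ k, f (y k) = 0) → ∀ u : ℝ, f u = 0) (W : (Fin N → ℂ) → ℂ)
    (hW : ∀ x i, (fun z => W (update x i z)) ∈ V)
    (halt : ∀ (σ : Equiv.Perm (Fin N)) x, W (x ∘ σ) = (Equiv.Perm.sign σ : ℤ) * W x)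
    (k : Fin N → ℂ → ℂ) (hk : ∀ j, k j ∈ V) (x : Fin N → ℝ) :
    W (fun l => x l) * (Matrix.of fun j l => k j (y l)).det
      = W (fun l => y l) * (Matrix.of fun j l => k j (x l)).det := by
  let B : (Fin N → ℂ) → ℂ := fun x =>
    W x * (Matrix.of fun j l => k j (y l)).det
      - W (fun l => y l) * (Matrix.of fun j l => k j (x l)).det
  have hBslice : ∀ x i, (fun z => B (update x i z)) ∈ V := by
    intro x i
    have h1 : (fun z => B (update x i z))
        = (Matrix.of fun j l => k j (y l)).det • (fun z => W (update x i z))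
          - W (fun l => y l) • ∑ j, ((Matrix.of fun j l => k j (x l)).adjugate i j) • k j := by
      funext z
      have h2 : (Matrix.of fun j l => k j (update x i z l))
          = (Matrix.of fun j l => k j (x l)).updateCol i (fun j => k j z) := by
        ext j l
        by_cases hl : l = i
        · subst hl; simp
        · simp [hl, Matrix.updateCol_ne]
      have h3 : (Matrix.of fun j l => k j (update x i z l)).det
          = ∑ j, (Matrix.of fun j l => k j (x l)).adjugate i j * k j z := by
        rw [h2, ← Matrix.cramer_apply, Matrix.cramer_eq_adjugate_mulVec]
        rfl
      simp only [B, h3, Pi.sub_apply, Pi.smul_apply, Finset.sum_apply, smul_eq_mul]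
      ring
    rw [h1]
    exact V.sub_mem (V.smul_mem _ (hW x i))
      (V.smul_mem _ (V.sum_mem fun j _ => V.smul_mem _ (hk j)))
  have hBalt : ∀ (σ : Equiv.Perm (Fin N)) x, B (x ∘ σ) = (Equiv.Perm.sign σ : ℤ) * B x := by
    intro σ x
    have h1 : (Matrix.of fun j l => k j ((x ∘ σ) l)).det
        = (Equiv.Perm.sign σ : ℤ) * (Matrix.of fun j l => k j (x l)).det := by
      exact_mod_cast Matrix.det_permute' σ (Matrix.of fun j l => k j (x l))
    simp only [B]
    rw [halt, h1]
    ring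
  have hBrep : ∀ (x : Fin N → ℂ) i j, i ≠ j → x i = x j → B x = 0 := by
    intro x i j hij hx
    have h1 := hBalt (Equiv.swap i j) x
    have h2 : x ∘ Equiv.swap i j = x := by
      funext l
      simp only [comp_apply, Equiv.swap_apply_def]
      split_ifs with h h'
      · rw [h, hx]
      · rw [h', hx]
      · rfl
    rw [h2, Equiv.Perm.sign_swap hij] at h1
    simp at h1
    exact self_eq_neg.1 h1
  have hBy : B (fun l => y l) = 0 := by simp only [B]; ring
  have := eq_zero_of_slices y (fun x => B fun l => x l) ?_ ?_ x
  · exact sub_eq_zero.1 this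
  · intro x i hx u
    have e : ∀ u : ℝ, (fun l => ((update x i u l : ℝ) : ℂ))
        = update (fun l => (x l : ℂ)) i (u : ℂ) := by
      intro u; funext l
      by_cases hl : l = i
      · subst hl; simp
      · simp [hl]
    simp only [e] at hx ⊢
    exact hV _ (hBslice _ i) hx u
  · intro σ
    by_cases hσ : Function.Injective σ
    · have h1 := hBalt (Equiv.ofBijective σ (Finite.injective_iff_bijective.1 hσ)) fun l => y l
      rw [hBy, mul_zero] at h1
      exact h1
    · simp only [Injective, not_forall] at hσ
      obtain ⟨i, j, h1, h2⟩ := hσ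
      exact hBrep _ i j h2 (by simp [h1])

/-! ### Products over pairs of indices -/

@[to_additive]
lemma prod_pairs_ite {N : ℕ} {β : Type} [CommMonoid β] (i : Fin N) (c : Fin N → β) :
    ∏ j : Fin N, ∏ k ∈ Ioi j, ((if j = i then c k else 1) * (if k = i then c j else 1))
      = ∏ j ∈ univ.erase i, c j := by
  simp only [prod_mul_distrib]
  have h1 : ∏ j : Fin N, ∏ k ∈ Ioi j, (if j = i then c k else 1) = ∏ k ∈ Ioi i, c k := by
    rw [prod_eq_single i]
    · simp
    · intro j _ hj; simp [hj]
    · simp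
  have h2 : ∏ j : Fin N, ∏ k ∈ Ioi j, (if k = i then c j else 1) = ∏ j ∈ Iio i, c j := by
    rw [← prod_filter_mul_prod_filter_not univ (fun j => j < i)]
    rw [prod_eq_one (s := univ.filter fun j => ¬ j < i), mul_one]
    · have : univ.filter (fun j => j < i) = Iio i := by ext; simp
      rw [this]
      refine prod_congr rfl fun j hj => ?_
      rw [prod_ite_eq' (Ioi j) i]
      simp [mem_Iio.1 hj]
    · intro j hj
      simp at hj
      refine prod_eq_one fun k hk => ?_
      have := mem_Ioi.1 hk
      rw [if_neg (by rintro rfl; exact absurd this (not_lt.2 hj))]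
  rw [h1, h2, ← prod_union]
  · congr 1
    ext j
    simp only [mem_union, mem_Ioi, mem_Iio, mem_erase, mem_univ, and_true]
    exact ⟨fun h => h.elim (fun h => h.ne') fun h => h.ne, fun h => (lt_or_gt_of_ne h).symm⟩
  · rw [disjoint_left]
    intro j hj hj'
    exact lt_asymm (mem_Ioi.1 hj) (mem_Iio.1 hj')

open Function in
/-- Slices of a product over pairs of indices. -/
lemma quasiPeriodic_prod_pairs {N : ℕ} {L : ℝ} {m : ℕ} {a : ℂ} {b : ℂ → ℂ} {F : ℂ → ℂ → ℂ}
    (h1 : ∀ c, QuasiPeriodic L m a (b c) fun z => F z c)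
    (h2 : ∀ c, QuasiPeriodic L m a (b c) fun z => F c z) (x : Fin N → ℂ) (i : Fin N) :
    QuasiPeriodic L (m * (N - 1)) (a ^ (N - 1)) (∏ j ∈ univ.erase i, b (x j))
      fun z => ∏ j : Fin N, ∏ k ∈ Ioi j, F (update x i z j) (update x i z k) := by
  have hfac : ∀ j : Fin N, ∀ k ∈ Ioi j,
      QuasiPeriodic L ((if j = i then m else 0) + (if k = i then m else 0))
        ((if j = i then a else 1) * (if k = i then a else 1))
        ((if j = i then b (x k) else 1) * (if k = i then b (x j) else 1))
        fun z => F (update x i z j) (update x i z k) := by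
    intro j k hk
    have hjk := mem_Ioi.1 hk
    by_cases hj : j = i
    · subst hj
      have : k ≠ j := hjk.ne'
      simpa [this] using h1 (x k)
    · by_cases hk' : k = i
      · subst hk'
        simpa [hj] using h2 (x j)
      · simpa [hj, hk'] using QuasiPeriodic.const L (F (x j) (x k))
  have := QuasiPeriodic.prod univ fun j _ => QuasiPeriodic.prod (Ioi j) (hfac j)
  rw [sum_pairs_ite i fun _ => m, prod_pairs_ite i fun _ => a, prod_pairs_ite i fun j => b (x j)]
    at this
  simpa [card_erase_of_mem, mul_comm] using this

open Function in
lemma prod_pairs_slice_neg {N : ℕ} {F : ℂ → ℂ → ℂ} (h1 : ∀ c z, F (-z) c = F z c)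
    (h2 : ∀ c z, F c (-z) = F c z) (x : Fin N → ℂ) (i : Fin N) (z : ℂ) :
    ∏ j : Fin N, ∏ k ∈ Ioi j, F (update x i (-z) j) (update x i (-z) k)
      = ∏ j : Fin N, ∏ k ∈ Ioi j, F (update x i z j) (update x i z k) := by
  refine prod_congr rfl fun j _ => prod_congr rfl fun k _ => ?_
  by_cases hj : j = i <;> by_cases hk : k = i <;> simp [hj, hk, h1, h2]

end

section

open Finset Polynomial

/-! ### Weyl denominator formulas -/

/-- Monic Chebyshev-like polynomials in `c = 2 cos θ`, given by the three-term recursion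
`P_{n+2} = X P_{n+1} - P_n` with `P_0 = 1`, `P_1 = X + e`, and with `a` in place of
the coefficient `1` of `P_0` in `P_2`. -/
def chebPoly (e a : ℝ) : ℕ → ℝ[X]
  | 0 => 1
  | 1 => X + C e
  | n + 2 => X * chebPoly e a (n + 1) - C (if n = 0 then a else 1) * chebPoly e a n

lemma chebPoly_spec (e a : ℝ) (n : ℕ) :
    (chebPoly e a n).natDegree = n ∧ (chebPoly e a n).Monic := by
  induction n using Nat.twoStepInduction with
  | zero => simp [chebPoly]
  | one => exact ⟨natDegree_X_add_C e, monic_X_add_C e⟩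
  | more n ih1 ih2 =>
    have hm : (X * chebPoly e a (n + 1)).Monic := monic_X.mul ih2.2
    have hd : (X * chebPoly e a (n + 1)).natDegree = n + 2 := by
      rw [natDegree_X_mul ih2.2.ne_zero, ih2.1]
    have hlt : (C (if n = 0 then a else 1) * chebPoly e a n).natDegree
        < (X * chebPoly e a (n + 1)).natDegree := by
      rw [hd]
      exact (natDegree_C_mul_le _ _).trans_lt (by rw [ih1.1]; omega)
    have hlt' : (C (if n = 0 then a else 1) * chebPoly e a n).degree
        < (X * chebPoly e a (n + 1)).degree := degree_lt_degree hlt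
    rw [chebPoly]
    exact ⟨by rw [natDegree_sub_eq_left_of_natDegree_lt hlt, hd], hm.sub_of_left hlt'⟩

/-- Reversing the order of the indices permutes the pairs `j < k`. -/
lemma prod_pairs_rev {N : ℕ} {β : Type} [CommMonoid β] (g : Fin N → Fin N → β) :
    ∏ j : Fin N, ∏ k ∈ Ioi j, g k.rev j.rev = ∏ j : Fin N, ∏ k ∈ Ioi j, g j k := by
  rw [prod_sigma', prod_sigma']
  refine prod_bij' (fun p _ => ⟨p.2.rev, p.1.rev⟩) (fun p _ => ⟨p.2.rev, p.1.rev⟩) ?_ ?_ ?_ ?_ ?_ <;>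
    simp

lemma det_chebPoly (e a : ℝ) {N : ℕ} (c : Fin N → ℝ) :
    (Matrix.of fun j k : Fin N => (chebPoly e a j.rev).eval (c k)).det
      = ∏ j : Fin N, ∏ k ∈ Ioi j, (c j - c k) := by
  have h := Matrix.det_eval_matrixOfPolynomials_eq_det_vandermonde (fun k : Fin N => c k.rev)
    (fun j => chebPoly e a j) (fun j => (chebPoly_spec e a j).1) fun j => (chebPoly_spec e a j).2
  rw [Matrix.det_vandermonde] at h
  rw [← prod_pairs_rev fun j k => c j - c k, h, ← Matrix.det_transpose,
    ← Matrix.det_submatrix_equiv_self Fin.revPerm]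
  congr 1
  ext j k
  simp only [Matrix.submatrix_apply, Matrix.transpose_apply, Matrix.of_apply, Fin.revPerm_apply,
    Fin.rev_rev]

lemma two_cos_sub_two_cos (x y : ℝ) : 2 * Real.cos (2 * Real.pi * x) - 2 * Real.cos (2 * Real.pi * y)
    = 4 * (Real.sin (Real.pi * (y - x)) * Real.sin (Real.pi * (y + x))) := by
  rw [← mul_sub, Real.cos_sub_cos]
  have h1 : (2 * Real.pi * x + 2 * Real.pi * y) / 2 = Real.pi * (y + x) := by ring
  have h2 : (2 * Real.pi * x - 2 * Real.pi * y) / 2 = -(Real.pi * (y - x)) := by ring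
  rw [h1, h2, Real.sin_neg]; ring

lemma sin_add_two_mul_rec (c θ : ℝ) : Real.sin (c + 2 * θ)
    = 2 * Real.cos θ * Real.sin (c + θ) - Real.sin c := by
  have h1 : c + 2 * θ = (c + θ) + θ := by ring
  have h2 : c = (c + θ) - θ := by ring
  rw [h1, Real.sin_add]
  nth_rewrite 4 [h2]
  rw [Real.sin_sub]; ring

lemma cos_add_two_mul_rec (c θ : ℝ) : Real.cos (c + 2 * θ)
    = 2 * Real.cos θ * Real.cos (c + θ) - Real.cos c := by
  have h1 : c + 2 * θ = (c + θ) + θ := by ring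
  have h2 : c = (c + θ) - θ := by ring
  rw [h1, Real.cos_add]
  nth_rewrite 4 [h2]
  rw [Real.cos_sub]; ring

lemma eval_chebPoly_sin_int (θ : ℝ) (n : ℕ) :
    Real.sin θ * (chebPoly 0 1 n).eval (2 * Real.cos θ) = Real.sin ((n + 1) * θ) := by
  induction n using Nat.twoStepInduction with
  | zero => simp [chebPoly]
  | one =>
    simp only [chebPoly, eval_add, eval_X, eval_C, Nat.cast_one]
    rw [show (1 + 1) * θ = 2 * θ by ring, Real.sin_two_mul]; ring
  | more n ih1 ih2 =>
    rw [chebPoly]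
    simp only [eval_sub, eval_mul, eval_X, eval_C, ite_self, one_mul]
    have := sin_add_two_mul_rec ((n + 1) * θ) θ
    push_cast at ih2 ⊢
    rw [show ((n : ℝ) + 2 + 1) * θ = (n + 1) * θ + 2 * θ by ring, this, ← ih1,
      show ((n : ℝ) + 1) * θ + θ = (n + 1 + 1) * θ by ring, ← ih2]
    ring

lemma eval_chebPoly_sin_half (θ : ℝ) (n : ℕ) :
    Real.sin (θ / 2) * (chebPoly 1 1 n).eval (2 * Real.cos θ) = Real.sin ((n + 1 / 2) * θ) := by
  induction n using Nat.twoStepInduction with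
  | zero => simp [chebPoly]; ring_nf
  | one =>
    simp only [chebPoly, eval_add, eval_X, eval_C, Nat.cast_one]
    have := sin_add_two_mul_rec (-(θ / 2)) θ
    rw [show -(θ / 2) + θ = θ / 2 by ring, Real.sin_neg] at this
    rw [show (1 + 1 / 2) * θ = -(θ / 2) + 2 * θ by ring, this]; ring
  | more n ih1 ih2 =>
    rw [chebPoly]
    simp only [eval_sub, eval_mul, eval_X, eval_C, ite_self, one_mul]
    have := sin_add_two_mul_rec ((n + 1 / 2) * θ) θ
    push_cast at ih2 ⊢
    rw [show ((n : ℝ) + 2 + 1 / 2) * θ = (n + 1 / 2) * θ + 2 * θ by ring, this, ← ih1,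
      show ((n : ℝ) + 1 / 2) * θ + θ = (n + 1 + 1 / 2) * θ by ring, ← ih2]
    ring

lemma eval_chebPoly_cos (θ : ℝ) (n : ℕ) :
    (if n = 0 then 1 else 1 / 2) * (chebPoly 0 2 n).eval (2 * Real.cos θ) = Real.cos (n * θ) := by
  induction n using Nat.twoStepInduction with
  | zero => simp [chebPoly]
  | one => simp [chebPoly]
  | more n ih1 ih2 =>
    rw [chebPoly]
    simp only [eval_sub, eval_mul, eval_X, eval_C]
    have := cos_add_two_mul_rec (n * θ) θ
    push_cast at ih2 ⊢
    rw [show ((n : ℝ) + 2) * θ = n * θ + 2 * θ by ring, this, ← ih1,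
      show (n : ℝ) * θ + θ = (n + 1) * θ by ring, ← ih2]
    by_cases h : n = 0
    · simp [h]; ring
    · simp [h]; ring

lemma det_chebPoly_cos (e a : ℝ) {N : ℕ} (y : Fin N → ℝ) :
    (Matrix.of fun j k : Fin N => (chebPoly e a j.rev).eval (2 * Real.cos (2 * Real.pi * y k))).det
      = ∏ j : Fin N, ∏ k ∈ Ioi j,
        4 * (Real.sin (Real.pi * (y k - y j)) * Real.sin (Real.pi * (y k + y j))) := by
  rw [det_chebPoly e a fun k => 2 * Real.cos (2 * Real.pi * y k)]
  simp only [two_cos_sub_two_cos]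

/-- Weyl's denominator formula for the sines of integral multiples. -/
lemma det_sin_int {N : ℕ} (y : Fin N → ℝ) :
    (Matrix.of fun j k : Fin N => Real.sin (((j.rev : ℕ) + 1) * (2 * Real.pi * y k))).det
      = (∏ k, Real.sin (2 * Real.pi * y k)) * ∏ j : Fin N, ∏ k ∈ Ioi j,
        4 * (Real.sin (Real.pi * (y k - y j)) * Real.sin (Real.pi * (y k + y j))) := by
  rw [← det_chebPoly_cos 0 1, ← Matrix.det_mul_row]
  congr 1
  ext j k
  simp only [Matrix.of_apply, eval_chebPoly_sin_int]

/-- Weyl's denominator formula for the sines of half-integral multiples. -/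
lemma det_sin_half {N : ℕ} (y : Fin N → ℝ) :
    (Matrix.of fun j k : Fin N => Real.sin (((j.rev : ℕ) + 1 / 2) * (2 * Real.pi * y k))).det
      = (∏ k, Real.sin (Real.pi * y k)) * ∏ j : Fin N, ∏ k ∈ Ioi j,
        4 * (Real.sin (Real.pi * (y k - y j)) * Real.sin (Real.pi * (y k + y j))) := by
  rw [← det_chebPoly_cos 1 1, ← Matrix.det_mul_row]
  congr 1
  ext j k
  have := eval_chebPoly_sin_half (2 * Real.pi * y k) j.rev
  rw [show 2 * Real.pi * y k / 2 = Real.pi * y k by ring] at this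
  simp only [Matrix.of_apply, this]

/-- Weyl's denominator formula for cosines. -/
lemma det_cos {N : ℕ} (hN : 0 < N) (y : Fin N → ℝ) :
    (Matrix.of fun j k : Fin N => Real.cos ((j.rev : ℕ) * (2 * Real.pi * y k))).det
      = (1 / 2) ^ (N - 1) * ∏ j : Fin N, ∏ k ∈ Ioi j,
        4 * (Real.sin (Real.pi * (y k - y j)) * Real.sin (Real.pi * (y k + y j))) := by
  have h : ∏ j : Fin N, (if (j.rev : ℕ) = 0 then (1 : ℝ) else 1 / 2) = (1 / 2) ^ (N - 1) := by
    have h := Equiv.prod_comp Fin.revPerm fun j : Fin N => if (j : ℕ) = 0 then (1 : ℝ) else 1 / 2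
    simp only [Fin.revPerm_apply] at h
    rw [h]
    obtain ⟨n, rfl⟩ : ∃ n, N = n + 1 := ⟨N - 1, by omega⟩
    rw [Fin.prod_univ_succ]
    simp
  rw [← det_chebPoly_cos 0 2, ← h, ← Matrix.det_mul_column]
  congr 1
  ext j k
  simp only [Matrix.of_apply, eval_chebPoly_cos]

lemma prod_pairs_mul {N : ℕ} {β : Type} [CommMonoid β] (c : Fin N → β) :
    ∏ j : Fin N, ∏ k ∈ Ioi j, (c j * c k) = ∏ j, c j ^ (N - 1) := by
  have h1 : ∏ j : Fin N, ∏ k ∈ Ioi j, c k = ∏ k : Fin N, ∏ _j ∈ Iio k, c k :=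
    prod_comm' (by simp)
  simp only [prod_mul_distrib, h1]
  rw [← prod_mul_distrib]
  refine prod_congr rfl fun j _ => ?_
  rw [prod_const, prod_const, ← pow_add, Fin.card_Ioi, Fin.card_Iio]
  congr 1
  omega

lemma sum_card_Ioi (N : ℕ) : ∑ j : Fin N, (Ioi j).card = N * (N - 1) / 2 := by
  simp only [Fin.card_Ioi]
  rw [Fin.sum_univ_eq_sum_range (fun j => N - 1 - j) N, sum_range_reflect (fun j => j) N,
    sum_range_id]

lemma prod_pairs_const {N : ℕ} {β : Type} [CommMonoid β] (c : β) :
    ∏ j : Fin N, ∏ _k ∈ Ioi j, c = c ^ (N * (N - 1) / 2) := by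
  simp only [prod_const]
  rw [prod_pow_eq_pow_sum, sum_card_Ioi]

lemma cis_sub_cis (x y : ℝ) : cis y - cis x
    = cis (x / 2) * cis (y / 2) * (2 * Complex.I * (Real.sin (Real.pi * (y - x)) : ℝ)) := by
  have h1 : cis y = cis (x / 2) * cis (y / 2) * cis (((y - x) / 2 : ℝ) : ℂ) := by
    rw [← cis_add, ← cis_add]; congr 1; push_cast; ring
  have h2 : cis x = cis (x / 2) * cis (y / 2) * cis ((-((y - x) / 2) : ℝ) : ℂ) := by
    rw [← cis_add, ← cis_add]; congr 1; push_cast; ring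
  rw [h1, h2, cis_eq_cos_add_sin, cis_eq_cos_add_sin]
  have h3 : 2 * Real.pi * ((y - x) / 2) = Real.pi * (y - x) := by ring
  have h4 : 2 * Real.pi * -((y - x) / 2) = -(Real.pi * (y - x)) := by ring
  rw [h3, h4, Real.cos_neg, Real.sin_neg]
  push_cast; ring

/-- Weyl's denominator formula of type `A`. -/
lemma det_cis {N : ℕ} (y : Fin N → ℝ) :
    (Matrix.of fun j k : Fin N => cis (((j : ℕ) - ((N : ℂ) - 1) / 2) * y k)).det
      = (2 * Complex.I) ^ (N * (N - 1) / 2)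
        * ∏ j : Fin N, ∏ k ∈ Ioi j, ((Real.sin (Real.pi * (y k - y j)) : ℝ) : ℂ) := by
  have h0 : (Matrix.of fun j k : Fin N => cis (((j : ℕ) - ((N : ℂ) - 1) / 2) * y k))
      = Matrix.of fun j k => cis (-((N : ℂ) - 1) / 2 * y k)
        * (Matrix.vandermonde fun k => cis (y k)).transpose j k := by
    ext j k
    rw [Matrix.of_apply, Matrix.of_apply, Matrix.transpose_apply, Matrix.vandermonde_apply,
      ← cis_mul_nat, ← cis_add]
    congr 1; ring
  rw [h0, Matrix.det_mul_row, Matrix.det_transpose, Matrix.det_vandermonde]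
  simp only [cis_sub_cis, prod_mul_distrib]
  rw [prod_pairs_const, prod_pairs_const, ← mul_pow]
  have h1 : (∏ j : Fin N, ∏ _k ∈ Ioi j, cis (y j / 2)) * ∏ j : Fin N, ∏ k ∈ Ioi j, cis (y k / 2)
      = ∏ j, cis (y j / 2) ^ (N - 1) := by
    rw [← prod_pairs_mul]
    simp only [prod_mul_distrib]
  have h2 : (∏ k, cis (-((N : ℂ) - 1) / 2 * y k)) * ∏ j, cis (y j / 2) ^ (N - 1) = 1 := by
    rw [← prod_mul_distrib]
    refine prod_eq_one fun j _ => ?_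
    have hN : 1 ≤ N := by have := j.2; omega
    rw [← cis_mul_nat, ← cis_add]
    push_cast [Nat.cast_sub hN]
    rw [show -((N : ℂ) - 1) / 2 * y j + (N - 1) * (y j / 2) = 0 by ring, cis_zero]
  rw [h1, ← mul_assoc, ← mul_assoc, h2, one_mul]

end

section

open Finset

/-! ### The transition densities as theta functions -/

lemma thetaChar_ofReal {L : ℝ} (hL : 0 < L) {h : ℝ} (m : ℤ) (hm : (m : ℝ) = 2 * h) (x : ℝ) :
    (Summable fun n : ℤ => Real.exp (-L * ((n : ℝ) - h) ^ 2)
      * Real.cos (2 * Real.pi * ((n - h) * x))) ∧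
    thetaChar L h x = (∑' n : ℤ, Real.exp (-L * ((n : ℝ) - h) ^ 2)
      * Real.cos (2 * Real.pi * ((n - h) * x)) : ℝ) := by
  have h1 := (summable_thetaCharTerm hL h x).hasSum
  have h2 := (summable_thetaCharTerm hL h (-x)).hasSum
  rw [← thetaChar, thetaChar_neg L m hm] at h2
  rw [← thetaChar] at h1
  have h3 := (h1.add h2).div_const 2
  have hterm : ∀ n : ℤ, (thetaCharTerm L h x n + thetaCharTerm L h (-x) n) / 2
      = ((Real.exp (-L * ((n : ℝ) - h) ^ 2) * Real.cos (2 * Real.pi * ((n - h) * x)) : ℝ) : ℂ) := by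
    intro n
    have e1 : cis (((n : ℂ) - h) * x) = cis (((n - h) * x : ℝ) : ℂ) := by push_cast; rfl
    have e2 : cis (((n : ℂ) - h) * -x) = cis ((-((n - h) * x) : ℝ) : ℂ) := by push_cast; ring_nf
    rw [thetaCharTerm, thetaCharTerm, e1, e2, cis_eq_cos_add_sin, cis_eq_cos_add_sin, mul_neg,
      Real.cos_neg, Real.sin_neg]
    push_cast
    ring
  simp only [hterm] at h3
  have h4 : (thetaChar L h x + thetaChar L h x) / 2 = thetaChar L h x := by ring
  rw [h4] at h3
  have hs := Complex.summable_ofReal.1 h3.summable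
  exact ⟨hs, by rw [Complex.ofReal_tsum]; exact h3.tsum_eq.symm⟩

lemma tsum_sin_mul_sin {L : ℝ} (hL : 0 < L) {h : ℝ} (m : ℤ) (hm : (m : ℝ) = 2 * h) (x y : ℝ) :
    ((∑' n : ℤ, Real.exp (-L * ((n : ℝ) - h) ^ 2) * Real.sin (2 * Real.pi * ((n - h) * x))
      * Real.sin (2 * Real.pi * ((n - h) * y)) : ℝ) : ℂ)
      = (thetaChar L h (y - x) + (-1) * thetaChar L h (y + x)) / 2 := by
  obtain ⟨s1, e1⟩ := thetaChar_ofReal hL m hm (y - x)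
  obtain ⟨s2, e2⟩ := thetaChar_ofReal hL m hm (y + x)
  rw [← Complex.ofReal_sub, ← Complex.ofReal_add, e1, e2]
  have : ∀ n : ℤ, Real.exp (-L * ((n : ℝ) - h) ^ 2) * Real.sin (2 * Real.pi * ((n - h) * x))
      * Real.sin (2 * Real.pi * ((n - h) * y))
      = (Real.exp (-L * ((n : ℝ) - h) ^ 2) * Real.cos (2 * Real.pi * ((n - h) * (y - x)))
        + (-1) * (Real.exp (-L * ((n : ℝ) - h) ^ 2)
          * Real.cos (2 * Real.pi * ((n - h) * (y + x))))) / 2 := by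
    intro n
    have a1 : 2 * Real.pi * (((n : ℝ) - h) * (y - x))
      = 2 * Real.pi * ((n - h) * y) - 2 * Real.pi * ((n - h) * x) := by ring
    have a2 : 2 * Real.pi * (((n : ℝ) - h) * (y + x))
      = 2 * Real.pi * ((n - h) * y) + 2 * Real.pi * ((n - h) * x) := by ring
    rw [a1, a2, Real.cos_sub, Real.cos_add]; ring
  simp only [this]
  rw [tsum_div_const, Summable.tsum_add s1 (s2.mul_left _), tsum_mul_left]
  push_cast
  ring

lemma tsum_cos_mul_cos {L : ℝ} (hL : 0 < L) {h : ℝ} (m : ℤ) (hm : (m : ℝ) = 2 * h) (x y : ℝ) :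
    ((∑' n : ℤ, Real.exp (-L * ((n : ℝ) - h) ^ 2) * Real.cos (2 * Real.pi * ((n - h) * x))
      * Real.cos (2 * Real.pi * ((n - h) * y)) : ℝ) : ℂ)
      = (thetaChar L h (y - x) + 1 * thetaChar L h (y + x)) / 2 := by
  obtain ⟨s1, e1⟩ := thetaChar_ofReal hL m hm (y - x)
  obtain ⟨s2, e2⟩ := thetaChar_ofReal hL m hm (y + x)
  rw [← Complex.ofReal_sub, ← Complex.ofReal_add, e1, e2]
  have : ∀ n : ℤ, Real.exp (-L * ((n : ℝ) - h) ^ 2) * Real.cos (2 * Real.pi * ((n - h) * x))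
      * Real.cos (2 * Real.pi * ((n - h) * y))
      = (Real.exp (-L * ((n : ℝ) - h) ^ 2) * Real.cos (2 * Real.pi * ((n - h) * (y - x)))
        + Real.exp (-L * ((n : ℝ) - h) ^ 2)
          * Real.cos (2 * Real.pi * ((n - h) * (y + x)))) / 2 := by
    intro n
    have a1 : 2 * Real.pi * (((n : ℝ) - h) * (y - x))
      = 2 * Real.pi * ((n - h) * y) - 2 * Real.pi * ((n - h) * x) := by ring
    have a2 : 2 * Real.pi * (((n : ℝ) - h) * (y + x))
      = 2 * Real.pi * ((n - h) * y) + 2 * Real.pi * ((n - h) * x) := by ring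
    rw [a1, a2, Real.cos_sub, Real.cos_add]; ring
  simp only [this]
  rw [tsum_div_const, Summable.tsum_add s1 s2]
  push_cast
  ring

lemma tauVar_eq (r t : ℝ) (hr : 0 < r) :
    tauVar r t = Complex.I * ((t / (2 * r ^ 2) : ℝ) : ℂ) / Real.pi := by
  have hpi : (Real.pi : ℂ) ≠ 0 := by exact_mod_cast Real.pi_ne_zero
  have hr' : (r : ℂ) ≠ 0 := by exact_mod_cast hr.ne'
  rw [tauVar]
  push_cast
  field_simp

/-- Poisson summation: the theta series is a sum of Gaussians over the windings. -/
lemma thetaChar_poisson {L : ℝ} (hL : 0 < L) (h w : ℝ) :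
    thetaChar L h w = (Real.sqrt (Real.pi / L) : ℝ)
      * ∑' n : ℤ, ((Real.exp (-(Real.pi ^ 2 / L) * (w + n) ^ 2) : ℝ) : ℂ) * cis (n * h) := by
  have hpi : (Real.pi : ℂ) ≠ 0 := by exact_mod_cast Real.pi_ne_zero
  have hL' : (L : ℂ) ≠ 0 := by exact_mod_cast hL.ne'
  rw [thetaChar_eq_jacobiTheta₂, jacobiTheta₂_functional_equation, jacobiTheta₂]
  have h1 : (-Complex.I * (Complex.I * L / Real.pi)) = ((L / Real.pi : ℝ) : ℂ) := by
    push_cast; linear_combination (-(L : ℂ) / Real.pi) * Complex.I_sq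
  have h2 : ((L / Real.pi : ℝ) : ℂ) ^ (1 / 2 : ℂ) = (Real.sqrt (L / Real.pi) : ℝ) := by
    rw [Real.sqrt_eq_rpow, Complex.ofReal_cpow (by positivity)]; norm_num
  have h3 : (1 : ℂ) / (Real.sqrt (L / Real.pi) : ℝ) = (Real.sqrt (Real.pi / L) : ℝ) := by
    rw [← Complex.ofReal_one, ← Complex.ofReal_div, one_div, ← Real.sqrt_inv, inv_div]
  rw [h1, h2, h3, ← (Equiv.neg ℤ).tsum_eq]
  simp only [← tsum_mul_left, Equiv.neg_apply]
  refine tsum_congr fun n => ?_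
  rw [jacobiTheta₂_term, Complex.ofReal_exp, cis, cis]
  have hI := Complex.I_ne_zero
  have : ∀ a b c d A : ℂ, Complex.exp a * Complex.exp b * (A * Complex.exp c * Complex.exp d)
      = A * Complex.exp (a + b + c + d) := by
    intro a b c d A; rw [Complex.exp_add, Complex.exp_add, Complex.exp_add]; ring
  rw [this, ← Complex.exp_add]
  congr 2
  push_cast
  field_simp
  linear_combination (-((L : ℂ) ^ 2 * h ^ 2)) * Complex.I_sq

/-- The kernel built from `ϑ(z - x) + ε ϑ(z + x)`. -/
def reflKernel (L h : ℝ) (ε x z : ℂ) : ℂ := thetaChar L h (z - x) + ε * thetaChar L h (z + x)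

lemma pAa_eq {r t : ℝ} (hr : 0 < r) (ht : 0 < t) (v x : ℝ) :
    (pAa r 0 (2 * Real.pi * r * v) t (2 * Real.pi * r * x) : ℂ)
      = 1 / (2 * Real.pi * r) * reflKernel (t / (2 * r ^ 2)) 0 (-1) v x := by
  have h := tsum_sin_mul_sin (L := t / (2 * r ^ 2)) (h := 0) (by positivity) 0 (by simp) v x
  rw [reflKernel, pAa, Complex.ofReal_mul]
  have : ∀ n : ℤ, Real.exp (-(n : ℝ) ^ 2 * (t - 0) / (2 * r ^ 2))
      * Real.sin ((n : ℝ) * (2 * Real.pi * r * v) / r)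
      * Real.sin ((n : ℝ) * (2 * Real.pi * r * x) / r)
      = Real.exp (-(t / (2 * r ^ 2)) * ((n : ℝ) - 0) ^ 2)
        * Real.sin (2 * Real.pi * ((n - 0) * v)) * Real.sin (2 * Real.pi * ((n - 0) * x)) := by
    intro n
    have e1 : -(n : ℝ) ^ 2 * (t - 0) / (2 * r ^ 2) = -(t / (2 * r ^ 2)) * ((n : ℝ) - 0) ^ 2 := by
      ring
    have e2 : ∀ v : ℝ, (n : ℝ) * (2 * Real.pi * r * v) / r = 2 * Real.pi * ((n - 0) * v) := by
      intro v; field_simp; ring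
    rw [e1, e2, e2]
  simp only [this]
  rw [h]
  push_cast
  ring

lemma pRr_eq {r t : ℝ} (hr : 0 < r) (ht : 0 < t) (v x : ℝ) :
    (pRr r 0 (2 * Real.pi * r * v) t (2 * Real.pi * r * x) : ℂ)
      = 1 / (2 * Real.pi * r) * reflKernel (t / (2 * r ^ 2)) 0 1 v x := by
  have h := tsum_cos_mul_cos (L := t / (2 * r ^ 2)) (h := 0) (by positivity) 0 (by simp) v x
  rw [reflKernel, pRr, Complex.ofReal_mul]
  have : ∀ n : ℤ, Real.exp (-(n : ℝ) ^ 2 * (t - 0) / (2 * r ^ 2))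
      * Real.cos ((n : ℝ) * (2 * Real.pi * r * v) / r)
      * Real.cos ((n : ℝ) * (2 * Real.pi * r * x) / r)
      = Real.exp (-(t / (2 * r ^ 2)) * ((n : ℝ) - 0) ^ 2)
        * Real.cos (2 * Real.pi * ((n - 0) * v)) * Real.cos (2 * Real.pi * ((n - 0) * x)) := by
    intro n
    have e1 : -(n : ℝ) ^ 2 * (t - 0) / (2 * r ^ 2) = -(t / (2 * r ^ 2)) * ((n : ℝ) - 0) ^ 2 := by
      ring
    have e2 : ∀ v : ℝ, (n : ℝ) * (2 * Real.pi * r * v) / r = 2 * Real.pi * ((n - 0) * v) := by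
      intro v; field_simp; ring
    rw [e1, e2, e2]
  simp only [this]
  rw [h]
  push_cast
  ring

lemma pAr_eq {r t : ℝ} (hr : 0 < r) (ht : 0 < t) (v x : ℝ) :
    (pAr r 0 (2 * Real.pi * r * v) t (2 * Real.pi * r * x) : ℂ)
      = 1 / (2 * Real.pi * r) * reflKernel (t / (2 * r ^ 2)) (1 / 2) (-1) v x := by
  have h := tsum_sin_mul_sin (L := t / (2 * r ^ 2)) (h := 1 / 2) (by positivity) 1 (by simp) v x
  rw [reflKernel, pAr, Complex.ofReal_mul]
  have : ∀ n : ℤ, Real.exp (-((n : ℝ) - 1 / 2) ^ 2 * (t - 0) / (2 * r ^ 2))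
      * Real.sin (((n : ℝ) - 1 / 2) * (2 * Real.pi * r * v / r))
      * Real.sin (((n : ℝ) - 1 / 2) * (2 * Real.pi * r * x / r))
      = Real.exp (-(t / (2 * r ^ 2)) * ((n : ℝ) - 1 / 2) ^ 2)
        * Real.sin (2 * Real.pi * ((n - 1 / 2) * v))
        * Real.sin (2 * Real.pi * ((n - 1 / 2) * x)) := by
    intro n
    have e1 : -((n : ℝ) - 1 / 2) ^ 2 * (t - 0) / (2 * r ^ 2)
        = -(t / (2 * r ^ 2)) * ((n : ℝ) - 1 / 2) ^ 2 := by ring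
    have e2 : ∀ v : ℝ, ((n : ℝ) - 1 / 2) * (2 * Real.pi * r * v / r)
        = 2 * Real.pi * ((n - 1 / 2) * v) := by
      intro v; field_simp
    rw [e1, e2, e2]
  simp only [this]
  rw [h]
  push_cast
  ring

/-- The characteristic of the kernel of Brownian motion on the circle. -/
def circChar (N : ℕ) : ℝ := if Even N then 1 / 2 else 0

lemma pCirc_eq {r t : ℝ} (hr : 0 < r) (ht : 0 < t) (N : ℕ) (v x : ℝ) :
    (pCirc N r 0 (2 * Real.pi * r * v) t (2 * Real.pi * r * x) : ℂ)
      = 1 / (2 * Real.pi * r) * thetaChar (t / (2 * r ^ 2)) (circChar N) (x - v) := by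
  have h := thetaChar_poisson (L := t / (2 * r ^ 2)) (by positivity) (circChar N) (x - v)
  have hBM : ∀ n : ℤ, pBM 0 (2 * Real.pi * r * v) t (2 * Real.pi * r * x + 2 * Real.pi * r * n)
      = 1 / (2 * Real.pi * r) * (Real.sqrt (Real.pi / (t / (2 * r ^ 2)))
        * Real.exp (-(Real.pi ^ 2 / (t / (2 * r ^ 2))) * (x - v + n) ^ 2)) := by
    intro n
    rw [pBM, ← mul_assoc]
    congr 1
    · have h1 : Real.pi / (t / (2 * r ^ 2)) = (2 * Real.pi * r) ^ 2 / (2 * Real.pi * t) := by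
        field_simp
      rw [h1, Real.sqrt_div (by positivity), Real.sqrt_sq (by positivity), sub_zero]
      field_simp
    · congr 1
      rw [sub_zero]
      field_simp
      ring
  push_cast at h
  rw [h, pCirc]
  simp only [hBM]
  split_ifs with hN
  · rw [Complex.ofReal_tsum, ← tsum_mul_left, ← tsum_mul_left]
    refine tsum_congr fun n => ?_
    rw [circChar, if_pos hN]
    have := neg_one_zpow_eq_cis n
    push_cast
    rw [this]
    ring
  · rw [Complex.ofReal_tsum, ← tsum_mul_left, ← tsum_mul_left]
    refine tsum_congr fun n => ?_
    rw [circChar, if_neg hN]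
    push_cast
    rw [mul_zero, cis_zero]
    ring

/-! ### Discrete Fourier transforms of the kernels -/

/-- The Gaussian sum over a residue class. -/
def gaussSum (lam : ℝ) (M : ℕ) (ν : ℝ) : ℝ := ∑' l : ℤ, Real.exp (-lam * (ν + M * l) ^ 2)

lemma gaussSum_neg (lam : ℝ) (M : ℕ) (ν : ℝ) : gaussSum lam M (-ν) = gaussSum lam M ν := by
  rw [gaussSum, gaussSum, ← (Equiv.neg ℤ).tsum_eq]
  refine tsum_congr fun l => ?_
  simp only [Equiv.neg_apply]
  push_cast
  congr 2; ring

/-- On the lattice of mesh `1 / M`, exponentials are eigenvectors of the convolution with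
`thetaChar`, with Gaussian sums as eigenvalues. -/
lemma sum_cis_mul_thetaChar {lam : ℝ} (hlam : 0 < lam) {M : ℕ} (hM : 0 < M) (h s : ℝ) (k m : ℤ)
    {z : ℝ} (hz : z = (m + s) / M) :
    ∑ i ∈ range M, cis ((k - h) * ((i + s) / M)) * thetaChar lam h (z - (i + s) / M)
      = M * cis ((k - h) * z) * (gaussSum lam M (k - h) : ℝ) := by
  have hM' : (M : ℂ) ≠ 0 := by exact_mod_cast hM.ne'
  have hMZ : (M : ℤ) ≠ 0 := by exact_mod_cast hM.ne'
  have hzc : (z : ℂ) = (m + s) / M := by rw [hz]; push_cast; rfl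
  have h1 : HasSum (fun n : ℤ => ∑ i ∈ range M, cis ((k - h) * ((i + s) / M))
      * thetaCharTerm lam h (z - (i + s) / M) n)
      (∑ i ∈ range M, cis ((k - h) * ((i + s) / M)) * thetaChar lam h (z - (i + s) / M)) :=
    hasSum_sum fun i _ => (summable_thetaCharTerm hlam h _).hasSum.mul_left _
  have h2 : ∀ n : ℤ, ∑ i ∈ range M, cis ((k - h) * ((i + s) / M))
      * thetaCharTerm lam h (z - (i + s) / M) n
      = if (M : ℤ) ∣ k - n then thetaCharTerm lam h z n * (M * cis ((k - n : ℤ) * (s / M)))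
        else 0 := by
    intro n
    have : ∀ i : ℕ, cis ((k - h) * ((i + s) / M)) * thetaCharTerm lam h (z - (i + s) / M) n
        = thetaCharTerm lam h z n * cis ((k - n : ℤ) * ((i + s) / M)) := by
      intro i
      rw [thetaCharTerm, thetaCharTerm]
      have e1 : cis (((n : ℂ) - h) * (z - (i + s) / M))
          = cis (((n : ℂ) - h) * z) * cis (-((n : ℂ) - h) * ((i + s) / M)) := by
        rw [← cis_add]; congr 1; ring
      have e2 : cis ((k - n : ℤ) * ((i + s) / M))
          = cis ((k - h) * ((i + s) / M)) * cis (-((n : ℂ) - h) * ((i + s) / M)) := by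
        rw [← cis_add]; congr 1; push_cast; ring
      rw [e1, e2]; ring
    simp only [this]
    rw [← mul_sum, sum_cis_lattice hM]
    split_ifs <;> simp
  simp only [h2] at h1
  have hinj : Function.Injective fun l : ℤ => k + M * l := by
    intro a b hab
    exact mul_left_cancel₀ hMZ (add_left_cancel hab)
  rw [← hinj.hasSum_iff] at h1
  · have h3 : ∀ l : ℤ, ((fun n : ℤ => if (M : ℤ) ∣ k - n then
        thetaCharTerm lam h z n * (M * cis ((k - n : ℤ) * (s / M))) else 0)
          ∘ fun l : ℤ => k + M * l) l
        = (M * cis ((k - h) * z)) * (Real.exp (-lam * ((k - h) + M * l) ^ 2) : ℝ) := by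
      intro l
      have hdvd : (M : ℤ) ∣ k - (k + M * l) := ⟨-l, by ring⟩
      simp only [Function.comp, if_pos hdvd]
      rw [thetaCharTerm]
      have e1 : cis ((((k + M * l : ℤ) : ℂ) - h) * z) * cis ((k - (k + M * l) : ℤ) * (s / M))
          = cis ((k - h) * z) := by
        have : (((k + M * l : ℤ) : ℂ) - h) * z + ((k - (k + M * l) : ℤ) : ℂ) * (s / M)
            = (k - h) * z + ((l * m : ℤ) : ℂ) := by
          rw [hzc]; push_cast; field_simp; ring
        rw [← cis_add, this, cis_add, cis_int, mul_one]
      have e2 : Complex.exp (-lam * (((k + M * l : ℤ) : ℂ) - h) ^ 2)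
          = (Real.exp (-lam * ((k - h) + M * l) ^ 2) : ℝ) := by
        rw [Complex.ofReal_exp]; congr 1; push_cast; ring
      rw [e2, ← e1]; ring
    simp only [funext h3] at h1
    rw [gaussSum, Complex.ofReal_tsum, ← tsum_mul_left]
    exact h1.tsum_eq.symm
  · intro n hn
    rw [if_neg]
    rintro ⟨l, hl⟩
    exact hn ⟨-l, by simp only; linarith⟩

/-- On the lattice of mesh `1 / M`, trigonometric functions of the right parity are eigenvectors
of the reflected kernel. -/
lemma sum_lattice_reflKernel {lam : ℝ} (hlam : 0 < lam) {M : ℕ} (hM : 0 < M) {h s : ℝ} (k m : ℤ)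
    {kh ks : ℤ} (hh : (kh : ℝ) = 2 * h) (hs : (ks : ℝ) = 2 * s) {ε : ℂ} (hε : ε ^ 2 = 1)
    {z : ℝ} (hz : z = (m + s) / M) :
    ∑ i ∈ range M, (cis ((k - h) * ((i + s) / M)) + ε * cis (-(k - h) * ((i + s) / M)))
        * reflKernel lam h ε ((i + s) / M) z
      = 2 * M * (cis ((k - h) * z) + ε * cis (-(k - h) * z)) * (gaussSum lam M (k - h) : ℝ) := by
  have hh' : (kh : ℂ) = 2 * h := by exact_mod_cast hh
  have hz' : -z = ((-m - ks : ℤ) + s) / M := by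
    rw [hz]; push_cast; rw [hs]; ring
  have ek : (((kh - k : ℤ) : ℂ) - h) = -(k - h) := by push_cast; rw [hh']; ring
  have ekr : (((kh - k : ℤ) : ℝ) - h) = -(k - h) := by push_cast; rw [hh]; ring
  have a1 := sum_cis_mul_thetaChar hlam hM h s k m hz
  have a2 := sum_cis_mul_thetaChar hlam hM h s (kh - k) m hz
  have a3 := sum_cis_mul_thetaChar hlam hM h s k (-m - ks) hz'
  have a4 := sum_cis_mul_thetaChar hlam hM h s (kh - k) (-m - ks) hz'
  rw [ek, ekr, gaussSum_neg] at a2 a4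
  have hneg : ∀ i : ℕ, thetaChar lam h (((-z : ℝ) : ℂ) - (i + s) / M)
      = thetaChar lam h (z + (i + s) / M) := by
    intro i
    rw [← thetaChar_neg lam kh hh]
    congr 1; push_cast; ring
  simp only [hneg] at a3 a4
  have : ∀ i : ℕ, (cis ((k - h) * ((i + s) / M)) + ε * cis (-(k - h) * ((i + s) / M)))
        * reflKernel lam h ε ((i + s) / M) z
      = cis ((k - h) * ((i + s) / M)) * thetaChar lam h (z - (i + s) / M)
        + ε * (cis (-(k - h) * ((i + s) / M)) * thetaChar lam h (z - (i + s) / M))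
        + ε * (cis ((k - h) * ((i + s) / M)) * thetaChar lam h (z + (i + s) / M))
        + cis (-(k - h) * ((i + s) / M)) * thetaChar lam h (z + (i + s) / M) := by
    intro i
    rw [reflKernel]
    linear_combination (cis (-(k - h) * ((i + s) / M)) * thetaChar lam h (z + (i + s) / M)) * hε
  simp only [this, sum_add_distrib, ← mul_sum]
  rw [a1, a2, a3, a4]
  have e3 : ((k : ℂ) - h) * ((-z : ℝ) : ℂ) = -(k - h) * z := by push_cast; ring
  have e4 : -((k : ℂ) - h) * ((-z : ℝ) : ℂ) = (k - h) * z := by push_cast; ring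
  rw [e3, e4]
  ring

/-- Evaluation of the Gaussian sums, from the triple product. -/
lemma exp_mul_gaussSum {lam : ℝ} (hlam : 0 < lam) {M : ℕ} (hM : 0 < M) (J : ℝ) :
    Real.exp (lam * J ^ 2) * gaussSum lam M (M / 2 - J)
      = Real.exp (-lam * (M ^ 2 / 4 - M * J) + (logEuler (M * (M * lam))
        + (logShift (M * (M * lam)) (J / M) + logShift (M * (M * lam)) (1 - J / M)))) := by
  have hM' : (M : ℝ) ≠ 0 := by exact_mod_cast hM.ne'
  have hMpos : (0 : ℝ) < M := by exact_mod_cast hM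
  have key := tsum_exp_quadratic (L := M * (M * lam)) (by positivity) (-lam * M * (M - 2 * J))
  have e1 : 1 / 2 + -lam * M * (M - 2 * J) / (2 * (M * (M * lam))) = J / M := by
    field_simp; ring
  have e2 : 1 / 2 - -lam * M * (M - 2 * J) / (2 * (M * (M * lam))) = 1 - J / M := by
    field_simp; ring
  rw [e1, e2] at key
  rw [Real.exp_add, ← key, gaussSum, ← tsum_mul_left, ← tsum_mul_left]
  refine tsum_congr fun l => ?_
  rw [← Real.exp_add, ← Real.exp_add]
  congr 1; ring

end

section

open Finset

/-! ### Macdonald denominators as functions of one variable -/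

lemma QuasiPeriodic.const_mul {L : ℝ} {M : ℕ} {a b : ℂ} {f : ℂ → ℂ}
    (hf : QuasiPeriodic L M a b f) (c : ℂ) : QuasiPeriodic L M a b fun z => c * f z :=
  (quasiPeriodicSubmodule L M a b).smul_mem c hf

lemma theta1_neg (L : ℝ) (x : ℂ) :
    theta1 (-x) (Complex.I * L / Real.pi) = -theta1 x (Complex.I * L / Real.pi) := by
  rw [theta1_eq_thetaChar, theta1_eq_thetaChar]
  have h1 : -x + 1 / 2 = -(x + 1 / 2) + 1 := by ring
  rw [h1, thetaChar_add_one, thetaChar_neg L 1 (by norm_num)]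
  have : cis (-((1 / 2 : ℝ) : ℂ)) = -1 := by
    rw [cis_neg]; push_cast; rw [cis_half]; norm_num
  rw [this]; ring

lemma quasiPeriodic_theta1 {L lam : ℝ} (hlam : 0 < lam) (a k : ℕ) (hak : a * L = k * lam) (b : ℂ) :
    QuasiPeriodic L (k * a) ((-1) ^ a) ((-1) ^ k * cis (-k * b))
      fun z => theta1 (a * z + b) (Complex.I * lam / Real.pi) := by
  have h := (quasiPeriodic_thetaChar hlam (1 / 2) a k hak (b + 1 / 2)).const_mul (-1)
  have e1 : cis (-((1 / 2 : ℝ) : ℂ)) = -1 := by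
    rw [cis_neg]; push_cast; rw [cis_half]; norm_num
  have e2 : cis (-k * (b + 1 / 2)) = (-1) ^ k * cis (-k * b) := by
    have : -(k : ℂ) * (b + 1 / 2) = k * (-(1 / 2)) + -k * b := by ring
    rw [this, cis_add, cis_mul_nat, cis_neg, cis_half]; norm_num
  rw [e1, e2] at h
  convert h using 2 with z
  rw [theta1_eq_thetaChar]
  ring_nf

/-- The factor of the Macdonald denominator attached to a pair of indices. -/
def pairFactor (L : ℝ) (u v : ℂ) : ℂ :=
  theta1 (v - u) (Complex.I * L / Real.pi) * theta1 (v + u) (Complex.I * L / Real.pi)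

lemma pairFactor_swap (L : ℝ) (u v : ℂ) : pairFactor L u v = -pairFactor L v u := by
  unfold pairFactor
  rw [← neg_sub u v, theta1_neg, add_comm v u]; ring

lemma pairFactor_neg_right (L : ℝ) (u v : ℂ) : pairFactor L u (-v) = pairFactor L u v := by
  unfold pairFactor
  have h1 : -v - u = -(v + u) := by ring
  have h2 : -v + u = -(v - u) := by ring
  rw [h1, h2, theta1_neg, theta1_neg]; ring

lemma quasiPeriodic_pairFactor {L : ℝ} (hL : 0 < L) (c : ℂ) :
    QuasiPeriodic L 2 1 1 fun z => pairFactor L c z := by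
  have h1 := quasiPeriodic_theta1 (L := L) hL 1 1 (by simp) (-c)
  have h2 := quasiPeriodic_theta1 (L := L) hL 1 1 (by simp) c
  have h := h1.mul h2
  have e : (-1 : ℂ) ^ 1 * cis (-((1 : ℕ) : ℂ) * -c) * ((-1) ^ 1 * cis (-((1 : ℕ) : ℂ) * c)) = 1 := by
    have : cis (-((1 : ℕ) : ℂ) * -c) * cis (-((1 : ℕ) : ℂ) * c) = 1 := by
      rw [← cis_add, ← cis_zero]; congr 1; ring
    linear_combination this
  rw [e] at h
  convert h using 2 with z
  · norm_num
  · simp [pairFactor, sub_eq_add_neg]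

/-- The Macdonald denominators other than those of type `A` have the form
`∏ w(ξ_l) · ∏_{j<k} ϑ₁(ξ_k - ξ_j) ϑ₁(ξ_k + ξ_j)`. -/
def denominator (L : ℝ) (w : ℂ → ℂ) {N : ℕ} (x : Fin N → ℂ) : ℂ :=
  (∏ l, w (x l)) * ∏ j : Fin N, ∏ k ∈ Ioi j, pairFactor L (x j) (x k)

lemma denominator_comp_perm (L : ℝ) (w : ℂ → ℂ) {N : ℕ} (σ : Equiv.Perm (Fin N))
    (x : Fin N → ℂ) :
    denominator L w (x ∘ σ) = (Equiv.Perm.sign σ : ℤ) * denominator L w x := by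
  have h := Equiv.Perm.prod_Ioi_comp_eq_sign_mul_prod σ
    (f := fun j k => pairFactor L (x j) (x k)) fun j k => pairFactor_swap L _ _
  unfold denominator
  simp only [Function.comp_apply]
  rw [h, Equiv.prod_comp σ fun l => w (x l)]
  ring

open Function in
lemma prod_update {N : ℕ} (w : ℂ → ℂ) (x : Fin N → ℂ) (i : Fin N) (z : ℂ) :
    ∏ l, w (update x i z l) = (∏ l ∈ univ.erase i, w (x l)) * w z := by
  rw [← prod_erase_mul univ _ (mem_univ i), update_self]
  congr 1
  refine prod_congr rfl fun l hl => ?_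
  rw [update_of_ne (ne_of_mem_erase hl)]

open Function in
lemma quasiPeriodic_denominator {L : ℝ} (hL : 0 < L) {m : ℕ} {a b : ℂ} {w : ℂ → ℂ}
    (hw : QuasiPeriodic L m a b w) {N : ℕ} (x : Fin N → ℂ) (i : Fin N) :
    QuasiPeriodic L (m + 2 * (N - 1)) a b fun z => denominator L w (update x i z) := by
  have h1 : ∀ c, QuasiPeriodic L 2 1 1 fun z => pairFactor L z c := fun c => by
    have := (quasiPeriodic_pairFactor hL c).const_mul (-1)
    simpa only [neg_one_mul, ← pairFactor_swap] using this
  have h := (hw.const_mul (∏ l ∈ univ.erase i, w (x l))).mul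
    (quasiPeriodic_prod_pairs (b := fun _ => 1) h1 (quasiPeriodic_pairFactor hL) x i)
  simp only [one_pow, prod_const_one, mul_one] at h
  simpa only [denominator, prod_update] using h

open Function in
lemma denominator_update_neg (L : ℝ) {ε : ℂ} {w : ℂ → ℂ} (hw : ∀ z, w (-z) = ε * w z) {N : ℕ}
    (x : Fin N → ℂ) (i : Fin N) (z : ℂ) :
    denominator L w (update x i (-z)) = ε * denominator L w (update x i z) := by
  unfold denominator
  rw [prod_update, prod_update, hw, prod_pairs_slice_neg (F := pairFactor L)
    (fun c z => by rw [pairFactor_swap, pairFactor_neg_right, ← pairFactor_swap])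
    fun c z => pairFactor_neg_right L c z]
  ring

lemma reflKernel_neg (lam : ℝ) {h : ℝ} {ε : ℂ} (hε : ε ^ 2 = 1) (m : ℤ) (hm : (m : ℝ) = 2 * h)
    (x z : ℂ) : reflKernel lam h ε x (-z) = ε * reflKernel lam h ε x z := by
  unfold reflKernel
  have h1 : -z - x = -(z + x) := by ring
  have h2 : -z + x = -(z - x) := by ring
  rw [h1, h2, thetaChar_neg lam m hm, thetaChar_neg lam m hm]
  linear_combination (-thetaChar lam h (z + x)) * hε

/-- As a function of the end point, the reflected kernel started at a lattice point is
quasi-periodic. -/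
lemma quasiPeriodic_reflKernel {lam : ℝ} (hlam : 0 < lam) (h : ℝ) (ε : ℂ) (M : ℕ) {s : ℝ}
    (m ks : ℤ) (hs : (ks : ℝ) = 2 * s) {y : ℝ} (hy : M * y = m + s) :
    QuasiPeriodic (M * lam) M (cis (-h)) (cis s) fun z => reflKernel lam h ε y z := by
  have hy' : (M : ℂ) * y = m + s := by exact_mod_cast hy
  have hs' : (ks : ℂ) = 2 * s := by exact_mod_cast hs
  have h1 := quasiPeriodic_thetaChar hlam h 1 M (L := M * lam) (by simp) (-y)
  have h2 := (quasiPeriodic_thetaChar hlam h 1 M (L := M * lam) (by simp) y).const_mul ε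
  have e1 : cis (-M * -(y : ℂ)) = cis s := by
    have : -(M : ℂ) * -y = m + s := by linear_combination hy'
    rw [this, cis_add, cis_int, one_mul]
  have e2 : cis (-M * (y : ℂ)) = cis s := by
    have : -(M : ℂ) * y = ((-m - ks : ℤ) : ℂ) + s := by push_cast; linear_combination -hy' + hs'
    rw [this, cis_add, cis_int, one_mul]
  rw [e1] at h1
  rw [e2] at h2
  have := (quasiPeriodicSubmodule _ _ _ _).add_mem h1 h2
  simp only [mul_one, pow_one, Nat.cast_one, one_mul] at this
  exact this

end

section

open Finset

/-! ### Folding a lattice on the circle onto an alcove -/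

lemma sum_range_two_mul_of_symm (f : ℕ → ℂ) (n : ℕ) (hf : ∀ i < n, f (n + i) = f (n - 1 - i)) :
    ∑ i ∈ range (2 * n), f i = 2 * ∑ i ∈ range n, f i := by
  rw [two_mul n, sum_range_add, ← sum_range_reflect f n, two_mul]
  congr 1
  exact sum_congr rfl fun i hi => hf i (mem_range.1 hi)

/-- The lattice points `(i + s) / M`, `i < M`, of the circle `ℝ / ℤ` are the `N` nodes
`(k + a) / M` and their mirror images under `x ↦ -x`: every sum of a symmetric function over the
lattice is twice the sum over the nodes, except for corrections at the fixed points `0` and `1/2`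
of the reflection. The correction `d₀` (and likewise `d₁`) is `1` if the fixed point is a node,
`-1` if it is a lattice point but no node, and `0` if it is no lattice point. The functions are
written in the coordinate `u = M x`. -/
def IsFold (M N : ℕ) (s a d₀ d₁ : ℝ) : Prop :=
  ∀ G : ℝ → ℂ, (∀ u, G (M - u) = G u) →
    ∑ i ∈ range M, G (i + s) = 2 * ∑ k : Fin N, G (k + a) - d₀ * G 0 - d₁ * G (M / 2)

lemma IsFold.real {M N : ℕ} {s a d₀ d₁ : ℝ} (h : IsFold M N s a d₀ d₁) (G : ℝ → ℝ)
    (hG : ∀ u, G (M - u) = G u) :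
    ∑ i ∈ range M, G (i + s) = 2 * ∑ k : Fin N, G (k + a) - d₀ * G 0 - d₁ * G (M / 2) := by
  have := h (fun u => (G u : ℂ)) fun u => by rw [hG]
  exact_mod_cast this

lemma isFold_half_even (N : ℕ) : IsFold (2 * N) N (1 / 2) (1 / 2) 0 0 := by
  intro G hG
  rw [sum_range_two_mul_of_symm (fun i => G (i + 1 / 2)), Fin.sum_univ_eq_sum_range
    (fun k => G (k + 1 / 2))]
  · simp
  · intro i hi
    rw [← hG]
    congr 1
    have : ((N - 1 - i : ℕ) : ℝ) = N - 1 - i := by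
      rw [Nat.sub_sub, Nat.cast_sub (by omega)]; push_cast; ring
    rw [this]; push_cast; ring

lemma sum_range_odd_of_symm {M : ℕ} (n : ℕ) (hM : M = 2 * n + 1) (G : ℝ → ℂ)
    (hG : ∀ u, G (M - u) = G u) :
    ∑ i ∈ range M, G (i + 0) = G 0 + 2 * ∑ i ∈ range n, G (i + 1) := by
  subst hM
  rw [sum_range_succ', add_comm]
  push_cast at hG ⊢
  simp only [add_zero]
  congr 1
  rw [sum_range_two_mul_of_symm (fun i => G (i + 1))]
  intro i hi
  rw [← hG]
  congr 1
  have : ((n - 1 - i : ℕ) : ℝ) = n - 1 - i := by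
    rw [Nat.sub_sub, Nat.cast_sub (by omega)]; push_cast; ring
  rw [this]; push_cast; ring

lemma sum_range_even_of_symm {M : ℕ} (n : ℕ) (hM : M = 2 * n + 2) (G : ℝ → ℂ)
    (hG : ∀ u, G (M - u) = G u) :
    ∑ i ∈ range M, G (i + 0) = G 0 + 2 * ∑ i ∈ range n, G (i + 1) + G (n + 1) := by
  subst hM
  rw [sum_range_succ']
  push_cast at hG ⊢
  simp only [add_zero]
  have h1 : ∑ i ∈ range (2 * n + 1), G (i + 1)
      = ∑ i ∈ range n, G (i + 1) + G (n + 1) + ∑ i ∈ range n, G (i + 1) := by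
    rw [show 2 * n + 1 = (n + 1) + n by ring, sum_range_add, sum_range_succ]
    congr 1
    rw [← sum_range_reflect _ n]
    refine sum_congr rfl fun i hi => ?_
    have hi := mem_range.1 hi
    rw [← hG]
    congr 1
    have : ((n - 1 - i : ℕ) : ℝ) = n - 1 - i := by
      rw [Nat.sub_sub, Nat.cast_sub (by omega)]; push_cast; ring
    push_cast
    rw [this]; ring
  rw [h1]; ring

lemma isFold_half_odd (n : ℕ) : IsFold (2 * n + 1) (n + 1) (1 / 2) (1 / 2) 0 1 := by
  intro G hG
  rw [Fin.sum_univ_eq_sum_range (fun k => G (k + 1 / 2)), sum_range_succ _ n,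
    show 2 * n + 1 = (n + 1) + n by ring, sum_range_add, sum_range_succ]
  have h1 : ∑ i ∈ range n, G (((n + 1 + i : ℕ) : ℝ) + 1 / 2) = ∑ i ∈ range n, G (i + 1 / 2) := by
    rw [← sum_range_reflect _ n]
    refine sum_congr rfl fun i hi => ?_
    have hi := mem_range.1 hi
    rw [← hG]
    congr 1
    have : ((n - 1 - i : ℕ) : ℝ) = n - 1 - i := by
      rw [Nat.sub_sub, Nat.cast_sub (by omega)]; push_cast; ring
    push_cast
    rw [this]; ring
  rw [h1]
  have h2 : (((n + 1 + n : ℕ) : ℝ) / 2) = n + 1 / 2 := by push_cast; ring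
  rw [h2]; push_cast; ring

lemma isFold_one_even (N : ℕ) : IsFold (2 * N + 2) N 0 1 (-1) (-1) := by
  intro G hG
  rw [sum_range_even_of_symm N rfl G hG, Fin.sum_univ_eq_sum_range (fun k => G (k + 1))]
  have h2 : (((2 * N + 2 : ℕ) : ℝ) / 2) = N + 1 := by push_cast; ring
  rw [h2]; push_cast; ring

lemma isFold_one_odd (N : ℕ) : IsFold (2 * N + 1) N 0 1 (-1) 0 := by
  intro G hG
  rw [sum_range_odd_of_symm N rfl G hG, Fin.sum_univ_eq_sum_range (fun k => G (k + 1))]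
  push_cast; ring

lemma isFold_one_even_closed (n : ℕ) : IsFold (2 * n + 2) (n + 1) 0 1 (-1) 1 := by
  intro G hG
  rw [sum_range_even_of_symm n rfl G hG, Fin.sum_univ_eq_sum_range (fun k => G (k + 1)),
    sum_range_succ]
  have h2 : (((2 * n + 2 : ℕ) : ℝ) / 2) = n + 1 := by push_cast; ring
  rw [h2]; push_cast; ring

lemma isFold_zero_even_closed (n : ℕ) : IsFold (2 * n + 2) (n + 2) 0 0 1 1 := by
  intro G hG
  rw [sum_range_even_of_symm n rfl G hG, Fin.sum_univ_eq_sum_range (fun k => G (k + 0)),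
    sum_range_succ, sum_range_succ']
  have h2 : (((2 * n + 2 : ℕ) : ℝ) / 2) = n + 1 := by push_cast; ring
  rw [h2]; push_cast; simp only [add_zero]; ring

lemma isFold_zero_odd (n : ℕ) : IsFold (2 * n + 1) (n + 1) 0 0 1 0 := by
  intro G hG
  rw [sum_range_odd_of_symm n rfl G hG, Fin.sum_univ_eq_sum_range (fun k => G (k + 0)),
    sum_range_succ']
  push_cast; simp only [add_zero]; ring

lemma isFold_zero_even (n : ℕ) : IsFold (2 * n + 2) (n + 1) 0 0 1 (-1) := by
  intro G hG
  rw [sum_range_even_of_symm n rfl G hG, Fin.sum_univ_eq_sum_range (fun k => G (k + 0)),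
    sum_range_succ']
  have h2 : (((2 * n + 2 : ℕ) : ℝ) / 2) = n + 1 := by push_cast; ring
  rw [h2]; push_cast; simp only [add_zero]; ring

lemma norm_of_sq_eq_one {ε : ℂ} (hε : ε ^ 2 = 1) : ‖ε‖ = 1 := by
  have := congrArg norm hε
  rw [norm_pow, norm_one] at this
  exact (pow_eq_one_iff_of_nonneg (norm_nonneg _) two_ne_zero).1 this

/-- The nodes of an alcove are unisolvent for quasi-periodic functions of given parity. -/
lemma QuasiPeriodic.eq_zero_of_nodes {L : ℝ} {M N : ℕ} (hM : 0 < M) {s a d₀ d₁ h : ℝ} {ε : ℂ}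
    (hfold : IsFold M N s a d₀ d₁) (hε : ε ^ 2 = 1) (h0 : d₀ < 0 → ε = -1)
    (h1 : d₁ < 0 → ε = -1 ∧ h = 0) {f : ℂ → ℂ} (hf : QuasiPeriodic L M (cis (-h)) (cis s) f)
    (hpar : ∀ z, f (-z) = ε * f z) (hz : ∀ k : Fin N, f (((k + a) / M : ℝ) : ℂ) = 0) (u : ℝ) :
    f u = 0 := by
  have hM' : (M : ℝ) ≠ 0 := by exact_mod_cast hM.ne'
  have hn : ‖cis (-(h : ℂ))‖ = 1 := by
    have := norm_cis (-h)
    rwa [Complex.ofReal_neg] at this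
  have hsum := hfold.real (fun u => ‖f ((u / M : ℝ) : ℂ)‖) fun u => by
    have e : (((M - u) / M : ℝ) : ℂ) = -((u / M : ℝ) : ℂ) + 1 := by
      have : ((M - u) / M : ℝ) = -(u / M) + 1 := by field_simp; ring
      rw [this]; push_cast; ring
    simp only [e]
    rw [hf.add_one, hpar, norm_mul, norm_mul, hn, norm_of_sq_eq_one hε]
    ring
  simp only [hz, norm_zero, sum_const_zero, mul_zero, zero_sub, zero_div] at hsum
  have hA : 0 ≤ d₀ * ‖f ((0 : ℝ) : ℂ)‖ := by
    rcases lt_or_ge d₀ 0 with hd | hd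
    · have := hpar 0
      rw [h0 hd, neg_zero, neg_one_mul] at this
      rw [Complex.ofReal_zero, self_eq_neg.1 this]
      simp
    · positivity
  have hB : 0 ≤ d₁ * ‖f ((M / 2 / M : ℝ) : ℂ)‖ := by
    rcases lt_or_ge d₁ 0 with hd | hd
    · obtain ⟨he, hh⟩ := h1 hd
      have e : ((M / 2 / M : ℝ) : ℂ) = 1 / 2 := by
        have : (M / 2 / M : ℝ) = 1 / 2 := by field_simp
        rw [this]; push_cast; ring
      have h2 := hf.add_one (-(1 / 2))
      rw [hh, hpar, he] at h2
      norm_num at h2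
      rw [e, self_eq_neg.1 h2]
      simp
    · positivity
  have hle : ∑ i ∈ range M, ‖f (((i + s) / M : ℝ) : ℂ)‖ ≤ 0 := by
    rw [hsum]; linarith
  have hzero := (sum_eq_zero_iff_of_nonneg fun i _ => norm_nonneg _).1
    (le_antisymm hle (sum_nonneg fun i _ => norm_nonneg _))
  have hf' : QuasiPeriodic L M (cis ((-h : ℝ) : ℂ)) (cis s) f := by
    rwa [Complex.ofReal_neg]
  exact hf'.eq_zero_of_lattice hM (fun i hi => by simpa using hzero i (mem_range.2 hi)) u

/-- `cos (2πνx)` or `sin (2πνx)`, up to normalization, according to the sign `ε`. -/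
def trig (ε ν x : ℂ) : ℂ := cis (ν * x) + ε * cis (-ν * x)

lemma trig_one (n x : ℝ) : trig 1 n x = 2 * Real.cos (n * (2 * Real.pi * x)) := by
  unfold trig
  have h1 := cis_eq_cos_add_sin (n * x)
  have h2 := cis_eq_cos_add_sin (-n * x)
  push_cast at h1 h2 ⊢
  rw [h1, h2, show 2 * (Real.pi : ℂ) * (-n * x) = -(2 * Real.pi * (n * x)) by ring, Complex.cos_neg,
    Complex.sin_neg, show (n : ℂ) * (2 * Real.pi * x) = 2 * Real.pi * (n * x) by ring]
  ring

lemma trig_neg_one (n x : ℝ) :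
    trig (-1) n x = 2 * Complex.I * Real.sin (n * (2 * Real.pi * x)) := by
  unfold trig
  have h1 := cis_eq_cos_add_sin (n * x)
  have h2 := cis_eq_cos_add_sin (-n * x)
  push_cast at h1 h2 ⊢
  rw [h1, h2, show 2 * (Real.pi : ℂ) * (-n * x) = -(2 * Real.pi * (n * x)) by ring, Complex.cos_neg,
    Complex.sin_neg, show (n : ℂ) * (2 * Real.pi * x) = 2 * Real.pi * (n * x) by ring]
  ring

/-- Multiplied by weights that count the nodes fixed by the reflection one half, trigonometric
functions are eigenvectors of the reflected kernel at the nodes. -/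
lemma sum_nodes_reflKernel {lam : ℝ} (hlam : 0 < lam) {M N : ℕ} (hM : 0 < M)
    {s a d₀ d₁ h : ℝ} {ε : ℂ} (hfold : IsFold M N s a d₀ d₁) (hε : ε ^ 2 = 1)
    (h0 : d₀ < 0 → ε = -1) (h1 : d₁ < 0 → ε = -1 ∧ h = 0) {kh ks : ℤ} (hh : (kh : ℝ) = 2 * h)
    (hs : (ks : ℝ) = 2 * s) {w : Fin N → ℂ}
    (hw : ∀ G : ℝ → ℂ, (d₀ < 0 → G 0 = 0) → (d₁ < 0 → G (M / 2) = 0) →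
      2 * ∑ k : Fin N, w k * G (k + a) = 2 * ∑ k : Fin N, G (k + a) - d₀ * G 0 - d₁ * G (M / 2))
    {ν : ℝ} {k : ℤ} (hν : ν = k - h) (m : ℤ) {z : ℝ} (hz : z = (m + s) / M) :
    ∑ k : Fin N, w k * (trig ε ν ((k + a) / M : ℝ) * reflKernel lam h ε ((k + a) / M : ℝ) z)
      = M * trig ε ν z * gaussSum lam M ν := by
  have hM' : (M : ℝ) ≠ 0 := by exact_mod_cast hM.ne'
  have hh' : (kh : ℂ) = 2 * h := by exact_mod_cast hh
  have hc2 : cis (-(h : ℂ)) ^ 2 = 1 := by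
    rw [← cis_mul_nat]
    have : ((2 : ℕ) : ℂ) * -(h : ℂ) = ((-kh : ℤ) : ℂ) := by push_cast; linear_combination hh'
    rw [this, cis_int]
  have hc : cis (h : ℂ) = cis (-(h : ℂ)) := by
    have h3 : cis (h : ℂ) * cis (-(h : ℂ)) = 1 := by rw [← cis_add]; simp
    exact mul_right_cancel₀ (cis_ne_zero _) (h3.trans (by rw [← hc2]; ring))
  have hνc : cis (ν : ℂ) = cis (-(h : ℂ)) := by
    rw [hν]; push_cast; rw [sub_eq_add_neg, cis_add, cis_int, one_mul]
  have hνc' : cis (-(ν : ℂ)) = cis (-(h : ℂ)) := by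
    rw [cis_neg, hνc, ← cis_neg, neg_neg, hc]
  have htrig : ∀ x : ℂ, trig ε ν (1 - x) = cis (-(h : ℂ)) * (ε * trig ε ν x) := by
    intro x
    unfold trig
    rw [show (ν : ℂ) * (1 - x) = ν + -ν * x by ring, show -(ν : ℂ) * (1 - x) = -ν + ν * x by ring,
      cis_add, cis_add, hνc, hνc']
    linear_combination (-cis (-(h : ℂ)) * cis (-ν * x)) * hε
  have hker : ∀ x : ℂ, reflKernel lam h ε (1 - x) z
      = cis (-(h : ℂ)) * (ε * reflKernel lam h ε x z) := by
    intro x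
    unfold reflKernel
    have e1 : thetaChar lam h ((z : ℂ) + x) = cis (-(h : ℂ)) * thetaChar lam h (z - (1 - x)) := by
      rw [← thetaChar_add_one]; congr 1; ring
    have e2 : thetaChar lam h ((z : ℂ) + (1 - x)) = cis (-(h : ℂ)) * thetaChar lam h (z - x) := by
      rw [← thetaChar_add_one]; congr 1; ring
    rw [e1, e2]
    linear_combination (-thetaChar lam h (z - (1 - x))) * (hc2 * ε ^ 2 + hε)
  let G : ℝ → ℂ := fun u => trig ε ν (u / M : ℝ) * reflKernel lam h ε (u / M : ℝ) z
  have hG : ∀ u, G (M - u) = G u := by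
    intro u
    have e : (((M - u) / M : ℝ) : ℂ) = 1 - ((u / M : ℝ) : ℂ) := by
      have : ((M - u) / M : ℝ) = 1 - u / M := by field_simp
      rw [this]; push_cast; ring
    simp only [G, e, htrig, hker]
    linear_combination (trig ε ν (u / M : ℝ) * reflKernel lam h ε (u / M : ℝ) z)
      * (hc2 * ε ^ 2 + hε)
  have hG0 : d₀ < 0 → G 0 = 0 := fun hd => by
    simp [G, trig, h0 hd]
  have hG1 : d₁ < 0 → G (M / 2) = 0 := fun hd => by
    obtain ⟨he, hh0⟩ := h1 hd
    have e : ((M / 2 / M : ℝ) : ℂ) = 1 / 2 := by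
      have : (M / 2 / M : ℝ) = 1 / 2 := by field_simp
      rw [this]; push_cast; ring
    have : cis ((ν : ℂ) * (1 / 2)) = cis (-ν * (1 / 2)) := by
      have e2 : (ν : ℂ) * (1 / 2) = (k : ℤ) + -ν * (1 / 2) := by
        rw [hν, hh0]; push_cast; ring
      rw [e2, cis_add, cis_int, one_mul]
    simp only [G, e, trig, he]
    rw [this]; ring
  have h2 := hw G hG0 hG1
  rw [← hfold G hG] at h2
  have h3 := sum_lattice_reflKernel hlam hM k m hh hs hε hz
  have hνC : (ν : ℂ) = k - h := by rw [hν]; push_cast; ring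
  have h4 : ∑ i ∈ range M, G (i + s) = 2 * M * trig ε ν z * gaussSum lam M ν := by
    have : trig ε ν z = cis ((k - h) * z) + ε * cis (-(k - h) * z) := by rw [trig, hνC]
    rw [this, hν, ← h3]
    refine sum_congr rfl fun i _ => ?_
    simp only [G, trig, hνC]
    push_cast
    rfl
  rw [h4] at h2
  simp only [G] at h2
  linear_combination h2 / 2

end

section

open Finset

/-! ### Products over the nodes -/

/-- `∑ ℓ_L(y_k + f)` over the nodes `y_k = (k + a) / M`, where `ℓ_L = logCos L`. -/
def nodeSum (M N : ℕ) (a L f : ℝ) : ℝ := ∑ k : Fin N, logCos L ((k + a) / M + f)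

lemma logCos_sub_half (L x : ℝ) : logCos L (x - 1 / 2) = logCos L (x + 1 / 2) := by
  rw [← logCos_add_one L (x - 1 / 2)]; congr 1; ring

section Nodes

variable {M N : ℕ} {s a d₀ d₁ L : ℝ}

lemma nodeSum_zero (hL : 0 < L) (hM : 0 < M) (hfold : IsFold M N s a d₀ d₁) :
    2 * nodeSum M N a L 0
      = logCos (M * L) s + 2 * d₀ * logEuler L + 2 * d₁ * logShift L 1 := by
  have hM' : (M : ℝ) ≠ 0 := by exact_mod_cast hM.ne'
  have h := hfold.real (fun u => logCos L (u / M)) fun u => by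
    have : ((M : ℝ) - u) / M = -(u / M) + 1 := by field_simp; ring
    simp only [this]
    rw [logCos_add_one, logCos_neg]
  have h2 := sum_logCos hL hM (s / M)
  have e1 : ∀ i : ℕ, s / M + i / M = (i + s) / M := fun i => by ring
  have e2 : (M : ℝ) * (s / M) = s := by field_simp
  have e3 : (M : ℝ) / 2 / M = 1 / 2 := by field_simp
  simp only [e1, e2] at h2
  rw [h2, e3, zero_div, logCos_zero, logCos_half] at h
  simp only [nodeSum, add_zero]
  linarith

lemma nodeSum_half (hL : 0 < L) (hM : 0 < M) (hfold : IsFold M N s a d₀ d₁) :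
    2 * nodeSum M N a L (1 / 2)
      = logCos (M * L) (s + M / 2) + 2 * d₀ * logShift L 1 + 2 * d₁ * logEuler L := by
  have hM' : (M : ℝ) ≠ 0 := by exact_mod_cast hM.ne'
  have h := hfold.real (fun u => logCos L (u / M + 1 / 2)) fun u => by
    have : ((M : ℝ) - u) / M + 1 / 2 = -(u / M - 1 / 2) + 1 := by field_simp; ring
    simp only [this]
    rw [logCos_add_one, logCos_neg, logCos_sub_half]
  have h2 := sum_logCos hL hM (s / M + 1 / 2)
  have e1 : ∀ i : ℕ, s / M + 1 / 2 + i / M = (i + s) / M + 1 / 2 := fun i => by ring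
  have e2 : (M : ℝ) * (s / M + 1 / 2) = s + M / 2 := by field_simp
  have e3 : (M : ℝ) / 2 / M + 1 / 2 = 0 + 1 := by field_simp; ring
  simp only [e1, e2] at h2
  rw [h2, e3, zero_div, logCos_add_one, logCos_zero, zero_add, logCos_half] at h
  simp only [nodeSum]
  linarith

lemma sum_nodes_logCos_two_mul (hL : 0 < L) :
    ∑ k : Fin N, logCos L (2 * ((k + a) / M))
      = nodeSum M N a (L / 2) 0 + nodeSum M N a (L / 2) (1 / 2) := by
  simp only [nodeSum, ← sum_add_distrib, add_zero]
  exact sum_congr rfl fun k _ => logCos_two_mul hL _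

/-- The product over all nodes of the factors attached to a fixed node. -/
lemma sum_nodes_logCos (hL : 0 < L) (hM : 0 < M) (hfold : IsFold M N s a d₀ d₁) (m ks : ℤ)
    (hs : (ks : ℝ) = 2 * s) {y : ℝ} (hy : M * y = m + s) :
    ∑ j : Fin N, (logCos L (y - (j + a) / M) + logCos L (y + (j + a) / M))
      = 2 * logEuler (M * L) + d₀ * logCos L y + d₁ * logCos L (y + 1 / 2) := by
  have hM' : (M : ℝ) ≠ 0 := by exact_mod_cast hM.ne'
  have h := hfold.real (fun u => logCos L (y - u / M) + logCos L (y + u / M)) fun u => by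
    have e1 : y - ((M : ℝ) - u) / M + 1 = y + u / M := by field_simp; ring
    have e2 : y + ((M : ℝ) - u) / M = y - u / M + 1 := by field_simp; ring
    simp only [e2]
    rw [← logCos_add_one L (y - ((M : ℝ) - u) / M), e1, logCos_add_one, add_comm]
  have h1 := sum_logCos hL hM (y + s / M)
  have h2 := sum_logCos hL hM (-y + s / M)
  have e1 : ∀ i : ℕ, y + s / M + i / M = y + (i + s) / M := fun i => by ring
  have e2 : ∀ i : ℕ, logCos L (-y + s / M + i / M) = logCos L (y - (i + s) / M) := fun i => by
    rw [← logCos_neg]; congr 1; ring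
  have e3 : (M : ℝ) * (y + s / M) = 0 + ((m + ks : ℤ) : ℝ) := by
    push_cast; rw [hs]; field_simp; linear_combination hy
  have e4 : (M : ℝ) * (-y + s / M) = 0 + ((-m : ℤ) : ℝ) := by
    push_cast; field_simp; linear_combination -hy
  have e5 : (M : ℝ) / 2 / M = 1 / 2 := by field_simp
  simp only [e1, e3, logCos_add_int, logCos_zero] at h1
  simp only [e2, e4, logCos_add_int, logCos_zero] at h2
  rw [sum_add_distrib, h1, h2, e5, logCos_sub_half] at h
  simp only [zero_div, sub_zero, add_zero] at h
  linarith

lemma sum_univ_eq_sum_pairs (f : Fin N → Fin N → ℝ) (hf : ∀ j k, f j k = f k j) :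
    ∑ j, ∑ k, f j k = 2 * ∑ j, ∑ k ∈ Ioi j, f j k + ∑ j, f j j := by
  have h1 : ∀ j : Fin N, ∑ k, f j k = ∑ k ∈ Ioi j, f j k + ∑ k ∈ Iio j, f j k + f j j := by
    intro j
    have hu : (univ : Finset (Fin N)) = insert j (Ioi j ∪ Iio j) := by
      ext k
      simp only [mem_univ, mem_insert, mem_union, mem_Ioi, mem_Iio, true_iff]
      rcases lt_trichotomy k j with h | h | h <;> simp [h]
    rw [hu, sum_insert (by simp), sum_union, add_comm]
    rw [disjoint_left]
    intro k hk hk'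
    exact lt_asymm (mem_Ioi.1 hk) (mem_Iio.1 hk')
  have h2 : ∑ j, ∑ k ∈ Iio j, f j k = ∑ j, ∑ k ∈ Ioi j, f j k := by
    rw [sum_comm' (s' := fun k => Ioi k) (t' := univ) (by simp)]
    exact sum_congr rfl fun j _ => sum_congr rfl fun k _ => hf _ _
  simp only [h1, sum_add_distrib, h2]
  ring

/-- The double product over pairs of nodes. -/
lemma sum_pairs_logCos (hL : 0 < L) (hM : 0 < M) (hfold : IsFold M N s a d₀ d₁) {ks ka : ℤ}
    (hs : (ks : ℝ) = 2 * s) (ha : a = ka + s) :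
    2 * ∑ j : Fin N, ∑ k ∈ Ioi j,
        (logCos L ((k + a) / M - (j + a) / M) + logCos L ((k + a) / M + (j + a) / M))
      = 2 * N * logEuler (M * L) - 2 * N * logEuler L
        - (nodeSum M N a (L / 2) 0 + nodeSum M N a (L / 2) (1 / 2))
        + d₀ * nodeSum M N a L 0 + d₁ * nodeSum M N a L (1 / 2) := by
  have hM' : (M : ℝ) ≠ 0 := by exact_mod_cast hM.ne'
  have h1 := sum_univ_eq_sum_pairs (fun j k : Fin N =>
    logCos L ((k + a) / M - (j + a) / M) + logCos L ((k + a) / M + (j + a) / M)) fun j k => by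
      rw [← logCos_neg, add_comm ((k + a) / M : ℝ)]; congr 2; ring
  have h2 : ∀ k : Fin N, ∑ j : Fin N,
      (logCos L ((j + a) / M - (k + a) / M) + logCos L ((j + a) / M + (k + a) / M))
      = 2 * logEuler (M * L) + d₀ * logCos L ((k + a) / M + 0)
        + d₁ * logCos L ((k + a) / M + 1 / 2) := by
    intro k
    have hy : (M : ℝ) * ((k + a) / M) = ((k + ka : ℤ) : ℝ) + s := by
      push_cast; field_simp; linear_combination ha
    rw [add_zero, ← sum_nodes_logCos hL hM hfold _ ks hs hy]
    refine sum_congr rfl fun j _ => ?_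
    rw [← logCos_neg, add_comm ((j + a) / M : ℝ)]; congr 2; ring
  have h3 : ∀ k : Fin N, ((k : ℝ) + a) / M + (k + a) / M = 2 * ((k + a) / M) := fun k => by ring
  simp only [h2, h3, sub_self, logCos_zero, sum_add_distrib, sum_nodes_logCos_two_mul hL,
    ← mul_sum, sum_const, card_univ, Fintype.card_fin, nsmul_eq_mul] at h1
  simp only [sum_add_distrib]
  simp only [nodeSum] at h1 ⊢
  linarith

/-- The product of the Gaussian sums attached to the frequencies `M / 2 - (j + b)`. -/
lemma sum_fold_logShift (hL : 0 < L) (hM : 0 < M) {ρ b : ℝ} (hfold : IsFold M N ρ b d₀ d₁) :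
    2 * ∑ j : Fin N, (logShift (M * L) ((j + b) / M) + logShift (M * L) (1 - (j + b) / M))
      = logShift L ρ + logShift L (1 - ρ) + d₀ * (Real.log 2 + 2 * logShift (M * L) 1)
        + d₁ * (2 * logShift (M * L) (1 / 2)) := by
  have hM' : (M : ℝ) ≠ 0 := by exact_mod_cast hM.ne'
  have hMpos : (0 : ℝ) < M := by exact_mod_cast hM
  have h := hfold.real (fun u => logShift (M * L) (u / M) + logShift (M * L) (1 - u / M))
    fun u => by
      have e1 : ((M : ℝ) - u) / M = 1 - u / M := by field_simp
      simp only [e1]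
      rw [add_comm, sub_sub_cancel]
  have h1 := sum_logShift hL hM ρ
  have h2 := sum_logShift hL hM (1 - ρ)
  have h3 : ∑ i ∈ range M, logShift (M * L) (1 - (i + ρ) / M) = logShift L (1 - ρ) := by
    rw [← h2, ← sum_range_reflect]
    refine sum_congr rfl fun i hi => ?_
    have hi := mem_range.1 hi
    congr 1
    have : ((M - 1 - i : ℕ) : ℝ) = M - 1 - i := by
      rw [Nat.sub_sub, Nat.cast_sub (by omega)]; push_cast; ring
    rw [this]; field_simp; ring
  have e5 : (M : ℝ) / 2 / M = 1 / 2 := by field_simp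
  have e6 : (1 : ℝ) - 1 / 2 = 1 / 2 := by norm_num
  rw [sum_add_distrib, h1, h3, e5, e6, zero_div, sub_zero, logShift_zero (by positivity)] at h
  linarith

end Nodes

lemma sum_fin_cast (N : ℕ) : ∑ j : Fin N, (j : ℝ) = N * (N - 1) / 2 := by
  rw [Fin.sum_univ_eq_sum_range (fun j => (j : ℝ)) N]
  induction N with
  | zero => simp
  | succ n ih => rw [sum_range_succ, ih]; push_cast; ring

/-- The exponent of `exp (λ J²)` times the Gaussian sum of frequency `M / 2 - J`, where
`L = M λ`; see `exp_mul_gaussSum`. -/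
def gaussExp (M : ℕ) (L J : ℝ) : ℝ := -(L * (M / 4 - J)) + (logEuler (M * L)
  + (logShift (M * L) (J / M) + logShift (M * L) (1 - J / M)))

/-- The left hand side is the entry `e^{λ J²}` of the matrix `R` times the eigenvalue of the
kernel. -/
lemma exp_mul_gaussSum_eq {lam L : ℝ} (hlam : 0 < lam) {M : ℕ} (hM : 0 < M) (hL : L = M * lam)
    (J : ℝ) : Real.exp (lam * J ^ 2) * gaussSum lam M (M / 2 - J) = Real.exp (gaussExp M L J) := by
  rw [exp_mul_gaussSum hlam hM, gaussExp, hL]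
  congr 1; ring

lemma sum_gaussExp {M N : ℕ} {L ρ b d₀ d₁ : ℝ} (hL : 0 < L) (hM : 0 < M)
    (hfold : IsFold M N ρ b d₀ d₁) :
    2 * ∑ j : Fin N, gaussExp M L (j + b)
      = -(L * (N * M / 2 - N * (N - 1) - 2 * N * b)) + 2 * N * logEuler (M * L)
        + (logShift L ρ + logShift L (1 - ρ) + d₀ * (Real.log 2 + 2 * logShift (M * L) 1)
          + d₁ * (2 * logShift (M * L) (1 / 2))) := by
  rw [← sum_fold_logShift hL hM hfold]
  have h1 : ∑ j : Fin N, -(L * (M / 4 - ((j : ℝ) + b)))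
      = -(L * (N * M / 4 - N * (N - 1) / 2 - N * b)) := by
    rw [sum_neg_distrib, ← mul_sum, sum_sub_distrib, sum_add_distrib, sum_fin_cast]
    simp only [sum_const, card_univ, Fintype.card_fin, nsmul_eq_mul]
    ring
  simp only [gaussExp]
  rw [sum_add_distrib, h1, sum_add_distrib]
  simp only [sum_const, card_univ, Fintype.card_fin, nsmul_eq_mul]
  ring

end

section

open Finset

/-! ### Comparison of the products for the individual types -/

lemma logCos_half_eq {L : ℝ} (hL : 0 < L) :
    logCos L (1 / 2) = 2 * (logEuler (2 * L) - logEuler L) := by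
  rw [logCos_half, logShift_one hL]

lemma logCos_int (L : ℝ) (m : ℤ) : logCos L m = 2 * logEuler L := by
  rw [← zero_add (m : ℝ), logCos_add_int, logCos_zero]

/-- The exponent of the part of the Macdonald denominator that comes from pairs of nodes. -/
def pairExp (M N : ℕ) (a L : ℝ) : ℝ := N * (N - 1) * (logEuler L - L / 4)
  + ∑ j : Fin N, ∑ k ∈ Ioi j,
    (logCos L ((k + a) / M - (j + a) / M) + logCos L ((k + a) / M + (j + a) / M))

/-- The exponents on both sides of the product formula, in terms of `logEuler` and `logCos`. -/
lemma exponents {M N : ℕ} {L s a b ρ d₀ d₁ e₀ e₁ : ℝ} (hL : 0 < L) (hM : 0 < M)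
    (hfold : IsFold M N s a d₀ d₁) (hfold' : IsFold M N ρ b e₀ e₁) {ks ka : ℤ}
    (hs : (ks : ℝ) = 2 * s) (ha : a = ka + s) :
    2 * nodeSum M N a L 0 = logCos (M * L) s + 2 * d₀ * logEuler L
        + 2 * d₁ * (logEuler (2 * L) - logEuler L)
    ∧ 2 * nodeSum M N a L (1 / 2) = logCos (M * L) (s + M / 2)
        + 2 * d₀ * (logEuler (2 * L) - logEuler L) + 2 * d₁ * logEuler L
    ∧ 2 * nodeSum M N a (L / 2) 0 = logCos (M * L / 2) s + 2 * d₀ * logEuler (L / 2)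
        + 2 * d₁ * (logEuler L - logEuler (L / 2))
    ∧ 2 * nodeSum M N a (L / 2) (1 / 2) = logCos (M * L / 2) (s + M / 2)
        + 2 * d₀ * (logEuler L - logEuler (L / 2)) + 2 * d₁ * logEuler (L / 2)
    ∧ 2 * pairExp M N a L = 2 * (N * (N - 1)) * (logEuler L - L / 4)
        + 2 * N * logEuler (M * L) - 2 * N * logEuler L
        - (nodeSum M N a (L / 2) 0 + nodeSum M N a (L / 2) (1 / 2))
        + d₀ * nodeSum M N a L 0 + d₁ * nodeSum M N a L (1 / 2)
    ∧ 2 * ∑ j : Fin N, gaussExp M L (j + b)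
      = -(L * (N * M / 2 - N * (N - 1) - 2 * N * b)) + 2 * N * logEuler (M * L)
        + (logShift L ρ + logShift L (1 - ρ)
          + e₀ * (Real.log 2 + 2 * (logEuler (2 * (M * L)) - logEuler (M * L)))
          + e₁ * (2 * (2 * logEuler (M * L) - logEuler (M * L / 2) - logEuler (2 * (M * L))))) := by
  have hMpos : (0 : ℝ) < M := by exact_mod_cast hM
  have e1 : (M : ℝ) * (L / 2) = M * L / 2 := by ring
  have e2 : 2 * (L / 2) = L := by ring
  refine ⟨?_, ?_, ?_, ?_, ?_, ?_⟩
  · rw [nodeSum_zero hL hM hfold, logShift_one hL]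
  · rw [nodeSum_half hL hM hfold, logShift_one hL]
  · rw [nodeSum_zero (by positivity) hM hfold, logShift_one (by positivity), e1, e2]
  · rw [nodeSum_half (by positivity) hM hfold, logShift_one (by positivity), e1, e2]
  · rw [pairExp, mul_add, sum_pairs_logCos hL hM hfold hs ha]; ring
  · rw [sum_gaussExp hL hM hfold', logShift_one (by positivity), logShift_half (by positivity)]

lemma sum_nodes_logCos_double {M N : ℕ} {a L : ℝ} (hL : 0 < L) :
    ∑ k : Fin N, logCos (2 * L) (2 * ((k + a) / M))
      = nodeSum M N a L 0 + nodeSum M N a L (1 / 2) := by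
  rw [sum_nodes_logCos_two_mul (by positivity)]
  congr 2 <;> ring

lemma balance_B (n : ℕ) {L : ℝ} (hL : 0 < L) :
    Real.log 2 + L * ((n + 1) * n / 4) - (n + 1) * n * logEuler L
      + ∑ k : Fin (n + 1), (-(L / 4) + logEuler L + logCos L ((k + 1 / 2) / (2 * n + 1 : ℕ)))
      + pairExp (2 * n + 1) (n + 1) (1 / 2) L
    = ∑ j : Fin (n + 1), gaussExp (2 * n + 1) L (j + 0) := by
  obtain ⟨X0, X1, Y0, Y1, P, K⟩ := exponents hL (by omega) (isFold_half_odd n) (isFold_zero_odd n)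
    (ks := 1) (ka := 0) (by norm_num) (by norm_num)
  have hML : 0 < ((2 * n + 1 : ℕ) : ℝ) * L := by positivity
  have e : (1 / 2 : ℝ) + ((2 * n + 1 : ℕ) : ℝ) / 2 = ((n + 1 : ℤ) : ℝ) := by push_cast; ring
  have e' : 2 * (((2 * n + 1 : ℕ) : ℝ) * L / 2) = ((2 * n + 1 : ℕ) : ℝ) * L := by ring
  have S : ∑ k : Fin (n + 1), logCos L ((k + 1 / 2) / (2 * n + 1 : ℕ))
    = nodeSum (2 * n + 1) (n + 1) (1 / 2) L 0 := by simp [nodeSum]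
  rw [logCos_half_eq hML] at X0
  rw [e, logCos_int] at X1
  rw [logCos_half_eq (by positivity), e'] at Y0
  rw [e, logCos_int] at Y1
  rw [sub_zero, logShift_zero hL, logShift_one hL] at K
  rw [sum_add_distrib, S]
  have hM : L * ((n + 1 : ℕ) * (2 * n + 1 : ℕ)) = L * ((n + 1) * (2 * n + 1)) := by push_cast; ring
  set m : ℝ := ((2 * n + 1 : ℕ) : ℝ)
  simp only [sum_const, card_univ, Fintype.card_fin, nsmul_eq_mul] at *
  push_cast at *
  linarith

lemma balance_Bv (n : ℕ) {L : ℝ} (hL : 0 < L) :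
    Real.log 2 + L * ((n + 1) * n / 4) - n ^ 2 * logEuler L - n * logEuler (2 * L)
      + ∑ k : Fin (n + 1), (-(2 * L / 4) + logEuler (2 * L)
        + logCos (2 * L) (2 * ((k + 1 / 2) / (2 * n + 2 : ℕ))))
      + pairExp (2 * n + 2) (n + 1) (1 / 2) L
    = ∑ j : Fin (n + 1), gaussExp (2 * n + 2) L (j + 0) := by
  obtain ⟨X0, X1, Y0, Y1, P, K⟩ := exponents (M := 2 * n + 2) hL (by omega) (isFold_half_even (n + 1))
    (isFold_zero_even n) (ks := 1) (ka := 0) (by norm_num) (by norm_num)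
  have hML : 0 < ((2 * n + 2 : ℕ) : ℝ) * L := by positivity
  have e : (1 / 2 : ℝ) + ((2 * n + 2 : ℕ) : ℝ) / 2 = 1 / 2 + ((n + 1 : ℤ) : ℝ) := by push_cast; ring
  have e' : 2 * (((2 * n + 2 : ℕ) : ℝ) * L / 2) = ((2 * n + 2 : ℕ) : ℝ) * L := by ring
  rw [logCos_half_eq hML] at X0
  rw [e, logCos_add_int, logCos_half_eq hML] at X1
  rw [logCos_half_eq (by positivity), e'] at Y0
  rw [e, logCos_add_int, logCos_half_eq (by positivity), e'] at Y1
  rw [sub_zero, logShift_zero hL, logShift_one hL] at K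
  rw [sum_add_distrib, sum_nodes_logCos_double hL]
  have hM : L * ((n + 1 : ℕ) * (2 * n + 2 : ℕ)) = L * ((n + 1) * (2 * n + 2)) := by push_cast; ring
  set m : ℝ := ((2 * n + 2 : ℕ) : ℝ)
  simp only [sum_const, card_univ, Fintype.card_fin, nsmul_eq_mul] at *
  push_cast at *
  linarith

lemma balance_C (N : ℕ) {L : ℝ} (hL : 0 < L) :
    L * (N ^ 2 / 4) - N * (N - 1) * logEuler L
      + ∑ k : Fin N, (-(L / 4) + logEuler L + logCos L (2 * ((k + 1) / (2 * N + 2 : ℕ))))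
      + pairExp (2 * N + 2) N 1 L
    = ∑ j : Fin N, gaussExp (2 * N + 2) L (j + 1) := by
  obtain ⟨X0, X1, Y0, Y1, P, K⟩ := exponents hL (by omega) (isFold_one_even N)
    (isFold_one_even N) (ks := 0) (ka := 1) (by norm_num) (by norm_num)
  have hML : 0 < ((2 * N + 2 : ℕ) : ℝ) * L := by positivity
  have e : (0 : ℝ) + ((2 * N + 2 : ℕ) : ℝ) / 2 = ((N + 1 : ℤ) : ℝ) := by push_cast; ring
  rw [logCos_zero] at X0
  rw [e, logCos_int] at X1
  rw [logCos_zero] at Y0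
  rw [e, logCos_int] at Y1
  rw [sub_zero, logShift_zero hL, logShift_one hL] at K
  rw [sum_add_distrib, sum_nodes_logCos_two_mul hL]
  have hM : L * (N * (2 * N + 2 : ℕ)) = L * (N * (2 * N + 2)) := by push_cast; ring
  set m : ℝ := ((2 * N + 2 : ℕ) : ℝ)
  simp only [sum_const, card_univ, Fintype.card_fin, nsmul_eq_mul] at *
  linarith

lemma balance_Cv (n : ℕ) {L : ℝ} (hL : 0 < L) :
    L * ((n + 1) * (2 * n + 1) / 8) - n ^ 2 * logEuler L - n * logEuler (L / 2)
      + ∑ k : Fin (n + 1), (-(L / 2 / 4) + logEuler (L / 2)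
        + logCos (L / 2) ((k + 1) / (2 * n + 2 : ℕ)))
      + pairExp (2 * n + 2) (n + 1) 1 L
    = ∑ j : Fin (n + 1), gaussExp (2 * n + 2) L (j + 1 / 2) := by
  obtain ⟨X0, X1, Y0, Y1, P, K⟩ := exponents hL (by omega) (isFold_one_even_closed n)
    (isFold_half_even (n + 1)) (ks := 0) (ka := 1) (by norm_num) (by norm_num)
  have hML : 0 < ((2 * n + 2 : ℕ) : ℝ) * L := by positivity
  have e : (0 : ℝ) + ((2 * n + 2 : ℕ) : ℝ) / 2 = ((n + 1 : ℤ) : ℝ) := by push_cast; ring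
  have S : ∑ k : Fin (n + 1), logCos (L / 2) ((k + 1) / (2 * n + 2 : ℕ))
    = nodeSum (2 * n + 2) (n + 1) 1 (L / 2) 0 := by simp [nodeSum]
  rw [logCos_zero] at X0
  rw [e, logCos_int] at X1
  rw [logCos_zero] at Y0
  rw [e, logCos_int] at Y1
  rw [show (1 : ℝ) - 1 / 2 = 1 / 2 by norm_num, logShift_half hL] at K
  rw [sum_add_distrib, S]
  have hM : L * ((n + 1 : ℕ) * (2 * n + 2 : ℕ)) = L * ((n + 1) * (2 * n + 2)) := by push_cast; ring
  set m : ℝ := ((2 * n + 2 : ℕ) : ℝ)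
  simp only [sum_const, card_univ, Fintype.card_fin, nsmul_eq_mul] at *
  push_cast at *
  linarith

lemma balance_BC (N : ℕ) {L : ℝ} (hL : 0 < L) :
    L * (N * (N + 1) / 4) - N * (N - 1) * logEuler L - N * logEuler (2 * L)
      + ∑ k : Fin N, (-(L / 4) + logEuler L + logCos L ((k + 1) / (2 * N + 1 : ℕ))
        + (logEuler (2 * L) + logCos L (2 * ((k + 1) / (2 * N + 1 : ℕ)))
          - logCos (2 * L) (2 * ((k + 1) / (2 * N + 1 : ℕ)))))
      + pairExp (2 * N + 1) N 1 L
    = ∑ j : Fin N, gaussExp (2 * N + 1) L (j + 1) := by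
  obtain ⟨X0, X1, Y0, Y1, P, K⟩ := exponents hL (by omega) (isFold_one_odd N)
    (isFold_one_odd N) (ks := 0) (ka := 1) (by norm_num) (by norm_num)
  have hML : 0 < ((2 * N + 1 : ℕ) : ℝ) * L := by positivity
  have e : (0 : ℝ) + ((2 * N + 1 : ℕ) : ℝ) / 2 = 1 / 2 + ((N : ℤ) : ℝ) := by push_cast; ring
  have e' : 2 * (((2 * N + 1 : ℕ) : ℝ) * L / 2) = ((2 * N + 1 : ℕ) : ℝ) * L := by ring
  have S : ∑ k : Fin N, logCos L ((k + 1) / (2 * N + 1 : ℕ))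
    = nodeSum (2 * N + 1) N 1 L 0 := by simp [nodeSum]
  rw [logCos_zero] at X0
  rw [e, logCos_add_int, logCos_half_eq hML] at X1
  rw [logCos_zero] at Y0
  rw [e, logCos_add_int, logCos_half_eq (by positivity), e'] at Y1
  rw [sub_zero, logShift_zero hL, logShift_one hL] at K
  simp only [sum_add_distrib, sum_sub_distrib]
  rw [S,
    sum_nodes_logCos_two_mul hL, sum_nodes_logCos_double hL]
  have hM : L * (N * (2 * N + 1 : ℕ)) = L * (N * (2 * N + 1)) := by push_cast; ring
  set m : ℝ := ((2 * N + 1 : ℕ) : ℝ)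
  simp only [sum_const, card_univ, Fintype.card_fin, nsmul_eq_mul] at *
  linarith

lemma balance_D (n : ℕ) {L : ℝ} (hL : 0 < L) :
    2 * Real.log 2 + L * ((n + 2) * (n + 1) / 4) - (n + 2) * n * logEuler L
      + pairExp (2 * n + 2) (n + 2) 0 L
    = Real.log 2 + ∑ j : Fin (n + 2), gaussExp (2 * n + 2) L (j + 0) := by
  obtain ⟨X0, X1, Y0, Y1, P, K⟩ := exponents hL (by omega) (isFold_zero_even_closed n)
    (isFold_zero_even_closed n) (ks := 0) (ka := 0) (by norm_num) (by norm_num)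
  have hML : 0 < ((2 * n + 2 : ℕ) : ℝ) * L := by positivity
  have e : (0 : ℝ) + ((2 * n + 2 : ℕ) : ℝ) / 2 = ((n + 1 : ℤ) : ℝ) := by push_cast; ring
  rw [logCos_zero] at X0
  rw [e, logCos_int] at X1
  rw [logCos_zero] at Y0
  rw [e, logCos_int] at Y1
  rw [sub_zero, logShift_zero hL, logShift_one hL] at K
  have hM : L * ((n + 2 : ℕ) * (2 * n + 2 : ℕ)) = L * ((n + 2) * (2 * n + 2)) := by push_cast; ring
  set m : ℝ := ((2 * n + 2 : ℕ) : ℝ)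
  push_cast at *
  linarith

end

section

open Finset

/-! ### From the values at the nodes to the determinantal formula -/

lemma pairFactor_eq_exp {L : ℝ} (hL : 0 < L) (u v : ℝ) :
    pairFactor L u v = ((4 * (Real.sin (Real.pi * (v - u)) * Real.sin (Real.pi * (v + u)))
      * Real.exp (2 * (logEuler L - L / 4) + (logCos L (v - u) + logCos L (v + u))) : ℝ) : ℂ) := by
  have h1 := theta1_eq_exp hL (v - u)
  have h2 := theta1_eq_exp hL (v + u)
  have e : Real.exp (2 * (logEuler L - L / 4) + (logCos L (v - u) + logCos L (v + u)))
      = Real.exp (-(L / 4) + logEuler L + logCos L (v - u))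
        * Real.exp (-(L / 4) + logEuler L + logCos L (v + u)) := by
    rw [← Real.exp_add]; congr 1; ring
  rw [e]
  push_cast at h1 h2 ⊢
  rw [pairFactor, h1, h2]
  ring

lemma denominator_nodes {L : ℝ} (hL : 0 < L) {w : ℂ → ℂ} {σ g : ℝ → ℝ}
    (hw : ∀ x : ℝ, w x = (2 * σ x * Real.exp (g x) : ℝ)) {N : ℕ} (M : ℕ) (a : ℝ) :
    denominator L w (fun l : Fin N => (((l + a) / M : ℝ) : ℂ))
      = ((2 ^ N * ((∏ l : Fin N, σ ((l + a) / M)) * ∏ j : Fin N, ∏ k ∈ Ioi j,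
          4 * (Real.sin (Real.pi * ((k + a) / M - (j + a) / M))
            * Real.sin (Real.pi * ((k + a) / M + (j + a) / M))))
        * Real.exp (∑ l : Fin N, g ((l + a) / M) + pairExp M N a L) : ℝ) : ℂ) := by
  have hc : ∑ j : Fin N, ∑ _k ∈ Ioi j, 2 * (logEuler L - L / 4)
      = N * (N - 1) * (logEuler L - L / 4) := by
    have := sum_univ_eq_sum_pairs (N := N) (fun _ _ => logEuler L - L / 4) fun _ _ => rfl
    simp only [sum_const, card_univ, Fintype.card_fin, nsmul_eq_mul] at this ⊢
    simp only [← mul_sum, mul_left_comm _ (2 : ℝ)]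
    linarith
  rw [pairExp, ← hc, ← sum_add_distrib, Real.exp_add, Real.exp_sum, Real.exp_sum]
  simp only [← sum_add_distrib, Real.exp_sum, denominator, hw, pairFactor_eq_exp hL]
  push_cast
  simp only [prod_mul_distrib, prod_const, card_univ, Fintype.card_fin]
  ring

lemma prod_pairs_sin_pos {M N : ℕ} (hM : 0 < M) {a : ℝ} (ha : 0 ≤ a)
    (hle : ∀ k : Fin N, (k + a : ℝ) ≤ M / 2) :
    0 < ∏ j : Fin N, ∏ k ∈ Ioi j, 4 * (Real.sin (Real.pi * ((k + a) / M - (j + a) / M))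
            * Real.sin (Real.pi * ((k + a) / M + (j + a) / M))) := by
  have hMpos : (0 : ℝ) < M := by exact_mod_cast hM
  refine prod_pos fun j _ => prod_pos fun k hk => ?_
  have hjk : (j : ℝ) < k := by exact_mod_cast mem_Ioi.1 hk
  have hj : (0 : ℝ) ≤ j := Nat.cast_nonneg _
  have hk2 := hle k
  have hsin : ∀ u : ℝ, 0 < u → u < M → 0 < Real.sin (Real.pi * (u / M)) := fun u h0 h1 => by
    apply Real.sin_pos_of_pos_of_lt_pi
    · exact mul_pos Real.pi_pos (div_pos h0 hMpos)
    · have : u / M < 1 := (div_lt_one hMpos).2 h1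
      nlinarith [Real.pi_pos]
  rw [← sub_div, ← add_div]
  have h1 := hsin ((k + a) - (j + a)) (by linarith) (by linarith)
  have h2 := hsin ((k + a) + (j + a)) (by linarith) (by linarith)
  positivity

lemma xiVar_eq (r x : ℝ) : xiVar r x = ((x / (2 * Real.pi * r) : ℝ) : ℂ) := by
  simp [xiVar]

/-- Elimination of the value `X` of the determinant at the nodes and of the value `Wy` of the
denominator there. -/
lemma eq_div_mul_of_node_values {D X A Wx Wy K : ℂ} (hint : Wx * X = Wy * K)
    (hdet : D * X = A * Wy) (hA : A ≠ 0) (hWy : Wy ≠ 0) : Wx = D / A * K := by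
  have hX : X ≠ 0 := fun h => by
    rw [h, mul_zero] at hdet
    exact mul_ne_zero hA hWy hdet.symm
  apply mul_right_cancel₀ hX
  rw [hint]
  field_simp
  linear_combination (-K) * hdet

/-- The determinantal formula for the types other than `A`, from the data of a type: the lattice
of the nodes, the parity `ε` and the characteristic `h` of the kernel, the frequencies
`M / 2 - (j + b)`, and the balance of the exponents. The weights `wt` are `1/2` at the nodes where
the process is reflected and `1` at the others. The constant `Ω` is the phase `1` or `1 / i` of
the matrix `R`. -/
theorem denominator_eq_det {N M : ℕ} (hM : 0 < M) {r t L : ℝ} (hr : 0 < r) (ht : 0 < t)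
    (hL : L = M * (t / (2 * r ^ 2))) {s a d₀ d₁ b h ε : ℝ} {ks ka kh : ℤ}
    (hfold : IsFold M N s a d₀ d₁) (hε : ε ^ 2 = 1) (h0 : d₀ < 0 → ε = -1)
    (h1 : d₁ < 0 → ε = -1 ∧ h = 0) (hs : (ks : ℝ) = 2 * s) (hka : a = ka + s)
    (hkh : (kh : ℝ) = 2 * h) (ha : 0 ≤ a) (hle : ∀ k : Fin N, (k + a : ℝ) ≤ M / 2)
    -- the denominator
    {w : ℂ → ℂ} {m : ℕ} (hm : m + 2 * (N - 1) = M)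
    (hw : QuasiPeriodic L m (cis (-h)) (cis s) w) (hpar : ∀ z, w (-z) = ε * w z)
    {σ g : ℝ → ℝ} (hwexp : ∀ x : ℝ, w x = (2 * σ x * Real.exp (g x) : ℝ))
    (hσ : ∀ k : Fin N, σ ((k + a) / M) ≠ 0)
    -- the kernel
    {p : ℝ → ℝ → ℝ → ℝ → ℝ} (hp : ∀ v x : ℝ, (p 0 (2 * Real.pi * r * v) t (2 * Real.pi * r * x) : ℂ)
      = 1 / (2 * Real.pi * r) * reflKernel (t / (2 * r ^ 2)) h ε v x)
    {v : Fin N → ℝ} (hv : ∀ k, v k = 2 * Real.pi * r * ((k + a) / M))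
    -- the matrix `R`
    {wt : Fin N → ℂ} (hwt : ∀ G : ℝ → ℂ, (d₀ < 0 → G 0 = 0) → (d₁ < 0 → G (M / 2) = 0) →
      2 * ∑ k : Fin N, wt k * G (k + a) = 2 * ∑ k : Fin N, G (k + a) - d₀ * G 0 - d₁ * G (M / 2))
    {κ : Fin N → ℤ} (hκ : ∀ j : Fin N, (M / 2 - (j + b) : ℝ) = κ j - h) {S : ℝ → ℝ} {τ : ℂ}
    (hτ : τ ≠ 0) (htrig : ∀ n x : ℝ, trig ε n x = τ * S (n * (2 * Real.pi * x)))
    {R : Matrix (Fin N) (Fin N) ℂ} {Ω : ℂ} (hΩ : Ω ≠ 0)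
    (hR : ∀ j k, R j k = 4 * Real.pi * r / M * Ω * Real.exp (t / (2 * r ^ 2) * (j + b) ^ 2) * wt k
      * S ((M / 2 - (j + b)) * (2 * Real.pi * ((k + a) / M))))
    -- the evaluation at the nodes
    {c A : ℝ} (hA : A ≠ 0)
    (hS : (Matrix.of fun j k : Fin N =>
        S ((M / 2 - (j + b)) * (2 * Real.pi * ((k + a) / M)))).det
      = c * ((∏ l : Fin N, σ ((l + a) / M)) * ∏ j : Fin N, ∏ k ∈ Ioi j,
          4 * (Real.sin (Real.pi * ((k + a) / M - (j + a) / M))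
            * Real.sin (Real.pi * ((k + a) / M + (j + a) / M)))))
    (hbal : A * Real.exp (∑ l : Fin N, g ((l + a) / M) + pairExp M N a L)
      = c * Real.exp (∑ j : Fin N, gaussExp M L (j + b))) (x : Fin N → ℝ) :
    denominator L w (fun l => xiVar r (x l))
      = Ω⁻¹ ^ N * (R.det / A) * (kmlgvDet p 0 v t x : ℂ) := by
  set lam : ℝ := t / (2 * r ^ 2) with hlam_def
  have hlam : 0 < lam := by positivity
  have hMpos : (0 : ℝ) < M := by exact_mod_cast hM
  have hLpos : 0 < L := by rw [hL]; positivity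
  have hπr : (2 * Real.pi * r : ℝ) ≠ 0 := by positivity
  have hπrC : (2 * Real.pi * r : ℂ) ≠ 0 := by exact_mod_cast hπr
  have hMC : (M : ℂ) ≠ 0 := by exact_mod_cast hM.ne'
  have hεC : (ε : ℂ) ^ 2 = 1 := by exact_mod_cast hε
  have h0C : d₀ < 0 → (ε : ℂ) = -1 := fun hd => by rw [h0 hd]; norm_num
  have h1C : d₁ < 0 → (ε : ℂ) = -1 ∧ h = 0 := fun hd => ⟨by rw [(h1 hd).1]; norm_num, (h1 hd).2⟩
  let y : Fin N → ℝ := fun k => (k + a) / M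
  have hy : ∀ k : Fin N, y k = (((k : ℕ) + ka : ℤ) + s) / M := fun k => by
    simp only [y]; rw [hka]; push_cast; ring
  have hy' : ∀ k : Fin N, M * y k = (((k : ℕ) + ka : ℤ) : ℝ) + s := fun k => by
    rw [hy]; field_simp
  -- the space of functions that contains all slices
  let V := quasiPeriodicSubmodule L M (cis (-h)) (cis s) ⊓ paritySubmodule (ε : ℂ)
  let kern : Fin N → ℂ → ℂ := fun j z => 1 / (2 * Real.pi * r) * reflKernel lam h ε (y j) z
  have hV : ∀ f ∈ V, (∀ k, f (y k) = 0) → ∀ u : ℝ, f u = 0 := fun f hf hz u =>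
    QuasiPeriodic.eq_zero_of_nodes hM hfold hεC h0C h1C hf.1 hf.2 hz u
  have hint := alternating_mul_det_eq V y hV (denominator L w)
    (fun x i => ⟨by
      have := quasiPeriodic_denominator hLpos hw x i
      rwa [hm] at this, denominator_update_neg L hpar x i⟩)
    (denominator_comp_perm L w) kern
    (fun j => V.smul_mem (1 / (2 * Real.pi * r) : ℂ) ⟨by
      have := quasiPeriodic_reflKernel hlam h ε M _ ks hs (hy' j)
      rwa [← hL] at this, fun z => reflKernel_neg lam hεC kh hkh _ z⟩)
    (fun l => x l / (2 * Real.pi * r))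
  have hK : ∀ u : Fin N → ℝ, (Matrix.of fun j l => kern j ((u l / (2 * Real.pi * r) : ℝ) : ℂ)).det
      = (kmlgvDet p 0 v t u : ℂ) := by
    intro u
    rw [kmlgvDet, ← Complex.ofRealHom_eq_coe, RingHom.map_det]
    congr 1
    ext j l
    have e : u l = 2 * Real.pi * r * (u l / (2 * Real.pi * r)) := by field_simp
    simp only [RingHom.mapMatrix_apply, Matrix.map_apply, Matrix.of_apply,
      Complex.ofRealHom_eq_coe, kern]
    rw [hv j, ← hp]
    congr 2
    rw [← e]
  have hSC : (Matrix.of fun j k : Fin N => ((S ((M / 2 - (j + b)) * (2 * Real.pi * y k)) : ℝ) : ℂ)).det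
      = ((c * ((∏ l : Fin N, σ ((l + a) / M)) * ∏ j : Fin N, ∏ k ∈ Ioi j,
          4 * (Real.sin (Real.pi * ((k + a) / M - (j + a) / M))
            * Real.sin (Real.pi * ((k + a) / M + (j + a) / M)))) : ℝ) : ℂ) := by
    rw [← hS, ← Complex.ofRealHom_eq_coe, RingHom.map_det]
    rfl
  have hRP : R * (Matrix.of fun j l => kern j (y l))
      = Matrix.of fun j l : Fin N => (2 * Ω * Real.exp (gaussExp M L (j + b)))
        * ((S ((M / 2 - (j + b)) * (2 * Real.pi * y l)) : ℝ) : ℂ) := by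
    ext j l
    rw [Matrix.mul_apply, Matrix.of_apply]
    have key := sum_nodes_reflKernel hlam hM hfold hεC h0C h1C hkh hs hwt (hκ j) _ (hy l)
    have hg := exp_mul_gaussSum_eq hlam hM hL (j + b)
    have hgC := congrArg (fun u : ℝ => (u : ℂ)) hg
    simp only [Complex.ofReal_mul] at hgC
    simp only [htrig] at key
    rw [← hgC]
    have key2 : ∑ k : Fin N, wt k * (S ((M / 2 - (j + b)) * (2 * Real.pi * ((k + a) / M)))
          * reflKernel lam h ε ((k + a) / M : ℝ) (y l))
        = M * S ((M / 2 - (j + b)) * (2 * Real.pi * y l)) * gaussSum lam M (M / 2 - (j + b)) := by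
      apply mul_left_cancel₀ hτ
      rw [mul_sum]
      have e : ∀ k : Fin N, τ * (wt k * (S ((M / 2 - (j + b)) * (2 * Real.pi * ((k + a) / M)))
          * reflKernel lam h ε ((k + a) / M : ℝ) (y l)))
          = wt k * (τ * S ((M / 2 - (j + b)) * (2 * Real.pi * ((k + a) / M)))
          * reflKernel lam h ε ((k + a) / M : ℝ) (y l)) := fun k => by ring
      simp only [e]
      rw [key]; ring
    have e2 : ∀ k : Fin N, R j k * (Matrix.of fun j l => kern j (y l)) k l
        = 4 * Real.pi * r / M * Ω * Real.exp (lam * (j + b) ^ 2) * (1 / (2 * Real.pi * r))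
          * (wt k * (S ((M / 2 - (j + b)) * (2 * Real.pi * ((k + a) / M)))
          * reflKernel lam h ε ((k + a) / M : ℝ) (y l))) := fun k => by
      rw [hR, Matrix.of_apply]; ring
    simp only [e2]
    rw [← mul_sum, key2]
    have hrC : (r : ℂ) ≠ 0 := by exact_mod_cast hr.ne'
    have hpi : (Real.pi : ℂ) ≠ 0 := by exact_mod_cast Real.pi_ne_zero
    field_simp
    ring
  have hval := denominator_nodes hLpos hwexp (N := N) M a
  have hbalC := congrArg (fun u : ℝ => (u : ℂ)) hbal
  simp only [Complex.ofReal_mul] at hbalC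
  have hdet : (Ω⁻¹ ^ N * R.det) * (Matrix.of fun j l => kern j (y l)).det
      = A * denominator L w (fun l => y l) := by
    rw [mul_assoc, ← Matrix.det_mul, hRP]
    have hcol := Matrix.det_mul_column
      (fun j : Fin N => 2 * Ω * (Real.exp (gaussExp M L (j + b)) : ℂ))
      (Matrix.of fun j k : Fin N => ((S ((M / 2 - (j + b)) * (2 * Real.pi * y k)) : ℝ) : ℂ))
    simp only [Matrix.of_apply] at hcol
    rw [hcol, hSC, hval, prod_mul_distrib, prod_const, card_univ,
      Fintype.card_fin, ← Complex.ofReal_prod, ← Real.exp_sum]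
    have hΩN : Ω⁻¹ ^ N * (2 * Ω) ^ N = 2 ^ N := by
      rw [← mul_pow]; congr 1; field_simp
    simp only [Complex.ofReal_mul, Complex.ofReal_pow, Complex.ofReal_ofNat]
    linear_combination (c * (∏ l : Fin N, σ ((l + a) / M) : ℝ) * (∏ j : Fin N, ∏ k ∈ Ioi j,
          4 * (Real.sin (Real.pi * ((k + a) / M - (j + a) / M))
            * Real.sin (Real.pi * ((k + a) / M + (j + a) / M))) : ℝ)
      * (Real.exp (∑ j : Fin N, gaussExp M L (j + b)) : ℝ)) * hΩN - ((2 : ℂ) ^ N * ((∏ l : Fin N, σ ((l + a) / M) : ℝ) : ℂ)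
      * ((∏ j : Fin N, ∏ k ∈ Ioi j,
          4 * (Real.sin (Real.pi * ((k + a) / M - (j + a) / M))
            * Real.sin (Real.pi * ((k + a) / M + (j + a) / M))) : ℝ) : ℂ)) * hbalC
  have hne : denominator L w (fun l => y l) ≠ 0 := by
    rw [hval]
    have := prod_pairs_sin_pos hM ha hle
    have h2 : ∏ l : Fin N, σ ((l + a) / M) ≠ 0 := prod_ne_zero_iff.2 fun k _ => hσ k
    exact_mod_cast mul_ne_zero (mul_ne_zero (by positivity) (mul_ne_zero h2 this.ne'))
      (Real.exp_pos _).ne'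
  have hAC : (A : ℂ) ≠ 0 := by exact_mod_cast hA
  rw [hK] at hint
  simp only [xiVar_eq]
  rw [eq_div_mul_of_node_values hint hdet hAC hne, mul_div_assoc]

end

section

open Finset

/-! ### The types other than `A` -/

lemma cis_half_ofReal : cis ((1 / 2 : ℝ) : ℂ) = -1 := by push_cast; exact cis_half

lemma cis_neg_half_ofReal : cis (-((1 / 2 : ℝ) : ℂ)) = -1 := by
  rw [cis_neg, cis_half_ofReal]; norm_num

lemma quasiPeriodic_theta1_mul {L lam : ℝ} (hlam : 0 < lam) (a k : ℕ) (hak : a * L = k * lam) :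
    QuasiPeriodic L (k * a) ((-1) ^ a) ((-1) ^ k)
      fun z => theta1 (a * z) (Complex.I * lam / Real.pi) := by
  simpa using quasiPeriodic_theta1 hlam a k hak 0

lemma theta1_mul_neg (L : ℝ) (a z : ℂ) : theta1 (a * -z) (Complex.I * L / Real.pi)
    = ((-1 : ℝ) : ℂ) * theta1 (a * z) (Complex.I * L / Real.pi) := by
  rw [mul_neg, theta1_neg]; push_cast; ring

lemma rev_cast {N : ℕ} (j : Fin N) : ((j.rev : ℕ) : ℝ) = N - 1 - j := by
  rw [Fin.val_rev, Nat.cast_sub (by omega)]; push_cast; ring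

lemma calN_mul_tauVar {M : ℕ} {R : RootType} {N : ℕ} (hM : calN R N = M) {r : ℝ} (hr : 0 < r)
    (t : ℝ) : calN R N * tauVar r t
      = Complex.I * ((M * (t / (2 * r ^ 2)) : ℝ) : ℂ) / Real.pi := by
  rw [hM, tauVar_eq r t hr]; push_cast; ring

lemma exp_sq_tauVar {r : ℝ} (hr : 0 < r) (t J : ℝ) :
    Complex.exp (-Real.pi * Complex.I * (J : ℂ) ^ 2 * tauVar r t)
      = (Real.exp (t / (2 * r ^ 2) * J ^ 2) : ℝ) := by
  have hpi : (Real.pi : ℂ) ≠ 0 := by exact_mod_cast Real.pi_ne_zero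
  rw [tauVar_eq r t hr, Complex.ofReal_exp]
  congr 1
  generalize t / (2 * r ^ 2) = l
  push_cast
  field_simp
  linear_combination (-((l : ℂ) * J ^ 2)) * Complex.I_sq

lemma nome_cpow (L : ℝ) {c : ℂ} (e : ℝ) (hc : c = e) :
    nome (Complex.I * L / Real.pi) ^ c = (Real.exp (-L * e) : ℝ) := by
  rw [hc, nome_tau, ← Complex.ofReal_cpow (Real.exp_pos _).le, ← Real.exp_mul]

lemma nomeProd_zpow {L : ℝ} (hL : 0 < L) {k : ℤ} (e : ℝ) (hk : (k : ℝ) = e) :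
    nomeProd (Complex.I * L / Real.pi) ^ k = (Real.exp (e * logEuler L) : ℝ) := by
  rw [nomeProd_tau hL, ← hk, mul_comm, Real.exp_mul, Real.rpow_intCast, Complex.ofReal_zpow]

/-- The angles in the matrix `R`, in terms of the frequencies and the nodes. -/
lemma angle_eq {r : ℝ} (hr : 0 < r) {M J v y : ℝ} (hv : v = 2 * Real.pi * r * y) :
    (M - 2 * J) * (v / (2 * r)) = (M / 2 - J) * (2 * Real.pi * y) := by
  rw [hv]; field_simp

lemma angle_half_eq {M J y : ℝ} (hy : y = 1 / 2) :
    (M - 2 * J) * Real.pi / 2 = (M / 2 - J) * (2 * Real.pi * y) := by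
  rw [hy]; ring

lemma sin_pi_mul_div_ne_zero {u M : ℝ} (h0 : 0 < u) (h1 : u < M) :
    Real.sin (Real.pi * (u / M)) ≠ 0 := by
  have hM : 0 < M := h0.trans h1
  apply (Real.sin_pos_of_pos_of_lt_pi (mul_pos Real.pi_pos (div_pos h0 hM)) _).ne'
  have : u / M < 1 := (div_lt_one hM).2 h1
  nlinarith [Real.pi_pos]

lemma fin_cast_le {n : ℕ} (k : Fin (n + 1)) : ((k : ℕ) : ℝ) ≤ n := by
  exact_mod_cast Nat.lt_succ_iff.1 k.2

section Types

variable {r t : ℝ}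

lemma macdonaldW_B (n : ℕ) (hr : 0 < r) (ht : 0 < t) (x : Fin (n + 1) → ℝ) :
    macdonaldW .B (fun j => xiVar r (x j)) (calN .B (n + 1) * tauVar r t)
      = bCoeff .B (n + 1) r t * (kmlgvDet (pAr r) 0 (vConf .B (n + 1) r) t x : ℂ) := by
  have hcalN : calN .B (n + 1) = (2 * n + 1 : ℕ) := by simp only [calN]; push_cast; ring
  have hMR : (((2 * n + 1 : ℕ) : ℝ)) = 2 * n + 1 := by push_cast; ring
  have hMC : (((2 * n + 1 : ℕ) : ℂ)) = 2 * n + 1 := by push_cast; ring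
  have hM0 : (2 * n + 1 : ℝ) ≠ 0 := by positivity
  have hT := calN_mul_tauVar hcalN hr t
  set L : ℝ := (2 * n + 1 : ℕ) * (t / (2 * r ^ 2)) with hL_def
  have hL : 0 < L := by positivity
  have hA : aCoeff .B (n + 1) r t
      = (Real.exp (Real.log 2 + L * ((n + 1) * n / 4) - (n + 1) * n * logEuler L) : ℝ) := by
    simp only [aCoeff, hT]
    rw [nome_cpow L (-((n + 1) * n / 4)) (by push_cast; ring),
      nomeProd_zpow hL (-((n + 1) * n)) (by push_cast; ring), sub_eq_add_neg, Real.exp_add,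
      Real.exp_add, Real.exp_log two_pos]
    push_cast
    ring_nf
  have hv : ∀ k : Fin (n + 1), vPoint .B (n + 1) r ((k : ℕ) + 1)
      = 2 * Real.pi * r * (((k : ℕ) + 1 / 2) / (2 * n + 1 : ℕ)) := fun k => by
    simp only [vPoint, hcalN]; push_cast; field_simp; ring
  have key := denominator_eq_det (M := 2 * n + 1) (by omega) hr ht hL_def (s := 1 / 2) (ks := 1)
    (ka := 0) (h := 1 / 2) (kh := 1) (ε := -1) (a := 1 / 2) (b := 0) (m := 1) (Ω := 1)
    (isFold_half_odd n) (by norm_num) (fun _ => rfl) (fun h => by linarith) (by norm_num)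
    (by norm_num) (by norm_num) (by norm_num)
    (fun k => by rw [hMR]; linarith [fin_cast_le k]) (by omega)
    (w := fun z => theta1 z (Complex.I * L / Real.pi))
    (by
      rw [cis_half_ofReal, cis_neg_half_ofReal]
      simpa using quasiPeriodic_theta1_mul (L := L) hL 1 1 (by simp))
    (fun z => by simpa using theta1_mul_neg L 1 z)
    (σ := fun x => Real.sin (Real.pi * x)) (g := fun x => -(L / 4) + logEuler L + logCos L x)
    (fun x => by rw [theta1_eq_exp hL]; push_cast; ring)
    (fun k => sin_pi_mul_div_ne_zero (by positivity) (by rw [hMR]; linarith [fin_cast_le k]))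
    (p := pAr r) (fun v x => by push_cast; exact_mod_cast pAr_eq hr ht v x)
    (v := vConf .B (n + 1) r)
    hv
    (wt := fun k => if (k : ℕ) + 1 = n + 1 then 1 / 2 else 1)
    (fun G _ _ => by
      have e : (((2 * n + 1 : ℕ) : ℝ)) / 2 = n + 1 / 2 := by rw [hMR]; ring
      have e2 : ∀ k : Fin n, (k : ℕ) ≠ n := fun k => k.2.ne
      rw [Fin.sum_univ_castSucc, Fin.sum_univ_castSucc, e]
      simp [e2]
      ring)
    (κ := fun j => n + 1 - (j : ℕ)) (fun j => by rw [hMR]; push_cast; ring)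
    (S := Real.sin) (τ := 2 * Complex.I) (by simp)
    (fun n x => by have := trig_neg_one n x; push_cast at this ⊢; exact this)
    (R := rMatrix .B (n + 1) r t) one_ne_zero
    (fun j k => by
      have hJ : indexJ .B ((j : ℕ) + 1) = (j : ℕ) + 0 := by simp only [indexJ]; push_cast; ring
      simp only [rMatrix, Matrix.of_apply, rEntry, hJ, exp_sq_tauVar hr, hcalN,
        angle_eq hr (hv k)]
      split_ifs with hk
      · have hk' : ((k : ℕ) : ℝ) = n := by exact_mod_cast Nat.succ_injective hk
        rw [angle_half_eq (y := ((k : ℕ) + 1 / 2) / (2 * n + 1 : ℕ))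
          (by rw [hk', hMR]; field_simp)]
        push_cast; ring
      · push_cast; ring)
    (c := 1) (A := Real.exp (Real.log 2 + L * ((n + 1) * n / 4) - (n + 1) * n * logEuler L))
    (Real.exp_pos _).ne'
    (by
      rw [one_mul, ← det_sin_half]
      congr 1
      ext j k
      simp only [Matrix.of_apply, rev_cast, hMR]
      congr 2
      push_cast; ring)
    (by
      rw [one_mul, ← balance_B n hL, ← Real.exp_add]
      congr 1; ring)
    x
  rw [hT, bCoeff, hA]
  simpa [macdonaldW, denominator, pairFactor] using key

lemma macdonaldW_Bv (n : ℕ) (hr : 0 < r) (ht : 0 < t) (x : Fin (n + 1) → ℝ) :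
    macdonaldW .Bv (fun j => xiVar r (x j)) (calN .Bv (n + 1) * tauVar r t)
      = bCoeff .Bv (n + 1) r t * (kmlgvDet (pAa r) 0 (vConf .Bv (n + 1) r) t x : ℂ) := by
  have hcalN : calN .Bv (n + 1) = (2 * n + 2 : ℕ) := by simp only [calN]; push_cast; ring
  have hMR : (((2 * n + 2 : ℕ) : ℝ)) = 2 * n + 2 := by push_cast; ring
  have hM0 : (2 * n + 2 : ℝ) ≠ 0 := by positivity
  have hT := calN_mul_tauVar hcalN hr t
  set L : ℝ := (2 * n + 2 : ℕ) * (t / (2 * r ^ 2)) with hL_def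
  have hL : 0 < L := by positivity
  have hT2 : 2 * (Complex.I * L / Real.pi) = Complex.I * ((2 * L : ℝ) : ℂ) / Real.pi := by
    push_cast; ring
  have hA : aCoeff .Bv (n + 1) r t = (Real.exp (Real.log 2 + L * ((n + 1) * n / 4)
      - n ^ 2 * logEuler L - n * logEuler (2 * L)) : ℝ) := by
    simp only [aCoeff, hT, hT2]
    rw [nome_cpow L (-((n + 1) * n / 4)) (by push_cast; ring),
      nomeProd_zpow hL (-n ^ 2) (by push_cast; ring),
      nomeProd_zpow (by positivity) (-n) (by push_cast; ring), sub_eq_add_neg, sub_eq_add_neg,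
      Real.exp_add, Real.exp_add, Real.exp_add, Real.exp_log two_pos]
    push_cast
    ring_nf
  have hv : ∀ k : Fin (n + 1), vPoint .Bv (n + 1) r ((k : ℕ) + 1)
      = 2 * Real.pi * r * (((k : ℕ) + 1 / 2) / (2 * n + 2 : ℕ)) := fun k => by
    simp only [vPoint, hcalN]; push_cast; field_simp; ring
  have key := denominator_eq_det (M := 2 * n + 2) (by omega) hr ht hL_def (s := 1 / 2) (ks := 1)
    (ka := 0) (h := 0) (kh := 0) (ε := -1) (a := 1 / 2) (b := 0) (m := 2) (Ω := 1)
    (isFold_half_even (n + 1)) (by norm_num) (fun _ => rfl) (fun h => by linarith) (by norm_num)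
    (by norm_num) (by norm_num) (by norm_num)
    (fun k => by rw [hMR]; linarith [fin_cast_le k]) (by omega)
    (w := fun z => theta1 (2 * z) (Complex.I * ((2 * L : ℝ) : ℂ) / Real.pi))
    (by
      rw [cis_half_ofReal]
      simpa using quasiPeriodic_theta1_mul (L := L) (lam := 2 * L) (by positivity) 2 1 (by simp))
    (fun z => theta1_mul_neg (2 * L) 2 z)
    (σ := fun x => Real.sin (2 * Real.pi * x))
    (g := fun x => -(2 * L / 4) + logEuler (2 * L) + logCos (2 * L) (2 * x))
    (fun x => by
      have := theta1_eq_exp (L := 2 * L) (by positivity) (2 * x)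
      rw [show Real.pi * (2 * x) = 2 * Real.pi * x by ring] at this
      push_cast at this ⊢
      rw [this])
    (fun k => by
      rw [mul_comm 2 Real.pi, mul_assoc, ← mul_div_assoc]
      exact sin_pi_mul_div_ne_zero (by positivity) (by rw [hMR]; linarith [fin_cast_le k]))
    (p := pAa r) (fun v x => by push_cast; exact_mod_cast pAa_eq hr ht v x)
    (v := vConf .Bv (n + 1) r)
    hv
    (wt := fun k => 1) (fun G _ _ => by simp)
    (κ := fun j => n + 1 - (j : ℕ)) (fun j => by rw [hMR]; push_cast; ring)
    (S := Real.sin) (τ := 2 * Complex.I) (by simp)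
    (fun n x => by have := trig_neg_one n x; push_cast at this ⊢; exact this)
    (R := rMatrix .Bv (n + 1) r t) one_ne_zero
    (fun j k => by
      have hJ : indexJ .Bv ((j : ℕ) + 1) = (j : ℕ) + 0 := by simp only [indexJ]; push_cast; ring
      simp only [rMatrix, Matrix.of_apply, rEntry, hJ, exp_sq_tauVar hr, hcalN,
        angle_eq hr (hv k)]
      push_cast; ring)
    (c := 1) (A := Real.exp (Real.log 2 + L * ((n + 1) * n / 4)
      - n ^ 2 * logEuler L - n * logEuler (2 * L)))
    (Real.exp_pos _).ne'
    (by
      rw [one_mul, ← det_sin_int]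
      congr 1
      ext j k
      simp only [Matrix.of_apply, rev_cast, hMR]
      congr 2
      push_cast; ring)
    (by
      rw [one_mul, ← balance_Bv n hL, ← Real.exp_add]
      congr 1; ring)
    x
  rw [hT, bCoeff, hA]
  simpa [macdonaldW, denominator, pairFactor, hT2] using key

lemma macdonaldW_C {N : ℕ} (hN : 1 ≤ N) (hr : 0 < r) (ht : 0 < t) (x : Fin N → ℝ) :
    macdonaldW .C (fun j => xiVar r (x j)) (calN .C N * tauVar r t)
      = bCoeff .C N r t * (kmlgvDet (pAa r) 0 (vConf .C N r) t x : ℂ) := by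
  have hcalN : calN .C N = (2 * N + 2 : ℕ) := by simp only [calN]; push_cast; ring
  have hMR : (((2 * N + 2 : ℕ) : ℝ)) = 2 * N + 2 := by push_cast; ring
  have hM0 : (2 * N + 2 : ℝ) ≠ 0 := by positivity
  have hT := calN_mul_tauVar hcalN hr t
  set L : ℝ := (2 * N + 2 : ℕ) * (t / (2 * r ^ 2)) with hL_def
  have hL : 0 < L := by positivity
  have hA : aCoeff .C N r t
      = (Real.exp (L * (N ^ 2 / 4) - N * (N - 1) * logEuler L) : ℝ) := by
    simp only [aCoeff, hT]
    rw [nome_cpow L (-(N ^ 2 / 4)) (by push_cast; ring),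
      nomeProd_zpow hL (-(N * (N - 1))) (by push_cast; ring), sub_eq_add_neg (L * _),
      Real.exp_add]
    push_cast
    ring_nf
  have hv : ∀ k : Fin N, vPoint .C N r ((k : ℕ) + 1)
      = 2 * Real.pi * r * (((k : ℕ) + 1) / (2 * N + 2 : ℕ)) := fun k => by
    simp only [vPoint, hcalN]; push_cast; field_simp
  have hk : ∀ k : Fin N, ((k : ℕ) + 1 : ℝ) ≤ N := fun k => by exact_mod_cast k.2
  have key := denominator_eq_det (M := 2 * N + 2) (by omega) hr ht hL_def (s := 0) (ks := 0)
    (ka := 1) (h := 0) (kh := 0) (ε := -1) (a := 1) (b := 1) (m := 4) (Ω := Complex.I⁻¹)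
    (isFold_one_even N) (by norm_num) (fun _ => rfl) (fun _ => ⟨rfl, rfl⟩) (by norm_num)
    (by norm_num) (by norm_num) (by norm_num)
    (fun k => by rw [hMR]; linarith [hk k]) (by omega)
    (w := fun z => theta1 (2 * z) (Complex.I * L / Real.pi))
    (by simpa using quasiPeriodic_theta1_mul (L := L) hL 2 2 (by simp))
    (fun z => theta1_mul_neg L 2 z)
    (σ := fun x => Real.sin (2 * Real.pi * x))
    (g := fun x => -(L / 4) + logEuler L + logCos L (2 * x))
    (fun x => by
      have := theta1_eq_exp hL (2 * x)
      rw [show Real.pi * (2 * x) = 2 * Real.pi * x by ring] at this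
      push_cast at this ⊢
      rw [this])
    (fun k => by
      rw [mul_comm 2 Real.pi, mul_assoc, ← mul_div_assoc]
      exact sin_pi_mul_div_ne_zero (by positivity) (by rw [hMR]; linarith [hk k]))
    (p := pAa r) (fun v x => by push_cast; exact_mod_cast pAa_eq hr ht v x)
    (v := vConf .C N r)
    hv
    (wt := fun k => 1)
    (fun G hG0 hG1 => by rw [hG0 (by norm_num), hG1 (by norm_num)]; simp)
    (κ := fun j => N - (j : ℕ)) (fun j => by rw [hMR]; push_cast; ring)
    (S := Real.sin) (τ := 2 * Complex.I) (by simp)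
    (fun n x => by have := trig_neg_one n x; push_cast at this ⊢; exact this)
    (R := rMatrix .C N r t) (by simp)
    (fun j k => by
      have hJ : indexJ .C ((j : ℕ) + 1) = (j : ℕ) + 1 := by simp only [indexJ]; push_cast; ring
      simp only [rMatrix, Matrix.of_apply, rEntry, hJ, exp_sq_tauVar hr, hcalN,
        angle_eq hr (hv k)]
      push_cast; field_simp)
    (c := 1) (A := Real.exp (L * (N ^ 2 / 4) - N * (N - 1) * logEuler L))
    (Real.exp_pos _).ne'
    (by
      rw [one_mul, ← det_sin_int]
      congr 1
      ext j k
      simp only [Matrix.of_apply, rev_cast, hMR]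
      congr 2
      ring)
    (by
      rw [one_mul, ← balance_C N hL, ← Real.exp_add]
      congr 1; ring)
    x
  rw [hT, bCoeff, hA]
  simpa [macdonaldW, denominator, pairFactor] using key

lemma macdonaldW_Cv (n : ℕ) (hr : 0 < r) (ht : 0 < t) (x : Fin (n + 1) → ℝ) :
    macdonaldW .Cv (fun j => xiVar r (x j)) (calN .Cv (n + 1) * tauVar r t)
      = bCoeff .Cv (n + 1) r t * (kmlgvDet (pAr r) 0 (vConf .Cv (n + 1) r) t x : ℂ) := by
  have hcalN : calN .Cv (n + 1) = (2 * n + 2 : ℕ) := by simp only [calN]; push_cast; ring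
  have hMR : (((2 * n + 2 : ℕ) : ℝ)) = 2 * n + 2 := by push_cast; ring
  have hM0 : (2 * n + 2 : ℝ) ≠ 0 := by positivity
  have hT := calN_mul_tauVar hcalN hr t
  set L : ℝ := (2 * n + 2 : ℕ) * (t / (2 * r ^ 2)) with hL_def
  have hL : 0 < L := by positivity
  have hT2 : Complex.I * L / Real.pi / 2 = Complex.I * ((L / 2 : ℝ) : ℂ) / Real.pi := by
    push_cast; ring
  have hA : aCoeff .Cv (n + 1) r t = (Real.exp (L * ((n + 1) * (2 * n + 1) / 8)
      - n ^ 2 * logEuler L - n * logEuler (L / 2)) : ℝ) := by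
    simp only [aCoeff, hT, hT2]
    rw [nome_cpow L (-((n + 1) * (2 * n + 1) / 8)) (by push_cast; ring),
      nomeProd_zpow hL (-n ^ 2) (by push_cast; ring),
      nomeProd_zpow (by positivity) (-n) (by push_cast; ring), sub_eq_add_neg, sub_eq_add_neg,
      Real.exp_add, Real.exp_add]
    push_cast
    ring_nf
  have hv : ∀ k : Fin (n + 1), vPoint .Cv (n + 1) r ((k : ℕ) + 1)
      = 2 * Real.pi * r * (((k : ℕ) + 1) / (2 * n + 2 : ℕ)) := fun k => by
    simp only [vPoint, hcalN]; push_cast; field_simp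
  have key := denominator_eq_det (M := 2 * n + 2) (by omega) hr ht hL_def (s := 0) (ks := 0)
    (ka := 1) (h := 1 / 2) (kh := 1) (ε := -1) (a := 1) (b := 1 / 2) (m := 2) (Ω := Complex.I⁻¹)
    (isFold_one_even_closed n) (by norm_num) (fun _ => rfl) (fun h => by linarith) (by norm_num)
    (by norm_num) (by norm_num) (by norm_num)
    (fun k => by rw [hMR]; linarith [fin_cast_le k]) (by omega)
    (w := fun z => theta1 z (Complex.I * ((L / 2 : ℝ) : ℂ) / Real.pi))
    (by
      rw [cis_neg_half_ofReal]
      simpa using quasiPeriodic_theta1_mul (L := L) (lam := L / 2) (by positivity) 1 2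
        (by push_cast; ring))
    (fun z => by simpa using theta1_mul_neg (L / 2) 1 z)
    (σ := fun x => Real.sin (Real.pi * x))
    (g := fun x => -(L / 2 / 4) + logEuler (L / 2) + logCos (L / 2) x)
    (fun x => by rw [theta1_eq_exp (by positivity)]; push_cast; ring)
    (fun k => sin_pi_mul_div_ne_zero (by positivity) (by rw [hMR]; linarith [fin_cast_le k]))
    (p := pAr r) (fun v x => by push_cast; exact_mod_cast pAr_eq hr ht v x)
    (v := vConf .Cv (n + 1) r)
    hv
    (wt := fun k => if (k : ℕ) + 1 = n + 1 then 1 / 2 else 1)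
    (fun G hG0 _ => by
      have e : (((2 * n + 2 : ℕ) : ℝ)) / 2 = n + 1 := by rw [hMR]; ring
      have e2 : ∀ k : Fin n, (k : ℕ) ≠ n := fun k => k.2.ne
      rw [Fin.sum_univ_castSucc, Fin.sum_univ_castSucc, e, hG0 (by norm_num)]
      simp [e2]
      ring)
    (κ := fun j => n + 1 - (j : ℕ)) (fun j => by rw [hMR]; push_cast; ring)
    (S := Real.sin) (τ := 2 * Complex.I) (by simp)
    (fun n x => by have := trig_neg_one n x; push_cast at this ⊢; exact this)
    (R := rMatrix .Cv (n + 1) r t) (by simp)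
    (fun j k => by
      have hJ : indexJ .Cv ((j : ℕ) + 1) = (j : ℕ) + 1 / 2 := by
        simp only [indexJ]; push_cast; ring
      simp only [rMatrix, Matrix.of_apply, rEntry, hJ, exp_sq_tauVar hr, hcalN,
        angle_eq hr (hv k)]
      split_ifs with hk
      · have hk' : ((k : ℕ) : ℝ) = n := by exact_mod_cast Nat.succ_injective hk
        rw [angle_half_eq (y := ((k : ℕ) + 1) / (2 * n + 2 : ℕ))
          (by rw [hk', hMR]; field_simp)]
        push_cast; field_simp; ring
      · push_cast; field_simp)
    (c := 1) (A := Real.exp (L * ((n + 1) * (2 * n + 1) / 8)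
      - n ^ 2 * logEuler L - n * logEuler (L / 2)))
    (Real.exp_pos _).ne'
    (by
      rw [one_mul, ← det_sin_half]
      congr 1
      ext j k
      simp only [Matrix.of_apply, rev_cast, hMR]
      congr 2
      push_cast; ring)
    (by
      rw [one_mul, ← balance_Cv n hL, ← Real.exp_add]
      congr 1; ring)
    x
  rw [hT, bCoeff, hA]
  simpa [macdonaldW, denominator, pairFactor, hT2] using key

lemma macdonaldW_BC {N : ℕ} (hN : 1 ≤ N) (hr : 0 < r) (ht : 0 < t) (x : Fin N → ℝ) :
    macdonaldW .BC (fun j => xiVar r (x j)) (calN .BC N * tauVar r t)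
      = bCoeff .BC N r t * (kmlgvDet (pAr r) 0 (vConf .BC N r) t x : ℂ) := by
  have hcalN : calN .BC N = (2 * N + 1 : ℕ) := by simp only [calN]; push_cast; ring
  have hMR : (((2 * N + 1 : ℕ) : ℝ)) = 2 * N + 1 := by push_cast; ring
  have hM0 : (2 * N + 1 : ℝ) ≠ 0 := by positivity
  have hT := calN_mul_tauVar hcalN hr t
  set L : ℝ := (2 * N + 1 : ℕ) * (t / (2 * r ^ 2)) with hL_def
  have hL : 0 < L := by positivity
  have hT2 : 2 * (Complex.I * L / Real.pi) = Complex.I * ((2 * L : ℝ) : ℂ) / Real.pi := by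
    push_cast; ring
  have hA : aCoeff .BC N r t = (Real.exp (L * (N * (N + 1) / 4)
      - N * (N - 1) * logEuler L - N * logEuler (2 * L)) : ℝ) := by
    simp only [aCoeff, hT, hT2]
    rw [nome_cpow L (-(N * (N + 1) / 4)) (by push_cast; ring),
      nomeProd_zpow hL (-(N * (N - 1))) (by push_cast; ring),
      nomeProd_zpow (by positivity) (-N) (by push_cast; ring), sub_eq_add_neg _ (_ * logEuler (2 * L)),
      sub_eq_add_neg (L * _), Real.exp_add, Real.exp_add]
    push_cast
    ring_nf
  have hv : ∀ k : Fin N, vPoint .BC N r ((k : ℕ) + 1)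
      = 2 * Real.pi * r * (((k : ℕ) + 1) / (2 * N + 1 : ℕ)) := fun k => by
    simp only [vPoint, hcalN]; push_cast; field_simp
  have hk : ∀ k : Fin N, ((k : ℕ) + 1 : ℝ) ≤ N := fun k => by exact_mod_cast k.2
  have key := denominator_eq_det (M := 2 * N + 1) (by omega) hr ht hL_def (s := 0) (ks := 0)
    (ka := 1) (h := 1 / 2) (kh := 1) (ε := -1) (a := 1) (b := 1) (m := 3) (Ω := Complex.I⁻¹)
    (isFold_one_odd N) (by norm_num) (fun _ => rfl) (fun h => by linarith) (by norm_num)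
    (by norm_num) (by norm_num) (by norm_num)
    (fun k => by rw [hMR]; linarith [hk k]) (by omega)
    (w := fun z => theta1 z (Complex.I * L / Real.pi)
      * theta0 (2 * z) (Complex.I * ((2 * L : ℝ) : ℂ) / Real.pi))
    (by
      have h0 := quasiPeriodic_thetaChar (L := L) (lam := 2 * L) (by positivity) 0 2 1 (by simp)
        (1 / 2)
      have h1 := (quasiPeriodic_theta1_mul (L := L) hL 1 1 (by simp)).mul h0
      simp only [theta0_eq_thetaChar]
      rw [cis_neg_half_ofReal]
      simpa [cis_neg, cis_half, show cis 2⁻¹ = -1 by simpa using cis_half] using h1)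
    (fun z => by
      have h0 : theta0 (2 * -z) (Complex.I * ((2 * L : ℝ) : ℂ) / Real.pi)
          = theta0 (2 * z) (Complex.I * ((2 * L : ℝ) : ℂ) / Real.pi) := by
        rw [theta0_eq_thetaChar, theta0_eq_thetaChar, ← thetaChar_neg (2 * L) 0 (by norm_num)]
        have := thetaChar_add_one (2 * L) 0 (2 * z - 1 / 2)
        rw [show 2 * z - 1 / 2 + 1 = 2 * z + 1 / 2 by ring] at this
        rw [this, show -(2 * -z + 1 / 2) = 2 * z - 1 / 2 by ring]
        simp
      have h1 := theta1_mul_neg L 1 z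
      rw [one_mul, one_mul] at h1
      rw [h0, h1, mul_assoc])
    (σ := fun x => Real.sin (Real.pi * x))
    (g := fun x => -(L / 4) + logEuler L + logCos L x
      + (logEuler (2 * L) + logCos L (2 * x) - logCos (2 * L) (2 * x)))
    (fun x => by
      have h0 := theta0_eq_exp (L := 2 * L) (by positivity) (2 * x)
      rw [show 2 * L / 2 = L by ring] at h0
      rw [theta1_eq_exp hL, Real.exp_add (-(L / 4) + logEuler L + logCos L x)]
      push_cast at h0 ⊢
      rw [h0]; ring)
    (fun k => sin_pi_mul_div_ne_zero (by positivity) (by rw [hMR]; linarith [hk k]))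
    (p := pAr r) (fun v x => by push_cast; exact_mod_cast pAr_eq hr ht v x)
    (v := vConf .BC N r)
    hv
    (wt := fun k => 1)
    (fun G hG0 _ => by rw [hG0 (by norm_num)]; simp)
    (κ := fun j => N - (j : ℕ)) (fun j => by rw [hMR]; push_cast; ring)
    (S := Real.sin) (τ := 2 * Complex.I) (by simp)
    (fun n x => by have := trig_neg_one n x; push_cast at this ⊢; exact this)
    (R := rMatrix .BC N r t) (by simp)
    (fun j k => by
      have hJ : indexJ .BC ((j : ℕ) + 1) = (j : ℕ) + 1 := by simp only [indexJ]; push_cast; ring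
      simp only [rMatrix, Matrix.of_apply, rEntry, hJ, exp_sq_tauVar hr, hcalN,
        angle_eq hr (hv k)]
      push_cast; field_simp)
    (c := 1) (A := Real.exp (L * (N * (N + 1) / 4)
      - N * (N - 1) * logEuler L - N * logEuler (2 * L)))
    (Real.exp_pos _).ne'
    (by
      rw [one_mul, ← det_sin_half]
      congr 1
      ext j k
      simp only [Matrix.of_apply, rev_cast, hMR]
      congr 2
      ring)
    (by
      rw [one_mul, ← balance_BC N hL, ← Real.exp_add]
      congr 1; ring)
    x
  rw [hT, bCoeff, hA]
  simpa [macdonaldW, denominator, pairFactor, hT2] using key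

lemma macdonaldW_D (n : ℕ) (hr : 0 < r) (ht : 0 < t) (x : Fin (n + 2) → ℝ) :
    macdonaldW .D (fun j => xiVar r (x j)) (calN .D (n + 2) * tauVar r t)
      = bCoeff .D (n + 2) r t * (kmlgvDet (pRr r) 0 (vConf .D (n + 2) r) t x : ℂ) := by
  have hcalN : calN .D (n + 2) = (2 * n + 2 : ℕ) := by simp only [calN]; push_cast; ring
  have hMR : (((2 * n + 2 : ℕ) : ℝ)) = 2 * n + 2 := by push_cast; ring
  have hM0 : (2 * n + 2 : ℝ) ≠ 0 := by positivity
  have hn0 : (n + 1 : ℝ) ≠ 0 := by positivity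
  have hT := calN_mul_tauVar hcalN hr t
  set L : ℝ := (2 * n + 2 : ℕ) * (t / (2 * r ^ 2)) with hL_def
  have hL : 0 < L := by positivity
  have hA : aCoeff .D (n + 2) r t = (Real.exp (2 * Real.log 2 + L * ((n + 2) * (n + 1) / 4)
      - (n + 2) * n * logEuler L) : ℝ) := by
    simp only [aCoeff, hT]
    rw [nome_cpow L (-((n + 2) * (n + 1) / 4)) (by push_cast; ring),
      nomeProd_zpow hL (-((n + 2) * n)) (by push_cast; ring), sub_eq_add_neg, Real.exp_add,
      Real.exp_add, two_mul, Real.exp_add, Real.exp_log two_pos]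
    push_cast
    ring_nf
  have hv : ∀ k : Fin (n + 2), vPoint .D (n + 2) r ((k : ℕ) + 1)
      = 2 * Real.pi * r * (((k : ℕ) + 0) / (2 * n + 2 : ℕ)) := fun k => by
    simp only [vPoint]; push_cast
    rw [show (n + 2 - 1 : ℝ) = n + 1 by ring]
    field_simp; ring
  have hk : ∀ k : Fin (n + 2), ((k : ℕ) : ℝ) ≤ n + 1 := fun k => by
    exact_mod_cast Nat.lt_succ_iff.1 k.2
  have key := denominator_eq_det (M := 2 * n + 2) (by omega) hr ht hL_def (s := 0) (ks := 0)
    (ka := 0) (h := 0) (kh := 0) (ε := 1) (a := 0) (b := 0) (m := 0) (Ω := 1)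
    (isFold_zero_even_closed n) (by norm_num) (fun h => by linarith) (fun h => by linarith)
    (by norm_num) (by norm_num) (by norm_num) (by norm_num)
    (fun k => by rw [hMR]; linarith [hk k]) (by omega)
    (w := fun _ => 1)
    (by simpa using QuasiPeriodic.const L 1)
    (fun z => by simp)
    (σ := fun _ => 1 / 2) (g := fun _ => 0)
    (fun x => by simp)
    (fun k => by norm_num)
    (p := pRr r) (fun v x => by push_cast; exact_mod_cast pRr_eq hr ht v x)
    (v := vConf .D (n + 2) r)
    hv
    (wt := fun k => if (k : ℕ) + 1 = 1 then 1 / 2 else if (k : ℕ) + 1 = n + 2 then 1 / 2 else 1)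
    (fun G _ _ => by
      have e : (((2 * n + 2 : ℕ) : ℝ)) / 2 = n + 1 := by rw [hMR]; ring
      have e2 : ∀ k : Fin n, (k : ℕ) ≠ n := fun k => k.2.ne
      rw [Fin.sum_univ_succ, Fin.sum_univ_castSucc, Fin.sum_univ_succ (n := n + 1),
        Fin.sum_univ_castSucc (n := n), e]
      simp [e2]
      ring)
    (κ := fun j => n + 1 - (j : ℕ)) (fun j => by rw [hMR]; push_cast; ring)
    (S := Real.cos) (τ := 2) (by simp)
    (fun n x => by have := trig_one n x; push_cast at this ⊢; exact this)
    (R := rMatrix .D (n + 2) r t) one_ne_zero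
    (fun j k => by
      have hJ : indexJ .D ((j : ℕ) + 1) = (j : ℕ) + 0 := by simp only [indexJ]; push_cast; ring
      simp only [rMatrix, Matrix.of_apply, rEntry, hJ, exp_sq_tauVar hr, hcalN,
        angle_eq hr (hv k)]
      split_ifs with hk0 hk
      · have hk' : ((k : ℕ) : ℝ) = 0 := by exact_mod_cast Nat.succ_injective hk0
        rw [hk']
        simp
        ring
      · have hk' : ((k : ℕ) : ℝ) = n + 1 := by exact_mod_cast Nat.succ_injective hk
        rw [angle_half_eq (y := ((k : ℕ) + 0) / (2 * n + 2 : ℕ))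
          (by rw [hk', hMR]; field_simp; ring)]
        push_cast; ring
      · push_cast; ring)
    (c := 2) (A := Real.exp (2 * Real.log 2 + L * ((n + 2) * (n + 1) / 4)
      - (n + 2) * n * logEuler L))
    (Real.exp_pos _).ne'
    (by
      have h := det_cos (N := n + 2) (by omega)
        fun k : Fin (n + 2) => ((k : ℕ) + 0 : ℝ) / (2 * n + 2 : ℕ)
      have e : (2 : ℝ) * (∏ _l : Fin (n + 2), 1 / 2) = (1 / 2) ^ (n + 2 - 1) := by
        rw [prod_const, card_univ, Fintype.card_fin, Nat.add_sub_assoc (by omega), pow_add, pow_add]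
        norm_num
        ring
      rw [← mul_assoc, e, ← h]
      congr 1
      ext j k
      simp only [Matrix.of_apply, rev_cast, hMR]
      congr 2
      push_cast; ring)
    (by
      rw [sum_const_zero, zero_add, ← Real.exp_add, balance_D n hL, Real.exp_add,
        Real.exp_log two_pos])
    x
  rw [hT, bCoeff, hA]
  simpa [macdonaldW, denominator, pairFactor] using key

end Types

end

section

open Finset

/-! ### Type `A` -/

lemma neg_one_pow_mul_cis_circChar {N : ℕ} (hN : 1 ≤ N) :
    (-1 : ℂ) ^ (N - 1) * cis (-(circChar N : ℂ)) = 1 ∧ (-1 : ℂ) ^ (N - 1) = cis (-(circChar N : ℂ)) := by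
  obtain ⟨n, rfl⟩ : ∃ n, N = n + 1 := ⟨N - 1, by omega⟩
  unfold circChar
  split_ifs with h
  · have h' : Odd n := by
      rw [← Nat.not_even_iff_odd]; exact fun h2 => (Nat.even_add_one.1 h) h2
    rw [cis_neg_half_ofReal, Nat.add_sub_cancel, h'.neg_one_pow]
    norm_num
  · have h' : Even n := by
      by_contra h2; exact h (Nat.even_add_one.2 h2)
    rw [Nat.add_sub_cancel, h'.neg_one_pow]
    simp

lemma ite_theta_eq_thetaChar (N : ℕ) (L : ℝ) (x : ℂ) :
    (if Even N then theta0 else theta3) x (Complex.I * L / Real.pi)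
      = thetaChar L 0 (x + circChar N) := by
  unfold circChar
  split_ifs
  · rw [theta0_eq_thetaChar]; push_cast; rfl
  · rw [theta3_eq_thetaChar]; simp

/-- The left hand side of the determinantal formula of type `A`. The theta function of the sum of
the variables turns the slices of the Macdonald denominator into functions with constant
multipliers. -/
def cyclicDenominator (L : ℝ) {N : ℕ} (x : Fin N → ℂ) : ℂ :=
  thetaChar L 0 (∑ l, x l + circChar N)
    * ∏ j : Fin N, ∏ k ∈ Ioi j, theta1 (x k - x j) (Complex.I * L / Real.pi)

lemma cyclicDenominator_comp_perm (L : ℝ) {N : ℕ} (σ : Equiv.Perm (Fin N)) (x : Fin N → ℂ) :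
    cyclicDenominator L (x ∘ σ) = (Equiv.Perm.sign σ : ℤ) * cyclicDenominator L x := by
  have h := Equiv.Perm.prod_Ioi_comp_eq_sign_mul_prod σ
    (f := fun j k => theta1 (x k - x j) (Complex.I * L / Real.pi))
    fun j k => by rw [← theta1_neg, neg_sub]
  unfold cyclicDenominator
  simp only [Function.comp_apply]
  rw [h, Equiv.sum_comp σ fun l => x l]
  ring

open Function in
lemma quasiPeriodic_cyclicDenominator {L : ℝ} (hL : 0 < L) {N : ℕ} (hN : 1 ≤ N) (x : Fin N → ℂ)
    (i : Fin N) : QuasiPeriodic L N (cis ((-circChar N : ℝ) : ℂ)) (cis ((0 : ℝ) : ℂ))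
      fun z => cyclicDenominator L (update x i z) := by
  have h2 : ∀ c, QuasiPeriodic L 1 (-1) (-cis c)
      fun z => theta1 (z - c) (Complex.I * L / Real.pi) := fun c => by
    simpa [sub_eq_add_neg] using quasiPeriodic_theta1 (L := L) hL 1 1 (by simp) (-c)
  have h1 : ∀ c, QuasiPeriodic L 1 (-1) (-cis c)
      fun z => theta1 (c - z) (Complex.I * L / Real.pi) := fun c => by
    have := (h2 c).const_mul (-1)
    simpa only [neg_one_mul, ← theta1_neg, neg_sub] using this
  have hsum : ∀ z, ∑ l, update x i z l = z + ∑ l ∈ univ.erase i, x l := fun z => by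
    rw [← sum_erase_add univ _ (mem_univ i), update_self, add_comm]
    congr 1
    exact sum_congr rfl fun l hl => by rw [update_of_ne (ne_of_mem_erase hl)]
  have hprod : ∏ l ∈ univ.erase i, -cis (x l)
      = (-1) ^ (N - 1) * cis (∑ l ∈ univ.erase i, x l) := by
    have h3 : ∀ s : Finset (Fin N), ∏ l ∈ s, cis (x l) = cis (∑ l ∈ s, x l) := fun s => by
      induction s using Finset.induction_on with
      | empty => simp
      | insert j s hj ih => rw [prod_insert hj, sum_insert hj, cis_add, ih]
    rw [prod_neg, h3, card_erase_of_mem (mem_univ i), card_univ, Fintype.card_fin]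
  obtain ⟨e1, e2⟩ := neg_one_pow_mul_cis_circChar hN
  have h := (quasiPeriodic_thetaChar (L := L) hL 0 1 1 (by simp)
    (∑ l ∈ univ.erase i, x l + circChar N)).mul
    (quasiPeriodic_prod_pairs (F := fun u v => theta1 (v - u) (Complex.I * L / Real.pi))
      (b := fun c => -cis c) h1 h2 x i)
  have e3 : cis (-((1 : ℕ) : ℂ) * (∑ l ∈ univ.erase i, x l + circChar N))
      * ((-1) ^ (N - 1) * cis (∑ l ∈ univ.erase i, x l)) = cis ((0 : ℝ) : ℂ) := by
    have e4 : cis (-((1 : ℕ) : ℂ) * (∑ l ∈ univ.erase i, x l + circChar N))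
        * cis (∑ l ∈ univ.erase i, x l) = cis (-(circChar N : ℂ)) := by
      rw [← cis_add]; congr 1; push_cast; ring
    rw [Complex.ofReal_zero, cis_zero]
    linear_combination (-1) ^ (N - 1) * e4 + e1
  rw [hprod, e3, e2] at h
  have e5 : 1 * 1 + 1 * (N - 1) = N := by omega
  rw [e5] at h
  simpa [cyclicDenominator, hsum, add_assoc] using h

lemma quasiPeriodic_cyclicKernel {lam : ℝ} (hlam : 0 < lam) (h : ℝ) {M : ℕ} (m : ℤ) {y : ℝ}
    (hy : M * y = m) : QuasiPeriodic (M * lam) M (cis ((-h : ℝ) : ℂ)) (cis ((0 : ℝ) : ℂ))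
      fun z => thetaChar lam h (z - y) := by
  have hy' : (M : ℂ) * y = m := by exact_mod_cast hy
  have h1 := quasiPeriodic_thetaChar hlam h 1 M (L := M * lam) (by simp) (-y)
  have e1 : cis (-M * -(y : ℂ)) = cis ((0 : ℝ) : ℂ) := by
    rw [show -(M : ℂ) * -y = m by linear_combination hy', cis_int]; simp
  rw [e1] at h1
  simpa [sub_eq_add_neg] using h1

lemma thetaChar_zero_int (L : ℝ) (m : ℤ) : thetaChar L 0 m = thetaChar L 0 0 := by
  unfold thetaChar
  refine tsum_congr fun n => ?_
  have h : cis (((n : ℂ) - (0 : ℝ)) * m) = 1 := by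
    rw [show ((n : ℂ) - (0 : ℝ)) * m = ((n * m : ℤ) : ℂ) by push_cast; ring, cis_int]
  rw [thetaCharTerm, thetaCharTerm, h]; simp

lemma sum_nodes_add_circChar {N : ℕ} (hN : 1 ≤ N) :
    ∃ m : ℤ, ∑ l : Fin N, ((((l : ℕ) + 0 : ℝ) / N : ℝ) : ℂ) + circChar N = m := by
  have hN' : (N : ℝ) ≠ 0 := by positivity
  have h1 : ∑ l : Fin N, (((l : ℕ) + 0 : ℝ) / N) = (N - 1) / 2 := by
    simp only [add_zero]
    rw [← sum_div, sum_fin_cast]; field_simp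
  rw [← Complex.ofReal_sum, h1]
  unfold circChar
  split_ifs with h
  · obtain ⟨p, hp⟩ := h
    refine ⟨p, ?_⟩
    rw [hp]; push_cast; ring
  · obtain ⟨p, hp⟩ := Nat.not_even_iff_odd.1 h
    refine ⟨p, ?_⟩
    rw [hp]; push_cast; ring

/-- The value of `cyclicDenominator` at the nodes. Their sum is congruent to `-circChar N` modulo
`1`, so the theta function of the sum is the theta constant `thetaChar L 0 0`. -/
lemma cyclicDenominator_nodes {L : ℝ} (hL : 0 < L) {N : ℕ} (hN : 1 ≤ N) :
    cyclicDenominator L (fun l : Fin N => ((((l : ℕ) + 0 : ℝ) / N : ℝ) : ℂ))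
      = ((2 ^ (N * (N - 1) / 2) * (∏ j : Fin N, ∏ k ∈ Ioi j,
          Real.sin (Real.pi * (((k : ℕ) + 0) / N - ((j : ℕ) + 0) / N)))
        * Real.exp (5 * logEuler L - 2 * logEuler (L / 2) - 2 * logEuler (2 * L)
          + N * (N - 1) / 2 * (logEuler L - L / 4)
          + N * logEuler (N * L) - N * logEuler L) : ℝ) : ℂ) := by
  have hN' : (N : ℝ) ≠ 0 := by positivity
  obtain ⟨m, hm⟩ := sum_nodes_add_circChar hN
  have hθ := thetaChar_zero_eq_exp hL 0
  rw [zero_add, logCos_half_eq hL, logCos_half_eq (by positivity)] at hθ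
  have hcard : ∑ j : Fin N, ∑ _k ∈ Ioi j, (logEuler L - L / 4)
      = N * (N - 1) / 2 * (logEuler L - L / 4) := by
    have := sum_univ_eq_sum_pairs (N := N) (fun _ _ => logEuler L - L / 4) fun _ _ => rfl
    simp only [sum_const, card_univ, Fintype.card_fin, nsmul_eq_mul] at this ⊢
    linarith
  have hpairs : ∑ j : Fin N, ∑ k ∈ Ioi j,
      logCos L (((k : ℕ) + 0) / N - ((j : ℕ) + 0) / N)
      = N * logEuler (N * L) - N * logEuler L := by
    have h1 := sum_univ_eq_sum_pairs (N := N)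
      (fun j k => logCos L (((k : ℕ) + 0) / N - ((j : ℕ) + 0) / N)) fun j k => by
        rw [← logCos_neg]; congr 1; ring
    have h2 : ∀ j : Fin N, ∑ k : Fin N, logCos L (((k : ℕ) + 0) / N - ((j : ℕ) + 0) / N)
        = 2 * logEuler (N * L) := fun j => by
      rw [← logCos_int _ (-(j : ℕ) : ℤ)]
      have h3 := sum_logCos hL (by omega : 0 < N) (-(((j : ℕ) + 0) / N))
      rw [show (N : ℝ) * -(((j : ℕ) + 0) / N) = ((-(j : ℕ) : ℤ) : ℝ) by
        push_cast; field_simp; ring] at h3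
      rw [← h3, Fin.sum_univ_eq_sum_range
        (fun k => logCos L (((k : ℕ) + 0) / N - ((j : ℕ) + 0) / N))]
      refine sum_congr rfl fun k _ => ?_
      congr 1; ring
    simp only [h2, sub_self, logCos_zero, sum_const, card_univ, Fintype.card_fin,
      nsmul_eq_mul] at h1
    linarith
  have hθ1 : ∀ j k : Fin N, theta1 (((((k : ℕ) + 0 : ℝ) / N : ℝ) : ℂ)
        - ((((j : ℕ) + 0 : ℝ) / N : ℝ) : ℂ)) (Complex.I * L / Real.pi)
      = ((2 * Real.sin (Real.pi * (((k : ℕ) + 0) / N - ((j : ℕ) + 0) / N))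
        * (Real.exp (logEuler L - L / 4)
          * Real.exp (logCos L (((k : ℕ) + 0) / N - ((j : ℕ) + 0) / N))) : ℝ) : ℂ) := by
    intro j k
    rw [← Complex.ofReal_sub, theta1_eq_exp hL, ← Real.exp_add,
      show -(L / 4) + logEuler L = logEuler L - L / 4 by ring]
    push_cast; ring
  have hE : ∏ j : Fin N, ∏ k ∈ Ioi j, (Real.exp (logEuler L - L / 4)
      * Real.exp (logCos L (((k : ℕ) + 0) / N - ((j : ℕ) + 0) / N)))
      = Real.exp (N * (N - 1) / 2 * (logEuler L - L / 4)
        + (N * logEuler (N * L) - N * logEuler L)) := by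
    rw [← hcard, ← hpairs, ← sum_add_distrib, Real.exp_sum]
    refine prod_congr rfl fun j _ => ?_
    rw [← sum_add_distrib, Real.exp_sum]
    exact prod_congr rfl fun k _ => (Real.exp_add _ _).symm
  unfold cyclicDenominator
  rw [hm, thetaChar_zero_int]
  rw [Complex.ofReal_zero] at hθ
  rw [hθ]
  simp only [hθ1, ← Complex.ofReal_prod]
  rw [← Complex.ofReal_mul]
  congr 1
  simp only [prod_mul_distrib] at hE ⊢
  rw [hE]
  have h2 : ∏ j : Fin N, ∏ _k ∈ Ioi j, (2 : ℝ) = 2 ^ (N * (N - 1) / 2) := prod_pairs_const 2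
  rw [h2, show 5 * logEuler L - 2 * logEuler (L / 2) - 2 * logEuler (2 * L)
      + N * (N - 1) / 2 * (logEuler L - L / 4) + N * logEuler (N * L) - N * logEuler L
      = (logEuler L + 2 * (logEuler (2 * (L / 2)) - logEuler (L / 2))
        - 2 * (logEuler (2 * L) - logEuler L)) + (N * (N - 1) / 2 * (logEuler L - L / 4)
        + (N * logEuler (N * L) - N * logEuler L)) by
      rw [show 2 * (L / 2) = L by ring]; ring,
    Real.exp_add (_ - 2 * (logEuler (2 * L) - logEuler L))]
  ring

lemma sum_gaussExp_half {N : ℕ} (hN : 1 ≤ N) {L : ℝ} (hL : 0 < L) :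
    ∑ j : Fin N, gaussExp N L (j + 1 / 2) = L * (N ^ 2 / 4) + N * logEuler (N * L)
      + 2 * (2 * logEuler L - logEuler (L / 2) - logEuler (2 * L)) := by
  have hN' : (N : ℝ) ≠ 0 := by positivity
  have h1 := sum_logShift hL (by omega : 0 < N) (1 / 2)
  have h2 : ∑ i ∈ range N, logShift (N * L) (1 - (i + 1 / 2) / N) = logShift L (1 / 2) := by
    rw [← h1, ← sum_range_reflect]
    refine sum_congr rfl fun i hi => ?_
    have hi := mem_range.1 hi
    have : ((N - 1 - i : ℕ) : ℝ) = N - 1 - i := by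
      rw [Nat.sub_sub, Nat.cast_sub (by omega)]; push_cast; ring
    congr 1
    rw [this]; field_simp; ring
  have h3 : ∑ j : Fin N, -(L * (N / 4 - ((j : ℝ) + 1 / 2))) = L * (N ^ 2 / 4) := by
    rw [sum_neg_distrib, ← mul_sum, sum_sub_distrib, sum_add_distrib, sum_fin_cast]
    simp only [sum_const, card_univ, Fintype.card_fin, nsmul_eq_mul]
    ring
  simp only [gaussExp]
  rw [sum_add_distrib, h3, sum_add_distrib, sum_add_distrib,
    Fin.sum_univ_eq_sum_range (fun j => logShift (N * L) (((j : ℕ) + 1 / 2) / N)),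
    Fin.sum_univ_eq_sum_range (fun j => logShift (N * L) (1 - ((j : ℕ) + 1 / 2) / N)), h1, h2,
    logShift_half hL]
  simp only [sum_const, card_univ, Fintype.card_fin, nsmul_eq_mul]
  ring

/-- The power of `i` in the coefficient of type `A` cancels the one in `det_cis`. -/
lemma I_pow_mul_I_pow {N : ℕ} (hN : 1 ≤ N) :
    (if Even N then Complex.I ^ (N * (N + 1) / 2) else Complex.I ^ ((N - 1) * (N - 2) / 2))
      * Complex.I ^ (N * (N - 1) / 2) = 1 := by
  split_ifs with h
  · obtain ⟨p, hp⟩ := h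
    obtain ⟨q, rfl⟩ : ∃ q, p = q + 1 := ⟨p - 1, by omega⟩
    have e1 : N * (N + 1) / 2 = (q + 1) * (2 * q + 3) := by
      rw [show N * (N + 1) = 2 * ((q + 1) * (2 * q + 3)) by rw [hp]; ring]; omega
    have e2 : N * (N - 1) / 2 = (q + 1) * (2 * q + 1) := by
      rw [show N - 1 = 2 * q + 1 by omega,
        show N * (2 * q + 1) = 2 * ((q + 1) * (2 * q + 1)) by rw [hp]; ring]; omega
    rw [e1, e2, ← pow_add, show (q + 1) * (2 * q + 3) + (q + 1) * (2 * q + 1)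
      = 4 * (q + 1) ^ 2 by ring, pow_mul, Complex.I_pow_four, one_pow]
  · obtain ⟨p, hp⟩ := Nat.not_even_iff_odd.1 h
    have e2 : N * (N - 1) / 2 = p * (2 * p + 1) := by
      rw [show N - 1 = 2 * p by omega,
        show N * (2 * p) = 2 * (p * (2 * p + 1)) by rw [hp]; ring]; omega
    have e1 : (N - 1) * (N - 2) / 2 + p = 2 * p ^ 2 := by
      rw [show N - 1 = 2 * p by omega, show N - 2 = 2 * p - 1 by omega]
      rcases Nat.eq_zero_or_pos p with rfl | hp0
      · simp
      · obtain ⟨q, rfl⟩ : ∃ q, p = q + 1 := ⟨p - 1, by omega⟩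
        rw [show 2 * (q + 1) - 1 = 2 * q + 1 by omega,
          show 2 * (q + 1) * (2 * q + 1) = 2 * ((q + 1) * (2 * q + 1)) by ring,
          Nat.mul_div_cancel_left _ two_pos]
        ring
    rw [e2, ← pow_add, show (N - 1) * (N - 2) / 2 + p * (2 * p + 1)
      = ((N - 1) * (N - 2) / 2 + p) + 2 * p ^ 2 by ring, e1,
      show 2 * p ^ 2 + 2 * p ^ 2 = 4 * p ^ 2 by ring, pow_mul, Complex.I_pow_four, one_pow]

theorem macdonaldW_A {N : ℕ} (hN : 1 ≤ N) {r t : ℝ} (hr : 0 < r) (ht : 0 < t) (x : Fin N → ℝ) :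
    (if Even N then theta0 else theta3) (∑ j, xiVar r (x j)) (N * tauVar r t)
        * macdonaldW .A (fun j => xiVar r (x j)) (N * tauVar r t)
      = bCoeff .A N r t * (kmlgvDet (pCirc N r) 0 (vConf .A N r) t x : ℂ) := by
  have hN0 : 0 < N := hN
  have hN' : (N : ℝ) ≠ 0 := by positivity
  have hNC : (N : ℂ) ≠ 0 := by exact_mod_cast hN'
  have hrC : (r : ℂ) ≠ 0 := by exact_mod_cast hr.ne'
  have hpi : (Real.pi : ℂ) ≠ 0 := by exact_mod_cast Real.pi_ne_zero
  have hT := calN_mul_tauVar (R := .A) (N := N) (M := N) rfl hr t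
  set lam : ℝ := t / (2 * r ^ 2) with hlam_def
  have hlam : 0 < lam := by positivity
  set L : ℝ := N * lam with hL_def
  have hL : 0 < L := by positivity
  have hT' : (N : ℂ) * tauVar r t = Complex.I * L / Real.pi := by rw [← hT]; simp [calN]
  let h : ℝ := circChar N
  let y : Fin N → ℝ := fun k => ((k : ℕ) + 0) / N
  have hv : ∀ k : Fin N, vConf .A N r k = 2 * Real.pi * r * y k := fun k => by
    simp only [vConf, vPoint, y]; push_cast; ring
  let A : ℝ := Real.exp (L * (N * (3 * N - 1) / 8) - (N - 1) * (N - 2) / 2 * logEuler L)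
  have hA : aCoeff .A N r t = A := by
    have hz : ((-(((N : ℤ) - 1) * ((N : ℤ) - 2) / 2) : ℤ) : ℝ) = -((N - 1) * (N - 2) / 2) := by
      obtain ⟨q, hq⟩ : (2 : ℤ) ∣ ((N : ℤ) - 1) * ((N : ℤ) - 2) := by
        have := Int.even_mul_pred_self ((N : ℤ) - 1)
        rw [sub_sub] at this
        exact this.two_dvd
      have hq' : ((N : ℝ) - 1) * (N - 2) = 2 * q := by exact_mod_cast hq
      rw [hq, hq', Int.mul_ediv_cancel_left _ two_ne_zero]
      push_cast; ring
    simp only [aCoeff, hT]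
    rw [nome_cpow L (-(N * (3 * N - 1) / 8)) (by push_cast; ring), nomeProd_zpow hL _ hz,
      ← Complex.ofReal_mul, ← Real.exp_add]
    congr 2; ring
  -- interpolation
  let kern : Fin N → ℂ → ℂ := fun j z => 1 / (2 * Real.pi * r) * thetaChar lam h (z - y j)
  have hint := alternating_mul_det_eq (quasiPeriodicSubmodule L N (cis ((-h : ℝ) : ℂ))
      (cis ((0 : ℝ) : ℂ))) y
    (fun f hf hz u => QuasiPeriodic.eq_zero_of_lattice hN0 hf (fun i hi => hz ⟨i, hi⟩) u)
    (cyclicDenominator L) (quasiPeriodic_cyclicDenominator hL hN)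
    (cyclicDenominator_comp_perm L) kern
    (fun j => Submodule.smul_mem _ (1 / (2 * Real.pi * r) : ℂ)
      (quasiPeriodic_cyclicKernel hlam h (M := N) (j : ℕ) (y := y j)
        (by simp only [y]; push_cast; field_simp; ring)))
    (fun l => x l / (2 * Real.pi * r))
  have hK : ∀ u : Fin N → ℝ, (Matrix.of fun j l => kern j ((u l / (2 * Real.pi * r) : ℝ) : ℂ)).det
      = (kmlgvDet (pCirc N r) 0 (vConf .A N r) t u : ℂ) := by
    intro u
    rw [kmlgvDet, ← Complex.ofRealHom_eq_coe, RingHom.map_det]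
    congr 1
    ext j l
    have e : u l = 2 * Real.pi * r * (u l / (2 * Real.pi * r)) := by
      have := Real.pi_ne_zero
      field_simp
    simp only [RingHom.mapMatrix_apply, Matrix.map_apply, Matrix.of_apply,
      Complex.ofRealHom_eq_coe, kern]
    rw [hv j, ← pCirc_eq hr ht]
    congr 2
    rw [← e]
  -- the matrix `R` diagonalizes the kernel at the nodes
  have hRP : rMatrix .A N r t * (Matrix.of fun j l => kern j (y l))
      = Matrix.of fun j l : Fin N => (Real.exp (gaussExp N L (j + 1 / 2)) : ℂ)
        * cis (((j : ℕ) - ((N : ℂ) - 1) / 2) * y l) := by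
    ext j l
    rw [Matrix.mul_apply, Matrix.of_apply]
    obtain ⟨κ, hκ⟩ : ∃ κ : ℤ, (κ : ℝ) - h = (j : ℕ) - ((N : ℝ) - 1) / 2 := by
      simp only [h, circChar]
      split_ifs with hev
      · obtain ⟨p, hp⟩ := hev
        have hpR : (N : ℝ) = p + p := by exact_mod_cast hp
        exact ⟨(j : ℕ) + 1 - p, by rw [hpR]; push_cast; ring⟩
      · obtain ⟨p, hp⟩ := Nat.not_even_iff_odd.1 hev
        have hpR : (N : ℝ) = 2 * p + 1 := by exact_mod_cast hp
        exact ⟨(j : ℕ) - p, by rw [hpR]; push_cast; ring⟩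
    have hκC : (κ : ℂ) - h = (j : ℕ) - ((N : ℂ) - 1) / 2 := by
      have := congrArg (fun u : ℝ => (u : ℂ)) hκ
      push_cast at this
      exact this
    have key := sum_cis_mul_thetaChar hlam hN0 h 0 κ (l : ℕ) (z := y l) (by simp [y])
    have hg := exp_mul_gaussSum_eq hlam hN0 hL_def ((j : ℕ) + 1 / 2)
    rw [← gaussSum_neg, show -((N : ℝ) / 2 - ((j : ℕ) + 1 / 2)) = κ - h by rw [hκ]; ring] at hg
    rw [hκC] at key
    rw [← hg]
    have e2 : ∀ k : Fin N, rMatrix .A N r t j k * (Matrix.of fun j l => kern j (y l)) k l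
        = 1 / N * Real.exp (lam * ((j : ℕ) + 1 / 2) ^ 2)
          * (cis (((j : ℕ) - ((N : ℂ) - 1) / 2) * (((k : ℕ) + (0 : ℝ)) / N))
            * thetaChar lam h (y l - ((k : ℕ) + (0 : ℝ)) / N)) := fun k => by
      have hJ : indexJ .A ((j : ℕ) + 1) = (j : ℕ) + 1 / 2 := by simp only [indexJ]; push_cast; ring
      have hvk : vPoint .A N r ((k : ℕ) + 1) = 2 * Real.pi * r * y k := hv k
      have e3 : Complex.exp (-Complex.I * ((calN .A N - 2 * ((j : ℕ) + 1 / 2) : ℝ) : ℂ)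
          * ((2 * Real.pi * r * y k : ℝ) : ℂ) / (2 * r))
          = cis (((j : ℕ) - ((N : ℂ) - 1) / 2) * (((k : ℕ) + (0 : ℝ)) / N)) := by
        simp only [cis, calN, y]
        congr 1
        push_cast
        field_simp
        ring
      have e4 : kern k (y l) = 1 / (2 * Real.pi * r)
          * thetaChar lam h (y l - ((k : ℕ) + (0 : ℝ)) / N) := by
        simp only [kern, y]; push_cast; rfl
      simp only [rMatrix, Matrix.of_apply, rEntry]
      rw [hJ, hvk, sub_eq_add_neg _ (_ / (2 * (r : ℂ))), Complex.exp_add, exp_sq_tauVar hr,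
        ← hlam_def, e4,
        ← e3, ← neg_div, ← neg_mul, ← neg_mul]
      simp only [calN, Complex.ofReal_natCast]
      generalize thetaChar lam h (y l - ((k : ℕ) + (0 : ℝ)) / N) = Θ
      generalize ((Real.exp (lam * ((j : ℕ) + 1 / 2) ^ 2) : ℝ) : ℂ) = E
      field_simp
    simp only [e2]
    rw [← mul_sum, Fin.sum_univ_eq_sum_range
      (fun k => cis (((j : ℕ) - ((N : ℂ) - 1) / 2) * (((k : ℕ) + (0 : ℝ)) / N))
            * thetaChar lam h (y l - ((k : ℕ) + (0 : ℝ)) / N)), key]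
    push_cast
    field_simp
  have hval := cyclicDenominator_nodes hL hN
  have hbal : A * Real.exp (5 * logEuler L - 2 * logEuler (L / 2) - 2 * logEuler (2 * L)
      + N * (N - 1) / 2 * (logEuler L - L / 4) + N * logEuler (N * L) - N * logEuler L)
      = Real.exp (∑ j : Fin N, gaussExp N L (j + 1 / 2)) := by
    rw [sum_gaussExp_half hN hL, ← Real.exp_add]
    congr 1; ring
  have hbalC := congrArg (fun u : ℝ => (u : ℂ)) hbal
  simp only [Complex.ofReal_mul] at hbalC
  let ι : ℂ := if Even N then Complex.I ^ (N * (N + 1) / 2)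
    else Complex.I ^ ((N - 1) * (N - 2) / 2)
  have hι : ι * Complex.I ^ (N * (N - 1) / 2) = 1 := I_pow_mul_I_pow hN
  have hdet : (ι * (rMatrix .A N r t).det) * (Matrix.of fun j l => kern j (y l)).det
      = A * cyclicDenominator L (fun l => y l) := by
    have hcol := Matrix.det_mul_column
      (fun j : Fin N => (Real.exp (gaussExp N L (j + 1 / 2)) : ℂ))
      (Matrix.of fun j k : Fin N => cis (((j : ℕ) - ((N : ℂ) - 1) / 2) * y k))
    simp only [Matrix.of_apply] at hcol
    rw [mul_assoc, ← Matrix.det_mul, hRP, hcol, det_cis, hval, ← Complex.ofReal_prod,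
      ← Real.exp_sum, mul_pow]
    simp only [Complex.ofReal_mul, Complex.ofReal_pow, Complex.ofReal_ofNat, Complex.ofReal_prod]
    simp only [y]
    linear_combination (Real.exp (∑ j : Fin N, gaussExp N L (j + 1 / 2)) * 2 ^ (N * (N - 1) / 2)
      * ∏ j : Fin N, ∏ k ∈ Ioi j,
        ((Real.sin (Real.pi * (((k : ℕ) + 0) / N - ((j : ℕ) + 0) / N)) : ℝ) : ℂ)) * hι
      - (2 ^ (N * (N - 1) / 2) * ∏ j : Fin N, ∏ k ∈ Ioi j,
        ((Real.sin (Real.pi * (((k : ℕ) + 0) / N - ((j : ℕ) + 0) / N)) : ℝ) : ℂ)) * hbalC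
  have hne : cyclicDenominator L (fun l => y l) ≠ 0 := by
    rw [hval]
    have hpos : 0 < ∏ j : Fin N, ∏ k ∈ Ioi j,
        Real.sin (Real.pi * (((k : ℕ) + 0) / N - ((j : ℕ) + 0) / N)) := by
      refine prod_pos fun j _ => prod_pos fun k hk => ?_
      have hjk : (j : ℝ) < k := by exact_mod_cast mem_Ioi.1 hk
      have hkN : (k : ℝ) < N := by exact_mod_cast k.2
      have hj : (0 : ℝ) ≤ j := Nat.cast_nonneg _
      have hNpos : (0 : ℝ) < N := by exact_mod_cast hN0
      rw [← sub_div]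
      have h0 : 0 < ((k : ℝ) + 0 - (j + 0)) / N := div_pos (by linarith) hNpos
      have h1 : ((k : ℝ) + 0 - (j + 0)) / N < 1 := (div_lt_one hNpos).2 (by linarith)
      apply Real.sin_pos_of_pos_of_lt_pi (mul_pos Real.pi_pos h0)
      nlinarith [Real.pi_pos]
    exact_mod_cast mul_ne_zero (mul_ne_zero (by positivity) hpos.ne') (Real.exp_pos _).ne'
  have hAC : (A : ℂ) ≠ 0 := by exact_mod_cast (Real.exp_pos _).ne'
  rw [hK] at hint
  have hfin := eq_div_mul_of_node_values hint hdet hAC hne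
  have hb : bCoeff .A N r t = ι * (rMatrix .A N r t).det / A := by
    simp only [bCoeff, hA, ι]
    split_ifs <;> ring
  rw [hb, ← hfin, hT', ite_theta_eq_thetaChar]
  simp only [macdonaldW, cyclicDenominator, xiVar_eq]

end

end MacdonaldKM

end

open MacdonaldKM in
theorem proposition4p2 (N : ℕ) (hN : 1 ≤ N) (r t : ℝ) (hr : 0 < r) (ht : 0 < t)
    (x : Fin N → ℝ) :
    ((if Even N then theta0 else theta3) (∑ j, xiVar r (x j)) (N * tauVar r t)
        * macdonaldW .A (fun j => xiVar r (x j)) (N * tauVar r t)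
      = bCoeff .A N r t * (kmlgvDet (pCirc N r) 0 (vConf .A N r) t x : ℂ))
    ∧ (∀ R : RootType, R = .B ∨ R = .Cv ∨ R = .BC →
      macdonaldW R (fun j => xiVar r (x j)) (calN R N * tauVar r t)
        = bCoeff R N r t * (kmlgvDet (pAr r) 0 (vConf R N r) t x : ℂ))
    ∧ (∀ R : RootType, R = .Bv ∨ R = .C →
      macdonaldW R (fun j => xiVar r (x j)) (calN R N * tauVar r t)
        = bCoeff R N r t * (kmlgvDet (pAa r) 0 (vConf R N r) t x : ℂ))
    ∧ (2 ≤ N →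
      macdonaldW .D (fun j => xiVar r (x j)) (calN .D N * tauVar r t)
        = bCoeff .D N r t * (kmlgvDet (pRr r) 0 (vConf .D N r) t x : ℂ)) := by
  refine ⟨macdonaldW_A hN hr ht x, ?_, ?_, ?_⟩
  · rintro R (rfl | rfl | rfl)
    · obtain ⟨n, rfl⟩ := Nat.exists_eq_add_of_le' hN
      exact macdonaldW_B n hr ht x
    · obtain ⟨n, rfl⟩ := Nat.exists_eq_add_of_le' hN
      exact macdonaldW_Cv n hr ht x
    · exact macdonaldW_BC hN hr ht x
  · rintro R (rfl | rfl)
    · obtain ⟨n, rfl⟩ := Nat.exists_eq_add_of_le' hN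
      exact macdonaldW_Bv n hr ht x
    · exact macdonaldW_C hN hr ht x
  · intro h2
    obtain ⟨n, rfl⟩ := Nat.exists_eq_add_of_le' h2
    exact macdonaldW_D n hr ht x
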